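/- **Model.** Algorithms are deterministic programs for the word RAM with finitely many registers and arrays, all holding $w$-bit words (two's complement), with unit-cost arithmetic, bitwise operations, shifts, comparisons and indirect array access. A decision problem is solvable in time $O(T)$ if there are a program and constants $c, C$ such that, on every instance $x$ and for every word length $w \ge c\log_2 U$, where $U$ bounds the length of the input and the absolute values of the input integers, the program halts with the correct answer after at most $C\,T(x)$ steps. **$k$-SUM.** Given $k$ sets $A_1,\dots,A_k$ of positive integers, of size $n \ge 1$ each, are there $a_i\in A_i$ with $a_1=a_2+\dots+a_k$? The *$k$-SUM hypothesis* says that for no integer $k\ge 2$ and no $\varepsilon>0$ can $k$-SUM be solved in time $O(n^{\lceil k/2\rceil-\varepsilon})$. **Polygon overlap.** Given two simple polygons $P$ and $Q$ with $n$ and $m$ vertices, where $m\le n$, with integer vertex coordinates and all of whose edges are horizontal, vertical or parallel to the diagonal $\{y=x\}$, and given a positive integer $\delta$, is there a translation $\tau\in\mathbb R^2$ with $\operatorname{area}(P\cap(Q+\tau))>\delta$? (Consecutive edges of a polygon are not parallel.) **Theorem 2.** Assume the $k$-SUM hypothesis. Then for no $\varepsilon>0$ can polygon overlap be solved in time $O\big(\max(n^2,nm^2)^{1-\varepsilon}\big)$.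 Moreover, this holds in every regime $m=\Theta(n^\gamma)$: for every rational $\gamma\in[0,1]$ there is a constant $c>0$ such that for no $\varepsilon>0$ can polygon overlap, restricted to the instances with $m \le n$, $n^\gamma\le c\,m$ and $m\le c\,n^\gamma$, be solved in time $O\big(\max(n^2,nm^2)^{1-\varepsilon}\big)$. -/

import Mathlib

/-! ## Word RAM

A program manipulates finitely many registers and finitely many arrays, all of whose entries are
`w`-bit words; arrays are indexed by words.  Every instruction and every evaluation of a branching
or loop condition costs one time unit.  The word length `w` is a parameter of the execution, not
of the program. -/

/-- Binary word operations.  Arithmetic is modulo `2 ^ w`; `lt` and `eq` are (unsigned)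
comparisons with result `0` or `1`. -/
inductive WordOp : Type
  | add | sub | mul | div | mod | and | or | xor | shl | shr | lt | eq

/-- The value of a word operation. -/
def WordOp.eval {w : ℕ} : WordOp → BitVec w → BitVec w → BitVec w
  | .add, x, y => x + y
  | .sub, x, y => x - y
  | .mul, x, y => x * y
  | .div, x, y => x / y
  | .mod, x, y => x % y
  | .and, x, y => x &&& y
  | .or, x, y => x ||| y
  | .xor, x, y => x ^^^ y
  | .shl, x, y => x <<< y.toNat
  | .shr, x, y => x >>> y.toNat
  | .lt, x, y => if x.toNat < y.toNat then 1 else 0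
  | .eq, x, y => if x = y then 1 else 0

/-- Word RAM programs.  Registers and arrays are named by natural numbers. -/
inductive Prog : Type
  /-- do nothing -/
  | skip : Prog
  /-- `r := c` -/
  | const (r c : ℕ) : Prog
  /-- `r := x o y` for registers `r`, `x`, `y` -/
  | op (o : WordOp) (r x y : ℕ) : Prog
  /-- `r := a[i]` for registers `r`, `i` and an array `a` -/
  | load (r a i : ℕ) : Prog
  /-- `a[i] := r` for registers `r`, `i` and an array `a` -/
  | store (a i r : ℕ) : Prog
  /-- run the first program, then the second one -/
  | seq (p q : Prog) : Prog
  /-- run `p` if register `r` is nonzero, and `q` otherwise -/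
  | ite (r : ℕ) (p q : Prog) : Prog
  /-- repeat `p` as long as register `r` is nonzero -/
  | loop (r : ℕ) (p : Prog) : Prog

/-- A memory state of the word RAM with word length `w`. -/
structure RamState (w : ℕ) where
  /-- contents of the registers -/
  reg : ℕ → BitVec w
  /-- contents of the arrays -/
  arr : ℕ → BitVec w → BitVec w

/-- The state after `r := v`. -/
def RamState.setReg {w : ℕ} (s : RamState w) (r : ℕ) (v : BitVec w) : RamState w :=
  { s with reg := Function.update s.reg r v }

/-- The state after `a[i] := v`. -/
def RamState.setArr {w : ℕ} (s : RamState w) (a : ℕ) (i v : BitVec w) : RamState w :=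
  { s with arr := Function.update s.arr a (Function.update (s.arr a) i v) }

/-- The initial state: the input is written to array `0`, one entry per cell (integers in two's
complement); everything else is `0`. -/
def RamState.init (w : ℕ) (input : List ℤ) : RamState w where
  reg := fun _ => 0
  arr := fun a i => if a = 0 then BitVec.ofInt w (input.getD i.toNat 0) else 0

/-- `Exec p s s' t`: started in state `s`, the program `p` halts in state `s'` after exactly `t`
time units. -/
inductive Exec {w : ℕ} : Prog → RamState w → RamState w → ℕ → Prop
  | skip (s : RamState w) : Exec .skip s s 1
  | const (s : RamState w) (r c : ℕ) :
      Exec (.const r c) s (s.setReg r (BitVec.ofNat w c)) 1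
  | op (s : RamState w) (o : WordOp) (r x y : ℕ) :
      Exec (.op o r x y) s (s.setReg r (o.eval (s.reg x) (s.reg y))) 1
  | load (s : RamState w) (r a i : ℕ) :
      Exec (.load r a i) s (s.setReg r (s.arr a (s.reg i))) 1
  | store (s : RamState w) (a i r : ℕ) :
      Exec (.store a i r) s (s.setArr a (s.reg i) (s.reg r)) 1
  | seq {p q : Prog} {s s₁ s₂ : RamState w} {t₁ t₂ : ℕ} :
      Exec p s s₁ t₁ → Exec q s₁ s₂ t₂ → Exec (.seq p q) s s₂ (t₁ + t₂)
  | ite_true {r : ℕ} {p q : Prog} {s s₁ : RamState w} {t : ℕ} :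
      s.reg r ≠ 0 → Exec p s s₁ t → Exec (.ite r p q) s s₁ (t + 1)
  | ite_false {r : ℕ} {p q : Prog} {s s₁ : RamState w} {t : ℕ} :
      s.reg r = 0 → Exec q s s₁ t → Exec (.ite r p q) s s₁ (t + 1)
  | loop_false {r : ℕ} {p : Prog} {s : RamState w} :
      s.reg r = 0 → Exec (.loop r p) s s 1
  | loop_true {r : ℕ} {p : Prog} {s s₁ s₂ : RamState w} {t₁ t₂ : ℕ} :
      s.reg r ≠ 0 → Exec p s s₁ t₁ → Exec (.loop r p) s₁ s₂ t₂ →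
        Exec (.loop r p) s s₂ (t₁ + t₂ + 1)

/-- The decision problem with instances `x : I` satisfying `dom x`, input strings `enc x` and
answers `ans x` can be solved in time `O(T x)` on the word RAM: there are a program and constants
`c` and `C` such that, on every instance and for every word length `w ≥ c * log₂ U`, where `U`
bounds the length of the input and the absolute values of its entries, the program halts within
`C * T x` time units, with a nonzero value in register `0` if and only if the answer is yes. -/
def SolvableInTime {I : Type} (dom : I → Prop) (enc : I → List ℤ) (ans : I → Prop)
    (T : I → ℝ) : Prop :=
  ∃ (p : Prog) (c : ℕ) (C : ℝ), ∀ x : I, dom x →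
    ∀ U w : ℕ, (enc x).length ≤ U → (∀ z ∈ enc x, z.natAbs ≤ U) → U ^ c ≤ 2 ^ w →
      ∃ (s : RamState w) (t : ℕ), Exec p (RamState.init w (enc x)) s t ∧
        (t : ℝ) ≤ C * T x ∧ (s.reg 0 ≠ 0 ↔ ans x)

/-! ## The `k`-SUM problem -/

/-- An instance of `k`-SUM: `k` sets of positive integers, of size `n ≥ 1` each.  Each set is given
as a list without repetitions, in arbitrary order. -/
structure KSumInstance (k : ℕ) where
  n : ℕ
  n_pos : 0 < n
  A : Fin k → List ℕ
  length_eq : ∀ j, (A j).length = n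
  nodup : ∀ j, (A j).Nodup
  pos : ∀ j, ∀ a ∈ A j, 0 < a

/-- The input string of a `k`-SUM instance: `n`, followed by the `k` lists. -/
def KSumInstance.enc {k : ℕ} (x : KSumInstance k) : List ℤ :=
  (x.n : ℤ) :: (List.ofFn x.A).flatten.map (fun a => (a : ℤ))

/-- Is there a choice of one element of each set such that the first element is the sum of all the
others? -/
def KSumInstance.HasSolution {k : ℕ} [NeZero k] (x : KSumInstance k) : Prop :=
  ∃ a : Fin k → ℕ, (∀ j, a j ∈ x.A j) ∧ a 0 = ∑ j ∈ Finset.univ.erase 0, a j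

/-- The `k`-SUM hypothesis: for no `k ≥ 2` and `ε > 0` can `k`-SUM be solved in time
`O(n ^ (⌈k / 2⌉ - ε))`. -/
def KSumHypothesis : Prop :=
  ∀ (k : ℕ) [NeZero k], 2 ≤ k → ∀ ε : ℝ, 0 < ε →
    ¬ SolvableInTime (fun _ : KSumInstance k => True) KSumInstance.enc KSumInstance.HasSolution
      (fun x => (x.n : ℝ) ^ ((⌈(k : ℝ) / 2⌉₊ : ℝ) - ε))

/-! ## Polygons -/

/-- An integer point as a point of the plane. -/
def toPlane (a : ℤ × ℤ) : ℝ × ℝ := ((a.1 : ℝ), (a.2 : ℝ))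

/-- The edges of the closed polygonal chain through the given vertices, in cyclic order. -/
def polyEdges (l : List (ℤ × ℤ)) : List ((ℤ × ℤ) × (ℤ × ℤ)) := l.zip (l.rotate 1)

/-- An edge as a closed segment in the plane. -/
def edgeSegment (e : (ℤ × ℤ) × (ℤ × ℤ)) : Set (ℝ × ℝ) := segment ℝ (toPlane e.1) (toPlane e.2)

/-- Two edges are not parallel. -/
def NotParallel (e f : (ℤ × ℤ) × (ℤ × ℤ)) : Prop :=
  (e.2.1 - e.1.1) * (f.2.2 - f.1.2) ≠ (e.2.2 - e.1.2) * (f.2.1 - f.1.1)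

/-- The cyclic sequence `l` of integer points is the vertex sequence of a simple polygon: there are
at least three vertices, they are distinct, any two edges meet at most in common endpoints, and
consecutive edges are not parallel (no vertex has a straight angle). -/
def IsSimplePolygon (l : List (ℤ × ℤ)) : Prop :=
  3 ≤ l.length ∧ l.Nodup ∧
    (polyEdges l).Pairwise (fun e f => edgeSegment e ∩ edgeSegment f ⊆
      ({toPlane e.1, toPlane e.2} : Set (ℝ × ℝ)) ∩ {toPlane f.1, toPlane f.2}) ∧
    ∀ ef ∈ (polyEdges l).zip ((polyEdges l).rotate 1), NotParallel ef.1 ef.2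

/-- Every edge is horizontal, vertical, or parallel to the diagonal `{(x, y) | y = x}`. -/
def EdgesAdmissible (l : List (ℤ × ℤ)) : Prop :=
  ∀ e ∈ polyEdges l, e.1.2 = e.2.2 ∨ e.1.1 = e.2.1 ∨ e.2.1 - e.1.1 = e.2.2 - e.1.2

/-- The vertical upward ray starting at `p` crosses the edge `e`: the half-open range of
`x`-coordinates of `e` contains the one of `p`, and the point of `e` with this `x`-coordinate lies
above `p`. -/
def CrossesAbove (p : ℝ × ℝ) (e : (ℤ × ℤ) × (ℤ × ℤ)) : Prop :=
  (((e.1.1 : ℝ) ≤ p.1 ∧ p.1 < e.2.1) ∨ ((e.2.1 : ℝ) ≤ p.1 ∧ p.1 < e.1.1)) ∧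
    p.2 < e.1.2 + (p.1 - e.1.1) * (e.2.2 - e.1.2) / (e.2.1 - e.1.1)

open Classical in
/-- The closed region bounded by the polygon with vertex sequence `l`: the points on the edges and
the points enclosed by them, that is, those from which a ray to infinity crosses an odd number of
edges. -/
noncomputable def polyRegion (l : List (ℤ × ℤ)) : Set (ℝ × ℝ) :=
  {p | (∃ e ∈ polyEdges l, p ∈ edgeSegment e) ∨
    Odd ((polyEdges l).countP (fun e => decide (CrossesAbove p e)))}

/-! ## The polygon overlap problem -/

/-- An instance of the polygon overlap problem: two simple polygons, with integer vertices and with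
horizontal, vertical and diagonal edges only, and a positive integer threshold. -/
structure OverlapInstance where
  P : List (ℤ × ℤ)
  Q : List (ℤ × ℤ)
  δ : ℕ
  simple_P : IsSimplePolygon P
  simple_Q : IsSimplePolygon Q
  admissible_P : EdgesAdmissible P
  admissible_Q : EdgesAdmissible Q
  δ_pos : 0 < δ

/-- The number of vertices of `P`. -/
def OverlapInstance.n (x : OverlapInstance) : ℕ := x.P.length

/-- The number of vertices of `Q`. -/
def OverlapInstance.m (x : OverlapInstance) : ℕ := x.Q.length

/-- The input string of an instance: `n`, `m`, `δ`, and the coordinates of the vertices of `P` and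
of `Q`. -/
def OverlapInstance.enc (x : OverlapInstance) : List ℤ :=
  (x.n : ℤ) :: (x.m : ℤ) :: (x.δ : ℤ) :: (x.P ++ x.Q).flatMap (fun a => [a.1, a.2])

/-- Is there a translation `τ` of the plane such that `P ∩ (Q + τ)` has area larger than `δ`? -/
def OverlapInstance.HasOverlap (x : OverlapInstance) : Prop :=
  ∃ τ : ℝ × ℝ, (x.δ : ENNReal) <
    MeasureTheory.volume (polyRegion x.P ∩ (fun q => q + τ) '' polyRegion x.Q)

/-- The polygon overlap problem, restricted to the instances in `dom`, can be solved in time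
`O(max(n², n m²) ^ (1 - ε))`. -/
def OverlapSolvable (dom : OverlapInstance → Prop) (ε : ℝ) : Prop :=
  SolvableInTime dom OverlapInstance.enc OverlapInstance.HasOverlap
    (fun x => (max ((x.n : ℝ) ^ 2) ((x.n : ℝ) * (x.m : ℝ) ^ 2)) ^ (1 - ε))

/-! The lower bound comes from 5-SUM if γ ≥ 1/2 and from 3-SUM if γ ≤ 1/2. Both go through one
geometric gadget: families X₁, X₂, X₃ of n numbers and Y₁, Y₂ of m numbers become polygons P and Q
with O(n) and O(m) vertices whose overlap can exceed the threshold if and only if X₁ = X₂ + X₃ + Y₁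
+ Y₂ has a solution (`SumData.hasOverlap_iff`).

P is a comb that carries, on thin stems, n vertical, n horizontal and n diagonal bars of width W and
length H; their offsets encode X₁, X₂ and X₃ in units of 4W. Q is a comb with long teeth of the same
width W: m vertical and m horizontal ones, whose offsets encode Y₁ and Y₂ on top of a coarse grid of
mesh M, and 2m diagonal ones that just form a coarse grid. A translation (u, v) that puts a vertical
bar into a vertical tooth fixes u; a horizontal match fixes v, and a diagonal match fixes u - v.
Three simultaneous matches therefore mean one linear equation. The mesh is large compared with the
numbers, so the equation splits into a coarse part, which says that the diagonal tooth has index j₁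
+ j₂, and a fine part, which is the equation to be solved (`solution_of_rel`).

A solution thus gives a translation for which three whole bars, of total area 3WH, are covered
(`exists_overlap_of_solution`). Conversely, fix any translation. In each direction at most one bar
can touch a parallel tooth, since the relative offsets of different bars are at least 4W apart. A
bar and a tooth of different directions cross in area W², and stems and spines are thin. So if one
direction has no contact, the overlap is at most 2WH plus a small error (`volume_inter_le`). An
overlap above 3WH - 1 hence forces a contact in every direction, each exact up to W; the accumulated
error 3W is less than the unit 4W, and the equation holds exactly (`exists_solution_of_overlap`).

The regions are given by the even-odd rule. Crossing numbers modulo 2 are sums over edges, so the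
region of a comb is found tooth by tooth: each tooth, closed by a piece of the spine, contributes
its own indicator function up to the boundary (`parity_comb` and the lemmas on covers and open
parts). Simplicity of the polygons is proved by separating edges with linear functionals, the teeth
being confined between parallel cuts (`pairwise_flatMap_of_cuts`).

For γ = a / b choose m about N^γ. If γ ≥ 1/2, cut the fourth and the fifth set of a 5-SUM instance
into about N / m pieces of length m and ask one overlap query for each pair of pieces. An algorithm
with time (n m²)^(1-ε) would solve 5-SUM in time about (N / m)² (N m²)^(1-ε) ≤ N^(3-ε). If γ ≤ 1/2,
take Y₁ = Y₂ = 0 and a single query; then m² = O(N), and 3-SUM would be solved in time O(N^(2-ε)).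
The bound without a regime is the case γ = 0, whose instances form a subclass.

Since the model is a concrete machine, the reduction is a concrete program
(`exists_exec_reduction`). It is verified with Hoare triples over a ghost state that records
variables and output. The assumed algorithm is run on a simulated memory whose entries carry time
stamps, so that a fresh memory for the next query costs only constant time. -/

/-! ## Closed polygonal chains -/

/-- The value of the linear functional with coefficients `k` at an integer point. -/
def lin (k v : ℤ × ℤ) : ℤ := k.1 * v.1 + k.2 * v.2

/-- The value of the linear functional with coefficients `k` at a point of the plane. -/
def linR (k : ℤ × ℤ) (z : ℝ × ℝ) : ℝ := k.1 * z.1 + k.2 * z.2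

/-- Two edges meet at most in common endpoints, and they start in different points. -/
def MeetsAtEnds (e f : (ℤ × ℤ) × (ℤ × ℤ)) : Prop :=
  (edgeSegment e ∩ edgeSegment f ⊆
      ({toPlane e.1, toPlane e.2} : Set (ℝ × ℝ)) ∩ {toPlane f.1, toPlane f.2}) ∧ e.1 ≠ f.1

/-- The edge `e` lies strictly below the level of `t`, except that it may end in `t`. -/
def Before (k t : ℤ × ℤ) (e : (ℤ × ℤ) × (ℤ × ℤ)) : Prop :=
  lin k e.1 < lin k t ∧ (lin k e.2 < lin k t ∨ e.2 = t)

/-- The edge `e` does not go below the level of `t`; unless it starts in `t`, it ends strictly above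
this level. -/
def After (k t : ℤ × ℤ) (e : (ℤ × ℤ) × (ℤ × ℤ)) : Prop :=
  (e.1 = t ∧ lin k t ≤ lin k e.2) ∨ (e.1 ≠ t ∧ lin k t ≤ lin k e.1 ∧ lin k t < lin k e.2)

theorem toPlane_injective : Function.Injective toPlane := fun a b h => by
  simpa [toPlane, Prod.ext_iff] using h

theorem exists_param_of_mem_edgeSegment {e : (ℤ × ℤ) × (ℤ × ℤ)} {z : ℝ × ℝ}
    (h : z ∈ edgeSegment e) :
    ∃ a b : ℝ, 0 ≤ a ∧ 0 ≤ b ∧ a + b = 1 ∧ z = a • toPlane e.1 + b • toPlane e.2 ∧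
      ∀ k, linR k z = a * lin k e.1 + b * lin k e.2 := by
  obtain ⟨a, b, ha, hb, hab, rfl⟩ := h
  refine ⟨a, b, ha, hb, hab, rfl, fun k => ?_⟩
  simp only [linR, lin, toPlane, Prod.fst_add, Prod.snd_add, Prod.smul_fst, Prod.smul_snd,
    smul_eq_mul, Int.cast_add, Int.cast_mul]
  ring

theorem MeetsAtEnds.symm {e f : (ℤ × ℤ) × (ℤ × ℤ)} (h : MeetsAtEnds e f) : MeetsAtEnds f e :=
  ⟨fun _ hz => (h.1 hz.symm).symm, h.2.symm⟩

/-- The functional `k` separates the two segments strictly, so they are disjoint. -/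
theorem meetsAtEnds_of_lt (k : ℤ × ℤ) {e f : (ℤ × ℤ) × (ℤ × ℤ)} (h11 : lin k e.1 < lin k f.1)
    (h12 : lin k e.1 < lin k f.2) (h21 : lin k e.2 < lin k f.1) (h22 : lin k e.2 < lin k f.2) :
    MeetsAtEnds e f := by
  refine ⟨?_, fun h => by rw [h] at h11; exact lt_irrefl _ h11⟩
  rintro z ⟨he, hf⟩
  obtain ⟨a, b, ha, hb, hab, -, hz⟩ := exists_param_of_mem_edgeSegment he
  obtain ⟨a', b', ha', hb', hab', -, hz'⟩ := exists_param_of_mem_edgeSegment hf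
  have h := (hz k).symm.trans (hz' k)
  exfalso
  have h1 : ((max (lin k e.1) (lin k e.2) : ℤ) : ℝ) < ((min (lin k f.1) (lin k f.2) : ℤ) : ℝ) := by
    exact_mod_cast (by simp only [max_lt_iff, lt_min_iff]; exact ⟨⟨h11, h21⟩, h12, h22⟩)
  push_cast at h1
  have e1 : a * (lin k e.1 : ℝ) + b * lin k e.2 ≤ max (lin k e.1 : ℝ) (lin k e.2) := by
    have := mul_le_mul_of_nonneg_left (le_max_left (lin k e.1 : ℝ) (lin k e.2)) ha
    have := mul_le_mul_of_nonneg_left (le_max_right (lin k e.1 : ℝ) (lin k e.2)) hb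
    calc _ ≤ (a + b) * max (lin k e.1 : ℝ) (lin k e.2) := by linarith
      _ = _ := by rw [hab, one_mul]
  have e2 : min (lin k f.1 : ℝ) (lin k f.2) ≤ a' * (lin k f.1 : ℝ) + b' * lin k f.2 := by
    have := mul_le_mul_of_nonneg_left (min_le_left (lin k f.1 : ℝ) (lin k f.2)) ha'
    have := mul_le_mul_of_nonneg_left (min_le_right (lin k f.1 : ℝ) (lin k f.2)) hb'
    calc _ = (a' + b') * min (lin k f.1 : ℝ) (lin k f.2) := by rw [hab', one_mul]
      _ ≤ _ := by linarith
  linarith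

/-- The level line of `k` through `t` is a cut. The first edge can touch it only at `t`, as its end.
The second edge either starts in `t`, which is then the only common point, or touches the line at
most in a starting point other than `t`, and then the edges are disjoint. -/
theorem Before.meetsAtEnds {k t : ℤ × ℤ} {e f : (ℤ × ℤ) × (ℤ × ℤ)} (he : Before k t e)
    (hf : After k t f) : MeetsAtEnds e f := by
  obtain ⟨he1, he2⟩ := he
  rcases hf with ⟨hf1, hf2⟩ | ⟨hne, hf1, hf2⟩
  · rcases he2 with he2 | he2
    · exact meetsAtEnds_of_lt k (by rwa [hf1]) (by omega) (by rwa [hf1]) (by omega)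
    · subst hf1
      refine ⟨?_, fun h => by rw [h] at he1; exact lt_irrefl _ he1⟩
      rintro z ⟨he', hf'⟩
      obtain ⟨a, b, ha, hb, hab, hz, hzk⟩ := exists_param_of_mem_edgeSegment he'
      obtain ⟨a', b', ha', hb', hab', hz', hzk'⟩ := exists_param_of_mem_edgeSegment hf'
      have h := (hzk k).symm.trans (hzk' k)
      have he1' : (lin k e.1 : ℝ) < lin k f.1 := by exact_mod_cast he1
      have hf2' : (lin k f.1 : ℝ) ≤ lin k f.2 := by exact_mod_cast hf2
      rw [he2] at h
      have ha0 : a = 0 := by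
        by_contra hne
        have hpos : 0 < a := lt_of_le_of_ne ha (Ne.symm hne)
        have hb1 : b = 1 - a := by linarith
        have hb1' : a' = 1 - b' := by linarith
        rw [hb1, hb1'] at h
        have h1 := mul_pos hpos (sub_pos.2 he1')
        have h2 := mul_nonneg hb' (sub_nonneg.2 hf2')
        linarith
      have hb1 : b = 1 := by linarith
      rw [ha0, hb1, zero_smul, one_smul, zero_add, he2] at hz
      rw [hz, he2]
      simp
  · rcases he2 with he2 | he2
    · exact meetsAtEnds_of_lt k (by omega) (by omega) (by omega) (by omega)
    · subst he2
      refine ⟨?_, fun h => by rw [h] at he1; omega⟩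
      rintro z ⟨he', hf'⟩
      obtain ⟨a, b, ha, hb, hab, hz, hzk⟩ := exists_param_of_mem_edgeSegment he'
      obtain ⟨a', b', ha', hb', hab', hz', hzk'⟩ := exists_param_of_mem_edgeSegment hf'
      have h := (hzk k).symm.trans (hzk' k)
      have he1' : (lin k e.1 : ℝ) < lin k e.2 := by exact_mod_cast he1
      have hf1' : (lin k e.2 : ℝ) ≤ lin k f.1 := by exact_mod_cast hf1
      have hf2' : (lin k e.2 : ℝ) < lin k f.2 := by exact_mod_cast hf2
      have hb1 : b = 1 - a := by linarith
      have hb1' : a' = 1 - b' := by linarith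
      have h1 := mul_nonneg ha (sub_pos.2 he1').le
      have h2 := mul_nonneg ha' (sub_nonneg.2 hf1')
      have h3 := mul_nonneg hb' (sub_pos.2 hf2').le
      -- Both edges give the same `k`-value at the common point. Measured from the level of the cut,
      -- this is a vanishing sum of three nonnegative terms.
      have hsum : a * (lin k e.2 - lin k e.1 : ℝ) + a' * (lin k f.1 - lin k e.2) +
          b' * (lin k f.2 - lin k e.2) = 0 := by
        rw [hb1, hb1'] at h
        rw [hb1']
        linear_combination -h
      have ha0 : a = 0 :=
        (mul_eq_zero.1 (by linarith : a * (lin k e.2 - lin k e.1 : ℝ) = 0)).resolve_right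
          (sub_pos.2 he1').ne'
      have hb0 : b' = 0 :=
        (mul_eq_zero.1 (by linarith : b' * (lin k f.2 - lin k e.2 : ℝ) = 0)).resolve_right
          (sub_pos.2 hf2').ne'
      rw [ha0, zero_smul, zero_add, hb1, ha0, sub_zero, one_smul] at hz
      rw [hb0, zero_smul, add_zero, hb1', hb0, sub_zero, one_smul] at hz'
      exact absurd (toPlane_injective (hz'.symm.trans hz)) hne

theorem Before.meetsAtEnds_of_lt {k t t' : ℤ × ℤ} {e f : (ℤ × ℤ) × (ℤ × ℤ)} (he : Before k t e)
    (hf : After k t' f) (h : lin k t < lin k t') : MeetsAtEnds e f := by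
  obtain ⟨he1, he2⟩ := he
  have he2' : lin k e.2 ≤ lin k t := by
    rcases he2 with he2 | he2
    · exact he2.le
    · rw [he2]
  rcases hf with ⟨hf1, hf2⟩ | ⟨hne, hf1, hf2⟩
  · exact _root_.meetsAtEnds_of_lt k (by rw [hf1]; omega) (by omega) (by rw [hf1]; omega) (by omega)
  · exact _root_.meetsAtEnds_of_lt k (by omega) (by omega) (by omega) (by omega)

/-- The steps of a path that starts in `v`. -/
def pathEdges {α : Type*} : α → List α → List (α × α)
  | _, [] => []
  | v, u :: l => (v, u) :: pathEdges u l

theorem zip_eq_pathEdges {α : Type*} (v w : α) (l : List α) :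
    (v :: l).zip (l ++ [w]) = pathEdges v (l ++ [w]) := by
  induction l generalizing v with
  | nil => rfl
  | cons u l ih => simp only [List.cons_append, List.zip_cons_cons, pathEdges, ih u]

theorem zip_rotate_eq_pathEdges {α : Type*} (v : α) (l : List α) :
    (v :: l).zip ((v :: l).rotate 1) = pathEdges v (l ++ [v]) := by
  rw [List.rotate_cons_succ, List.rotate_zero, zip_eq_pathEdges]

theorem polyEdges_cons (v : ℤ × ℤ) (l : List (ℤ × ℤ)) :
    polyEdges (v :: l) = pathEdges v (l ++ [v]) :=
  zip_rotate_eq_pathEdges v l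

theorem pathEdges_append_cons {α : Type*} (v w : α) (l l' : List α) :
    pathEdges v (l ++ w :: l') = pathEdges v (l ++ [w]) ++ pathEdges w l' := by
  induction l generalizing v with
  | nil => rfl
  | cons u l ih => simp only [List.cons_append, pathEdges, ih u]

theorem pathEdges_flatMap {α : Type*} (s : ℕ → α) (B : ℕ → List α) (r : ℕ) (l : List α) :
    pathEdges (s 0) ((List.range r).flatMap (fun i => B i ++ [s (i + 1)]) ++ l) =
      (List.range r).flatMap (fun i => pathEdges (s i) (B i ++ [s (i + 1)])) ++
        pathEdges (s r) l := by
  induction r generalizing l with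
  | zero => rfl
  | succ r ih =>
    rw [List.range_succ, List.flatMap_append, List.flatMap_append, List.append_assoc, ih,
      List.append_assoc]
    simp only [List.flatMap_cons, List.flatMap_nil, List.append_nil]
    rw [List.append_assoc, List.singleton_append, pathEdges_append_cons]

theorem map_fst_zip_rotate {α : Type*} (l : List α) : (l.zip (l.rotate 1)).map Prod.fst = l :=
  List.map_fst_zip (by simp)

/-! ### Combs with two spines -/

/-- A polygonal chain through `A`, `B`, blocks of vertices ending in `s 1, …, s r`, the vertices
`F` and `G`, and blocks of vertices ending in `t 1, …, t r'`. -/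
def comb (A B F G : ℤ × ℤ) (s t : ℕ → ℤ × ℤ) (X Y : ℕ → List (ℤ × ℤ)) (r r' : ℕ) :
    List (ℤ × ℤ) :=
  A :: B :: s 0 :: ((List.range r).flatMap (fun i => X i ++ [s (i + 1)]) ++
    F :: G :: t 0 :: (List.range r').flatMap (fun i => Y i ++ [t (i + 1)]))

theorem polyEdges_comb (A B F G : ℤ × ℤ) (s t : ℕ → ℤ × ℤ) (X Y : ℕ → List (ℤ × ℤ)) (r r' : ℕ) :
    polyEdges (comb A B F G s t X Y r r') =
      (A, B) :: (B, s 0) ::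
        ((List.range r).flatMap (fun i => pathEdges (s i) (X i ++ [s (i + 1)])) ++
          (s r, F) :: (F, G) :: (G, t 0) ::
            ((List.range r').flatMap (fun i => pathEdges (t i) (Y i ++ [t (i + 1)])) ++
              [(t r', A)])) := by
  simp only [comb, polyEdges_cons, List.cons_append, pathEdges, List.append_assoc,
    pathEdges_flatMap]

/-- The edges alternate between horizontal ones and others; `b` tells whether the first one is
horizontal, and `c` whether the edge after the last one should be. -/
def Alternates : Bool → List ((ℤ × ℤ) × (ℤ × ℤ)) → Bool → Prop
  | b, [], c => b = c
  | true, e :: l, c => (e.1.2 = e.2.2 ∧ e.1.1 ≠ e.2.1) ∧ Alternates false l c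
  | false, e :: l, c => e.1.2 ≠ e.2.2 ∧ Alternates true l c

theorem Alternates.append {b c d : Bool} {l l' : List ((ℤ × ℤ) × (ℤ × ℤ))}
    (h : Alternates b l c) (h' : Alternates c l' d) : Alternates b (l ++ l') d := by
  induction l generalizing b with
  | nil => simp only [Alternates] at h; subst h; exact h'
  | cons e l ih =>
    cases b
    · exact ⟨h.1, ih h.2⟩
    · exact ⟨h.1, ih h.2⟩

theorem Alternates.flatMap {b : Bool} {ι : Type*} {f : ι → List ((ℤ × ℤ) × (ℤ × ℤ))}
    {l : List ι} (h : ∀ i ∈ l, Alternates b (f i) b) : Alternates b (l.flatMap f) b := by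
  induction l with
  | nil => rfl
  | cons i l ih =>
    rw [List.flatMap_cons]
    exact (h i (by simp)).append (ih fun j hj => h j (by simp [hj]))

/-- A horizontal edge of nonzero length is never parallel to a non-horizontal one, so alternation
takes care of all consecutive pairs, whatever their lengths and slopes. -/
theorem Alternates.notParallel {b c : Bool} {e : (ℤ × ℤ) × (ℤ × ℤ)}
    {l : List ((ℤ × ℤ) × (ℤ × ℤ))} (h : Alternates b (e :: l) c) :
    ∀ ef ∈ pathEdges e l, NotParallel ef.1 ef.2 := by
  induction l generalizing b e with
  | nil => simp [pathEdges]
  | cons f l ih =>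
    intro ef hef
    simp only [pathEdges, List.mem_cons] at hef
    rcases hef with rfl | hef
    · cases b
      · obtain ⟨h1, ⟨h2, h3⟩, -⟩ := h
        simp only [NotParallel]
        rw [h2, sub_self, mul_zero]
        exact (mul_ne_zero (sub_ne_zero.2 (Ne.symm h1)) (sub_ne_zero.2 (Ne.symm h3))).symm
      · obtain ⟨⟨h2, h3⟩, h1, -⟩ := h
        simp only [NotParallel]
        rw [h2, sub_self, zero_mul]
        exact mul_ne_zero (sub_ne_zero.2 (Ne.symm h3)) (sub_ne_zero.2 (Ne.symm h1))
    · cases b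
      · exact ih (b := true) h.2 ef hef
      · exact ih (b := false) h.2 ef hef

theorem isSimplePolygon_of {v : ℤ × ℤ} {l : List (ℤ × ℤ)} (h3 : 2 ≤ l.length)
    (hp : (polyEdges (v :: l)).Pairwise MeetsAtEnds)
    (ha : Alternates false (polyEdges (v :: l)) false) : IsSimplePolygon (v :: l) := by
  refine ⟨by simp only [List.length_cons]; omega, ?_, hp.imp fun h => h.1, ?_⟩
  -- The vertices are the starting points of the edges, and these differ by the second half of
  -- `MeetsAtEnds`.
  · rw [← map_fst_zip_rotate (v :: l), List.Nodup, List.pairwise_map]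
    exact hp.imp fun h => h.2
  · obtain ⟨u, l, rfl⟩ : ∃ u l', l = u :: l' := by
      cases l with
      | nil => simp at h3
      | cons u l => exact ⟨u, l, rfl⟩
    rw [polyEdges_cons, List.cons_append, pathEdges] at ha ⊢
    rw [zip_rotate_eq_pathEdges]
    -- Consecutive pairs of the cyclic list are the steps of a path of edges that returns to the
    -- first edge. The alternation extends over the return, since it ends in the phase in which it
    -- began.
    refine (show Alternates false ((v, u) :: (pathEdges u (l ++ [v]) ++ [(v, u)])) true from ?_).notParallel
    rw [← List.cons_append]
    exact ha.append ⟨ha.1, rfl⟩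

/-- Consecutive parallel cuts confine each block of edges to its own strip, so that only edges of
the same block have to be compared. -/
theorem pairwise_flatMap_of_cuts (k : ℤ × ℤ) (s : ℕ → ℤ × ℤ)
    (E : ℕ → List ((ℤ × ℤ) × (ℤ × ℤ))) (r : ℕ)
    (hs : ∀ i j, i < j → j ≤ r → lin k (s i) < lin k (s j))
    (hE : ∀ i < r, (E i).Pairwise MeetsAtEnds)
    (hB : ∀ i < r, ∀ e ∈ E i, Before k (s (i + 1)) e)
    (hA : ∀ i < r, ∀ e ∈ E i, After k (s i) e) :
    ((List.range r).flatMap E).Pairwise MeetsAtEnds := by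
  rw [List.pairwise_flatMap]
  refine ⟨fun i hi => hE i (List.mem_range.1 hi), ?_⟩
  refine (List.pairwise_lt_range (n := r)).imp_of_mem fun {i j} hi hj hij e he f hf => ?_
  rw [List.mem_range] at hi hj
  rcases (Nat.succ_le_of_lt hij).eq_or_lt with h | h
  · have h : i + 1 = j := h
    subst h
    exact (hB i hi e he).meetsAtEnds (hA _ hj f hf)
  · exact (hB i hi e he).meetsAtEnds_of_lt (hA _ hj f hf) (hs _ _ h hj.le)

/-! ### Teeth -/

theorem meetsAtEnds_of_adjacent (k : ℤ × ℤ) {e f : (ℤ × ℤ) × (ℤ × ℤ)} (h : e.2 = f.1)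
    (h1 : lin k e.1 < lin k e.2) (h2 : lin k e.2 ≤ lin k f.2) : MeetsAtEnds e f :=
  Before.meetsAtEnds (k := k) (t := e.2) ⟨h1, Or.inr rfl⟩ (Or.inl ⟨h.symm, h2⟩)

/-- An edge that is horizontal, vertical, or diagonal. -/
def Admissible (e : (ℤ × ℤ) × (ℤ × ℤ)) : Prop :=
  e.1.2 = e.2.2 ∨ e.1.1 = e.2.1 ∨ e.2.1 - e.1.1 = e.2.2 - e.1.2

/-- The tooth below a horizontal spine that ends in a horizontal bar. -/
def barTooth (b h W H : ℤ) : List (ℤ × ℤ) :=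
  [(b, -h - W), (b + H, -h - W), (b + H, -h), (b + 1, -h), (b + 1, -1)]

/-- The tooth to the right of a vertical spine that ends in a vertical (`E = 0`, `u = 0`) or
diagonal (`E = H`, `u = 1`) bar. -/
def sideTooth (c X W H E u : ℤ) : List (ℤ × ℤ) :=
  [(X + W, c), (X + W + E, c + H), (X + E, c + H), (X + u, c + 1), (0, c + 1)]

/-- The vertical (`E = 0`) or diagonal (`E = L`) tooth above a horizontal spine. -/
def upTooth (a W L E : ℤ) : List (ℤ × ℤ) := [(a + E, 1 + L), (a + W + E, 1 + L), (a + W, 1)]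

/-- The horizontal tooth to the right of a vertical spine. -/
def rightTooth (g W L : ℤ) : List (ℤ × ℤ) := [(L, -g), (L, -g - W), (0, -g - W)]

/-- A finite check: each of the fifteen pairs of edges is either strictly separated by a coordinate,
or consists of neighbours that are cut at the common vertex. The other teeth are treated alike;
diagonal sides also need the functional x - y. -/
theorem barTooth_pairwise {b h W H D : ℤ} (hh : 2 ≤ h) (hW : 1 ≤ W) (hH : 2 ≤ H) (hD : H < D) :
    (pathEdges (b, -1) (barTooth b h W H ++ [(b + D, -1)])).Pairwise MeetsAtEnds := by
  simp only [barTooth, List.cons_append, List.nil_append, pathEdges, List.pairwise_cons,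
    List.mem_cons, List.not_mem_nil, or_false, forall_eq_or_imp, forall_eq, and_true, false_imp_iff,
    implies_true, List.Pairwise.nil]
  refine ⟨⟨?_, ?_, ?_, ?_, ?_⟩, ⟨?_, ?_, ?_, ?_⟩, ⟨?_, ?_, ?_⟩, ⟨?_, ?_⟩, ?_⟩
  all_goals first
    | (refine meetsAtEnds_of_lt (1, 0) ?_ ?_ ?_ ?_ <;> simp only [lin] <;> omega)
    | (refine meetsAtEnds_of_lt (0, 1) ?_ ?_ ?_ ?_ <;> simp only [lin] <;> omega)
    | (refine meetsAtEnds_of_lt (-1, 0) ?_ ?_ ?_ ?_ <;> simp only [lin] <;> omega)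
    | (refine meetsAtEnds_of_lt (0, -1) ?_ ?_ ?_ ?_ <;> simp only [lin] <;> omega)
    | (refine meetsAtEnds_of_adjacent (1, 0) rfl ?_ ?_ <;> simp only [lin] <;> omega)
    | (refine meetsAtEnds_of_adjacent (0, 1) rfl ?_ ?_ <;> simp only [lin] <;> omega)
    | (refine meetsAtEnds_of_adjacent (-1, 0) rfl ?_ ?_ <;> simp only [lin] <;> omega)
    | (refine meetsAtEnds_of_adjacent (1, -1) rfl ?_ ?_ <;> simp only [lin] <;> omega)

theorem sideTooth_pairwise {c X W H D E u : ℤ} (hX : 1 ≤ X) (hW : 1 ≤ W) (hH : 2 ≤ H) (hD : H < D)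
    (hE : E = 0 ∧ u = 0 ∨ E = H ∧ u = 1) :
    (pathEdges (0, c) (sideTooth c X W H E u ++ [(0, c + D)])).Pairwise MeetsAtEnds := by
  simp only [sideTooth, List.cons_append, List.nil_append, pathEdges, List.pairwise_cons,
    List.mem_cons, List.not_mem_nil, or_false, forall_eq_or_imp, forall_eq, and_true, false_imp_iff,
    implies_true, List.Pairwise.nil]
  rcases hE with ⟨rfl, rfl⟩ | ⟨rfl, rfl⟩ <;>
  refine ⟨⟨?_, ?_, ?_, ?_, ?_⟩, ⟨?_, ?_, ?_, ?_⟩, ⟨?_, ?_, ?_⟩, ⟨?_, ?_⟩, ?_⟩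
  all_goals first
    | (refine meetsAtEnds_of_lt (1, 0) ?_ ?_ ?_ ?_ <;> simp only [lin] <;> omega)
    | (refine meetsAtEnds_of_lt (0, 1) ?_ ?_ ?_ ?_ <;> simp only [lin] <;> omega)
    | (refine meetsAtEnds_of_lt (-1, 0) ?_ ?_ ?_ ?_ <;> simp only [lin] <;> omega)
    | (refine meetsAtEnds_of_lt (0, -1) ?_ ?_ ?_ ?_ <;> simp only [lin] <;> omega)
    | (refine meetsAtEnds_of_lt (1, -1) ?_ ?_ ?_ ?_ <;> simp only [lin] <;> omega)
    | (refine meetsAtEnds_of_lt (-1, 1) ?_ ?_ ?_ ?_ <;> simp only [lin] <;> omega)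
    | (refine meetsAtEnds_of_adjacent (1, 0) rfl ?_ ?_ <;> simp only [lin] <;> omega)
    | (refine meetsAtEnds_of_adjacent (0, 1) rfl ?_ ?_ <;> simp only [lin] <;> omega)
    | (refine meetsAtEnds_of_adjacent (-1, 0) rfl ?_ ?_ <;> simp only [lin] <;> omega)
    | (refine meetsAtEnds_of_adjacent (1, -1) rfl ?_ ?_ <;> simp only [lin] <;> omega)
    | (refine meetsAtEnds_of_adjacent (0, -1) rfl ?_ ?_ <;> simp only [lin] <;> omega)

theorem upTooth_pairwise {a a' W L E : ℤ} (hW : 1 ≤ W) (hL : 1 ≤ L) (ha : a + W < a')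
    (hE : E = 0 ∨ E = L) :
    (pathEdges (a, 1) (upTooth a W L E ++ [(a', 1)])).Pairwise MeetsAtEnds := by
  simp only [upTooth, List.cons_append, List.nil_append, pathEdges, List.pairwise_cons,
    List.mem_cons, List.not_mem_nil, or_false, forall_eq_or_imp, forall_eq, and_true, false_imp_iff,
    implies_true, List.Pairwise.nil]
  rcases hE with rfl | rfl <;> refine ⟨⟨?_, ?_, ?_⟩, ⟨?_, ?_⟩, ?_⟩
  all_goals first
    | (refine meetsAtEnds_of_lt (1, 0) ?_ ?_ ?_ ?_ <;> simp only [lin] <;> omega)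
    | (refine meetsAtEnds_of_lt (0, 1) ?_ ?_ ?_ ?_ <;> simp only [lin] <;> omega)
    | (refine meetsAtEnds_of_lt (0, -1) ?_ ?_ ?_ ?_ <;> simp only [lin] <;> omega)
    | (refine meetsAtEnds_of_lt (1, -1) ?_ ?_ ?_ ?_ <;> simp only [lin] <;> omega)
    | (refine meetsAtEnds_of_adjacent (1, 0) rfl ?_ ?_ <;> simp only [lin] <;> omega)
    | (refine meetsAtEnds_of_adjacent (0, 1) rfl ?_ ?_ <;> simp only [lin] <;> omega)
    | (refine meetsAtEnds_of_adjacent (1, -1) rfl ?_ ?_ <;> simp only [lin] <;> omega)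
    | (refine meetsAtEnds_of_adjacent (0, -1) rfl ?_ ?_ <;> simp only [lin] <;> omega)

theorem rightTooth_pairwise {g g' W L : ℤ} (hW : 1 ≤ W) (hL : 1 ≤ L) (hg : g + W < g') :
    (pathEdges (0, -g) (rightTooth g W L ++ [(0, -g')])).Pairwise MeetsAtEnds := by
  simp only [rightTooth, List.cons_append, List.nil_append, pathEdges, List.pairwise_cons,
    List.mem_cons, List.not_mem_nil, or_false, forall_eq_or_imp, forall_eq, and_true, false_imp_iff,
    implies_true, List.Pairwise.nil]
  refine ⟨⟨?_, ?_, ?_⟩, ⟨?_, ?_⟩, ?_⟩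
  all_goals first
    | (refine meetsAtEnds_of_lt (-1, 0) ?_ ?_ ?_ ?_ <;> simp only [lin] <;> omega)
    | (refine meetsAtEnds_of_lt (0, -1) ?_ ?_ ?_ ?_ <;> simp only [lin] <;> omega)
    | (refine meetsAtEnds_of_adjacent (1, 0) rfl ?_ ?_ <;> simp only [lin] <;> omega)
    | (refine meetsAtEnds_of_adjacent (-1, 0) rfl ?_ ?_ <;> simp only [lin] <;> omega)
    | (refine meetsAtEnds_of_adjacent (1, -1) rfl ?_ ?_ <;> simp only [lin] <;> omega)
    | (refine meetsAtEnds_of_adjacent (0, -1) rfl ?_ ?_ <;> simp only [lin] <;> omega)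

theorem barTooth_cuts {b h W H D : ℤ} (hH : 2 ≤ H) (hD : H < D) :
    ∀ e ∈ pathEdges (b, -1) (barTooth b h W H ++ [(b + D, -1)]),
      Before (1, 0) (b + D, -1) e ∧ After (1, 0) (b, -1) e := by
  simp only [barTooth, List.cons_append, List.nil_append, pathEdges, List.mem_cons,
    List.not_mem_nil, or_false, forall_eq_or_imp, forall_eq, Before, After, lin, ne_eq, Prod.mk.injEq,
    true_and, and_true, or_true]
  and_intros <;> first | rfl | omega

theorem sideTooth_cuts {c X W H D E u : ℤ} (hX : 1 ≤ X) (hW : 1 ≤ W) (hH : 2 ≤ H) (hD : H < D) :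
    ∀ e ∈ pathEdges (0, c) (sideTooth c X W H E u ++ [(0, c + D)]),
      Before (0, 1) (0, c + D) e ∧ After (0, 1) (0, c) e := by
  simp only [sideTooth, List.cons_append, List.nil_append, pathEdges, List.mem_cons,
    List.not_mem_nil, or_false, forall_eq_or_imp, forall_eq, Before, After, lin, ne_eq, Prod.mk.injEq,
    true_and, and_true, or_true]
  and_intros <;> first | rfl | omega

/-- The cut must be parallel to the tooth: a diagonal tooth leans over its neighbours on the right
and is separated from them by x - y but not by x. -/
theorem upTooth_cuts {a a' W L E : ℤ} (hW : 1 ≤ W) (hL : 1 ≤ L) (ha : a + W < a')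
    (hE : E = 0 ∨ E = L) (k : ℤ × ℤ) (hk : k = (1, 0) ∧ E = 0 ∨ k = (1, -1) ∧ E = L) :
    ∀ e ∈ pathEdges (a, 1) (upTooth a W L E ++ [(a', 1)]),
      Before k (a', 1) e ∧ After k (a, 1) e := by
  rcases hk with ⟨rfl, rfl⟩ | ⟨rfl, rfl⟩ <;>
  simp only [upTooth, List.cons_append, List.nil_append, pathEdges, List.mem_cons,
    List.not_mem_nil, or_false, forall_eq_or_imp, forall_eq, Before, After, lin, ne_eq, Prod.mk.injEq,
    true_and, and_true, or_true]
  all_goals and_intros <;> omega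

theorem rightTooth_cuts {g g' W L : ℤ} (hW : 1 ≤ W) (hL : 1 ≤ L) (hg : g + W < g') :
    ∀ e ∈ pathEdges (0, -g) (rightTooth g W L ++ [(0, -g')]),
      Before (0, -1) (0, -g') e ∧ After (0, -1) (0, -g) e := by
  simp only [rightTooth, List.cons_append, List.nil_append, pathEdges, List.mem_cons,
    List.not_mem_nil, or_false, forall_eq_or_imp, forall_eq, Before, After, lin, ne_eq, Prod.mk.injEq,
    true_and, and_true, or_true]
  and_intros <;> first | rfl | omega

theorem barTooth_alternates {b h W H D : ℤ} (hh : 2 ≤ h) (hW : 1 ≤ W) (hH : 2 ≤ H) (hD : H < D) :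
    Alternates false (pathEdges (b, -1) (barTooth b h W H ++ [(b + D, -1)])) false := by
  simp only [barTooth, List.cons_append, List.nil_append, pathEdges, Alternates, true_and,
    and_true]
  and_intros <;> first | rfl | omega

theorem sideTooth_alternates {c X W H D E u : ℤ} (hX : 1 ≤ X) (hW : 1 ≤ W) (hH : 2 ≤ H)
    (hD : H < D) (hu : 0 ≤ u) :
    Alternates true (pathEdges (0, c) (sideTooth c X W H E u ++ [(0, c + D)])) true := by
  simp only [sideTooth, List.cons_append, List.nil_append, pathEdges, Alternates, true_and,
    and_true]
  and_intros <;> first | rfl | omega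

theorem upTooth_alternates {a a' W L E : ℤ} (hW : 1 ≤ W) (hL : 1 ≤ L) (ha : a + W < a') :
    Alternates false (pathEdges (a, 1) (upTooth a W L E ++ [(a', 1)])) false := by
  simp only [upTooth, List.cons_append, List.nil_append, pathEdges, Alternates, true_and,
    and_true]
  and_intros <;> first | rfl | omega

theorem rightTooth_alternates {g g' W L : ℤ} (hW : 1 ≤ W) (hL : 1 ≤ L) (hg : g + W < g') :
    Alternates true (pathEdges (0, -g) (rightTooth g W L ++ [(0, -g')])) true := by
  simp only [rightTooth, List.cons_append, List.nil_append, pathEdges, Alternates, true_and,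
    and_true]
  and_intros <;> first | rfl | omega

theorem barTooth_admissible {b h W H D : ℤ} :
    ∀ e ∈ pathEdges (b, -1) (barTooth b h W H ++ [(b + D, -1)]), Admissible e := by
  simp [barTooth, pathEdges, Admissible]

theorem sideTooth_admissible {c X W H D E u : ℤ} (hE : E = 0 ∧ u = 0 ∨ E = H ∧ u = 1) :
    ∀ e ∈ pathEdges (0, c) (sideTooth c X W H E u ++ [(0, c + D)]), Admissible e := by
  simp only [sideTooth, List.cons_append, List.nil_append, pathEdges, List.mem_cons,
    List.not_mem_nil, or_false, forall_eq_or_imp, forall_eq, Admissible, true_and,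
    and_true, true_or, or_true]
  and_intros <;> first | rfl | omega

theorem upTooth_admissible {a a' W L E : ℤ} (hE : E = 0 ∨ E = L) :
    ∀ e ∈ pathEdges (a, 1) (upTooth a W L E ++ [(a', 1)]), Admissible e := by
  simp only [upTooth, List.cons_append, List.nil_append, pathEdges, List.mem_cons,
    List.not_mem_nil, or_false, forall_eq_or_imp, forall_eq, Admissible, true_and,
    and_true, true_or]
  and_intros <;> first | rfl | omega

theorem rightTooth_admissible {g g' W L : ℤ} :
    ∀ e ∈ pathEdges (0, -g) (rightTooth g W L ++ [(0, -g')]), Admissible e := by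
  simp [rightTooth, pathEdges, Admissible]

/-! ### Simplicity of a whole comb -/

/-- One proof serves both polygons; `σ = -1` turns the picture upside down. The teeth of the two
spines lie on different sides of the horizontal axis, so individual care is needed only for teeth
and the spine edges next to them; this is what `h₁` and `h₂` supply. -/
theorem comb_pairwise {A B F G : ℤ × ℤ} {s t : ℕ → ℤ × ℤ} {X Y : ℕ → List (ℤ × ℤ)} {r r' : ℕ}
    {E₁ E₂ : List ((ℤ × ℤ) × (ℤ × ℤ))}
    (hE₁ : (List.range r).flatMap (fun i => pathEdges (s i) (X i ++ [s (i + 1)])) = E₁)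
    (hE₂ : (List.range r').flatMap (fun i => pathEdges (t i) (Y i ++ [t (i + 1)])) = E₂)
    (σ x Z y T : ℤ) (hσ : σ = 1 ∨ σ = -1) (hx : 0 ≤ x) (hZ : x < Z) (hy : 1 ≤ y) (hT : y < T)
    (hA : A = (-1, σ * T)) (hB : B = (-1, -σ)) (hs : s 0 = (x, -σ)) (hs' : s r = (Z, -σ))
    (hF : F = (Z, 0)) (hG : G = (0, 0)) (ht : t 0 = (0, σ * y)) (ht' : t r' = (0, σ * T))
    (hp₁ : E₁.Pairwise MeetsAtEnds) (hp₂ : E₂.Pairwise MeetsAtEnds)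
    (hx₁ : ∀ e ∈ E₁, (-1 < e.1.1 ∧ -1 < e.2.1) ∧ σ * e.1.2 ≤ -1 ∧ σ * e.2.2 ≤ -1)
    (hx₂ : ∀ e ∈ E₂, (-1 < e.1.1 ∧ -1 < e.2.1) ∧ 1 ≤ σ * e.1.2 ∧ 1 ≤ σ * e.2.2)
    (h₁ : ∀ e ∈ E₁, MeetsAtEnds (B, s 0) e ∧ MeetsAtEnds e (s r, F))
    (h₂ : ∀ e ∈ E₂, MeetsAtEnds (G, t 0) e ∧ MeetsAtEnds e (t r', A)) :
    (polyEdges (comb A B F G s t X Y r r')).Pairwise MeetsAtEnds := by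
  rw [polyEdges_comb, hE₁, hE₂]
  rw [hs, hs'] at *
  rw [ht, ht'] at *
  subst hA hB hF hG
  have h12 : ∀ e ∈ E₁, ∀ f ∈ E₂, MeetsAtEnds e f := fun e he f hf => by
    have h1 := (hx₁ e he).2
    have h2 := (hx₂ f hf).2
    refine meetsAtEnds_of_lt (0, σ) ?_ ?_ ?_ ?_ <;> simp only [lin] <;> omega
  have hl1 : ∀ e ∈ E₁, MeetsAtEnds ((-1, σ * T), (-1, -σ)) e := fun e he => by
    have h1 := (hx₁ e he).1
    refine meetsAtEnds_of_lt (1, 0) ?_ ?_ ?_ ?_ <;> simp only [lin] <;> omega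
  have hl2 : ∀ e ∈ E₂, MeetsAtEnds ((-1, σ * T), (-1, -σ)) e := fun e he => by
    have h1 := (hx₂ e he).1
    refine meetsAtEnds_of_lt (1, 0) ?_ ?_ ?_ ?_ <;> simp only [lin] <;> omega
  have hd1 : ∀ e ∈ E₁, MeetsAtEnds e ((Z, 0), (0, 0)) ∧ MeetsAtEnds e ((0, 0), (0, σ * y)) ∧
      MeetsAtEnds e ((0, σ * T), (-1, σ * T)) := fun e he => by
    have h1 := (hx₁ e he).2
    refine ⟨?_, ?_, ?_⟩ <;> refine meetsAtEnds_of_lt (0, σ) ?_ ?_ ?_ ?_ <;> simp only [lin] <;>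
      rcases hσ with rfl | rfl <;> omega
  have hd2 : ∀ e ∈ E₂, MeetsAtEnds ((-1, -σ), (x, -σ)) e ∧ MeetsAtEnds ((Z, -σ), (Z, 0)) e ∧
      MeetsAtEnds ((Z, 0), (0, 0)) e := fun e he => by
    have h1 := (hx₂ e he).2
    refine ⟨?_, ?_, ?_⟩ <;> refine meetsAtEnds_of_lt (0, σ) ?_ ?_ ?_ ?_ <;> simp only [lin] <;>
      rcases hσ with rfl | rfl <;> omega
  simp only [List.pairwise_cons, List.pairwise_append, List.mem_cons, List.mem_append,
    List.not_mem_nil, or_false, forall_eq, false_imp_iff, implies_true,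
    List.Pairwise.nil, and_true, or_imp, forall_and]
  refine ⟨⟨?_, hl1, ?_, ?_, ?_, hl2, ?_⟩,
    ⟨fun e he => (h₁ e he).1, ?_, ?_, ?_, fun e he => (hd2 e he).1, ?_⟩, hp₁,
    ⟨⟨?_, ?_, fun e he => (hd2 e he).2.1, ?_⟩, ⟨?_, fun e he => (hd2 e he).2.2, ?_⟩,
      ⟨fun e he => (h₂ e he).1, ?_⟩, hp₂, trivial, fun e he => (h₂ e he).2⟩, fun e he => (h₁ e he).2,
    fun e he => (hd1 e he).1, fun e he => (hd1 e he).2.1, h12, fun e he => (hd1 e he).2.2⟩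
  all_goals rcases hσ with rfl | rfl
  all_goals first
    | (refine meetsAtEnds_of_lt (1, 0) ?_ ?_ ?_ ?_ <;> simp only [lin] <;> omega)
    | (refine meetsAtEnds_of_lt (0, 1) ?_ ?_ ?_ ?_ <;> simp only [lin] <;> omega)
    | (refine meetsAtEnds_of_lt (-1, 0) ?_ ?_ ?_ ?_ <;> simp only [lin] <;> omega)
    | (refine meetsAtEnds_of_lt (0, -1) ?_ ?_ ?_ ?_ <;> simp only [lin] <;> omega)
    | (refine meetsAtEnds_of_adjacent (1, 0) rfl ?_ ?_ <;> simp only [lin] <;> omega)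
    | (refine meetsAtEnds_of_adjacent (0, 1) rfl ?_ ?_ <;> simp only [lin] <;> omega)
    | (refine meetsAtEnds_of_adjacent (-1, 0) rfl ?_ ?_ <;> simp only [lin] <;> omega)
    | (refine meetsAtEnds_of_adjacent (0, -1) rfl ?_ ?_ <;> simp only [lin] <;> omega)
    | (refine (meetsAtEnds_of_adjacent (-1, 0) rfl ?_ ?_).symm <;> simp only [lin] <;> omega)

theorem comb_alternates {A B F G : ℤ × ℤ} {s t : ℕ → ℤ × ℤ} {X Y : ℕ → List (ℤ × ℤ)} {r r' : ℕ}
    {E₁ E₂ : List ((ℤ × ℤ) × (ℤ × ℤ))}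
    (hE₁ : (List.range r).flatMap (fun i => pathEdges (s i) (X i ++ [s (i + 1)])) = E₁)
    (hE₂ : (List.range r').flatMap (fun i => pathEdges (t i) (Y i ++ [t (i + 1)])) = E₂)
    (hAB : A.2 ≠ B.2) (hBs : B.2 = (s 0).2 ∧ B.1 ≠ (s 0).1) (hsF : (s r).2 ≠ F.2)
    (hFG : F.2 = G.2 ∧ F.1 ≠ G.1) (hGt : G.2 ≠ (t 0).2) (htA : (t r').2 = A.2 ∧ (t r').1 ≠ A.1)
    (h₁ : Alternates false E₁ false) (h₂ : Alternates true E₂ true) :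
    Alternates false (polyEdges (comb A B F G s t X Y r r')) false := by
  rw [polyEdges_comb, hE₁, hE₂]
  exact ⟨hAB, hBs, h₁.append ⟨hsF, hFG, hGt, h₂.append ⟨htA, rfl⟩⟩⟩

theorem isSimplePolygon_comb {A B F G : ℤ × ℤ} {s t : ℕ → ℤ × ℤ} {X Y : ℕ → List (ℤ × ℤ)}
    {r r' : ℕ} (hp : (polyEdges (comb A B F G s t X Y r r')).Pairwise MeetsAtEnds)
    (ha : Alternates false (polyEdges (comb A B F G s t X Y r r')) false) :
    IsSimplePolygon (comb A B F G s t X Y r r') :=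
  isSimplePolygon_of (by simp) hp ha

/-! ### The two polygons -/

/-- Five families of natural numbers. -/
structure SumData where
  n : ℕ
  m : ℕ
  V : ℕ
  X₁ : ℕ → ℕ
  X₂ : ℕ → ℕ
  X₃ : ℕ → ℕ
  Y₁ : ℕ → ℕ
  Y₂ : ℕ → ℕ
  n_pos : 0 < n
  m_pos : 0 < m
  X₁_pos : ∀ i < n, 0 < X₁ i
  X₁_le : ∀ i < n, X₁ i ≤ V
  X₂_le : ∀ i < n, X₂ i ≤ V
  X₃_le : ∀ i < n, X₃ i ≤ V
  Y₁_le : ∀ j < m, Y₁ j ≤ V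
  Y₂_le : ∀ j < m, Y₂ j ≤ V
  X₁_inj : Set.InjOn X₁ (Set.Iio n)
  X₂_inj : Set.InjOn X₂ (Set.Iio n)
  X₃_inj : Set.InjOn X₃ (Set.Iio n)

namespace SumData

variable (d : SumData)

/-- The width of the bars. -/
def W : ℤ := 200 * (d.n * d.n)

/-- The coarse spacing. -/
def M : ℤ := 32 * d.W * (d.V + 1)

/-- The length of the bars of the first polygon. -/
def H : ℤ := 4 * d.n * (d.m + 1) * d.M

/-- The spacing of the teeth of the first polygon. -/
def D : ℤ := 2 * d.H

/-- The length of the teeth of the second polygon. -/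
def L : ℤ := (2 * d.n + 4) * d.D

/-- The offset of the horizontal bars. -/
def h (i : ℕ) : ℤ := 4 * d.W * d.V + 2 - 4 * d.W * d.X₂ i

/-- The base of a tooth on the right of the first polygon. -/
def c (i : ℕ) : ℤ := (i + 1) * d.D

/-- The distance of the bar of a tooth on the right of the first polygon from the spine. -/
def x (i : ℕ) : ℤ :=
  if i < d.n then 4 * d.W * d.X₁ i
  else d.c i + (d.m * d.M + 4 * d.W * d.V + 1 + 4 * d.W * d.X₃ (i - d.n))

/-- The base of a tooth above the second polygon. -/
def a (j : ℕ) : ℤ :=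
  if j < d.m then (j + 1) * d.M + 4 * d.W * d.Y₁ j else (j + 2) * d.M

/-- The base of a tooth on the right of the second polygon. -/
def g (j : ℕ) : ℤ :=
  if j < d.m then (j + 1) * d.M + 4 * d.W * d.Y₂ j else (j + 1) * d.M

/-- The first polygon. -/
def P : List (ℤ × ℤ) :=
  comb (-1, (2 * d.n + 1) * d.D) (-1, -1) (d.n * d.D, 0) (0, 0)
    (fun i => (i * d.D, -1)) (fun i => (0, d.c i))
    (fun i => barTooth (i * d.D) (d.h i) d.W d.H)
    (fun i => sideTooth (d.c i) (d.x i) d.W d.H (if i < d.n then 0 else d.H)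
      (if i < d.n then 0 else 1)) d.n (2 * d.n)

/-- The second polygon. -/
def Q : List (ℤ × ℤ) :=
  comb (-1, -((d.m + 1) * d.M)) (-1, 1) (d.a (3 * d.m), 0) (0, 0)
    (fun j => (d.a j, 1)) (fun j => (0, -d.g j))
    (fun j => upTooth (d.a j) d.W d.L (if j < d.m then 0 else d.L))
    (fun j => rightTooth (d.g j) d.W d.L) (3 * d.m) d.m

/-! ### Inequalities between the parameters of the construction -/

theorem W_pos : 1 ≤ d.W := by
  have : (0 : ℤ) < d.n := by exact_mod_cast d.n_pos
  have := mul_pos this this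
  simp only [W]; omega

theorem M_ge : 32 * d.W ≤ d.M := by
  have := d.W_pos
  simp only [M]
  nlinarith [mul_nonneg (by linarith : 0 ≤ 32 * d.W) (by positivity : (0 : ℤ) ≤ d.V)]

theorem M_ge' : 8 * (4 * d.W * d.V) + 32 * d.W ≤ d.M := by
  simp only [M]; linarith

theorem H_ge : 4 * ((d.m + 1) * d.M) ≤ d.H := by
  have h1 : (1 : ℤ) ≤ d.n := by exact_mod_cast d.n_pos
  have h2 : 0 ≤ (d.m + 1) * d.M := by
    have := d.W_pos; have := d.M_ge
    have : 0 ≤ d.M := by linarith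
    positivity
  simp only [H]
  nlinarith

theorem mM_nonneg : 0 ≤ d.m * d.M := by
  have := d.W_pos; have := d.M_ge
  have : 0 ≤ d.M := by linarith
  positivity

theorem H_ge_mM : 4 * (d.m * d.M) + 4 * d.M ≤ d.H := by
  have := d.H_ge; linarith

theorem L_ge : 6 * d.D ≤ d.L := by
  have h1 : (1 : ℤ) ≤ d.n := by exact_mod_cast d.n_pos
  have h2 : 0 ≤ d.D := by
    have := d.W_pos; have := d.M_ge; have := d.H_ge_mM; have := d.mM_nonneg
    simp only [D]; linarith
  simp only [L]; nlinarith

theorem scaled_le {y : ℕ} (hy : y ≤ d.V) : 0 ≤ 4 * d.W * y ∧ 4 * d.W * y ≤ 4 * d.W * d.V := by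
  have := d.W_pos
  exact ⟨by positivity, mul_le_mul_of_nonneg_left (by exact_mod_cast hy) (by linarith)⟩

theorem h_ge {i : ℕ} (hi : i < d.n) : 2 ≤ d.h i ∧ d.h i ≤ d.M := by
  have := d.scaled_le (d.X₂_le i hi); have := d.M_ge'; have := d.W_pos
  simp only [h]; constructor <;> linarith

theorem c_succ (i : ℕ) : d.c (i + 1) = d.c i + d.D := by simp only [c]; push_cast; ring

theorem c_ge (i : ℕ) : d.D ≤ d.c i := by
  have : 0 ≤ d.D := by
    have := d.W_pos; have := d.M_ge; have := d.H_ge_mM; have := d.mM_nonneg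
    simp only [D]; linarith
  simp only [c]; nlinarith [mul_nonneg (by positivity : (0 : ℤ) ≤ i) this]

theorem x_ge {i : ℕ} (hi : i < 2 * d.n) : 2 ≤ d.x i := by
  have hW := d.W_pos
  simp only [x]
  split_ifs with hin
  · have : (1 : ℤ) ≤ d.X₁ i := by exact_mod_cast d.X₁_pos i hin
    nlinarith
  · have := d.c_ge i; have := d.mM_nonneg; have := d.M_ge; have := d.H_ge_mM
    have : d.D = 2 * d.H := rfl
    have := d.scaled_le (d.X₃_le (i - d.n) (by omega))
    linarith

theorem a_succ {j : ℕ} (_ : j < 3 * d.m) : d.a j + d.W < d.a (j + 1) := by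
  have hW := d.W_pos; have hM := d.M_ge'; have hM := d.M_ge
  simp only [a]
  split_ifs with h1 h2 h2
  · have := d.scaled_le (d.Y₁_le j h1); have := d.scaled_le (d.Y₁_le (j + 1) h2)
    push_cast; linarith
  · have := d.scaled_le (d.Y₁_le j h1)
    push_cast; linarith
  · omega
  · push_cast; linarith

theorem g_succ {j : ℕ} (hj : j < d.m) : d.g j + d.W < d.g (j + 1) := by
  have hW := d.W_pos; have hM := d.M_ge'; have hM := d.M_ge
  simp only [g]
  have := d.scaled_le (d.Y₂_le j hj)
  split_ifs with h2
  · have := d.scaled_le (d.Y₂_le (j + 1) h2)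
    push_cast; linarith
  · push_cast; linarith

theorem a_lt {i j : ℕ} (hij : i < j) (hj : j ≤ 3 * d.m) : d.a i < d.a j := by
  have hW := d.W_pos
  induction j, hij using Nat.le_induction with
  | base => have := d.a_succ (j := i) (by omega); linarith
  | succ k hk ih => have := d.a_succ (j := k) (by omega); have := ih (by omega); linarith

theorem g_lt {i j : ℕ} (hij : i < j) (hj : j ≤ d.m) : d.g i < d.g j := by
  have hW := d.W_pos
  induction j, hij using Nat.le_induction with
  | base => have := d.g_succ (j := i) (by omega); linarith
  | succ k hk ih => have := d.g_succ (j := k) (by omega); have := ih (by omega); linarith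

theorem D_pos : 8 ≤ d.D ∧ 4 ≤ d.H ∧ d.H < d.D := by
  have := d.W_pos; have := d.M_ge; have := d.H_ge_mM; have := d.mM_nonneg
  simp only [D]; refine ⟨?_, ?_, ?_⟩ <;> linarith

theorem mul_D_lt {i j : ℕ} (hij : i < j) : (i : ℤ) * d.D < j * d.D :=
  mul_lt_mul_of_pos_right (by exact_mod_cast hij) (by have := d.D_pos; linarith)

theorem c_lt {i j : ℕ} (hij : i < j) : d.c i < d.c j := by
  have := d.mul_D_lt hij
  simp only [c]; linarith

/-! ### The two polygons are simple, with admissible edges and of linear size -/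

theorem P_isSimplePolygon : IsSimplePolygon d.P := by
  have hW := d.W_pos
  obtain ⟨hD, hH, hHD⟩ := d.D_pos
  have hE : ∀ i : ℕ, ((if i < d.n then 0 else d.H : ℤ) = 0 ∧ (if i < d.n then 0 else 1 : ℤ) = 0 ∨
      (if i < d.n then 0 else d.H : ℤ) = d.H ∧ (if i < d.n then 0 else 1 : ℤ) = 1) := by
    intro i; split_ifs <;> simp
  have hE' : ∀ i : ℕ, 0 ≤ (if i < d.n then 0 else d.H : ℤ) ∧
      0 ≤ (if i < d.n then 0 else 1 : ℤ) := fun i => by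
    rcases hE i with h | h <;> omega
  have hs : ∀ i : ℕ, (((i + 1 : ℕ) : ℤ) * d.D, (-1 : ℤ)) = (i * d.D + d.D, -1) := fun i => by
    push_cast; rw [add_mul, one_mul]
  refine isSimplePolygon_comb (comb_pairwise rfl rfl 1 0 (d.n * d.D) d.D
    ((2 * d.n + 1) * d.D) (Or.inl rfl) le_rfl ?_ (by linarith) ?_ (by simp) (by simp) (by simp)
    (by simp) rfl rfl (by simp [c]) (by simp [c]) ?_ ?_ ?_ ?_ ?_ ?_) (comb_alternates rfl rfl ?_ ?_ ?_ ?_ ?_ ?_ ?_ ?_)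
  · have := d.mul_D_lt d.n_pos; simpa using this
  · have := d.mul_D_lt d.n_pos; push_cast at this; linarith
  · refine pairwise_flatMap_of_cuts (1, 0) (fun i => (i * d.D, -1)) _ _ ?_ ?_ ?_ ?_
    · intro i j hij _
      simpa [lin] using d.mul_D_lt hij
    · intro i hi
      simp only [hs]
      exact barTooth_pairwise (d.h_ge hi).1 hW (by linarith) hHD
    · intro i hi e he
      simp only [hs] at he ⊢
      exact (barTooth_cuts (by linarith) hHD e he).1
    · intro i hi e he
      simp only [hs] at he ⊢
      exact (barTooth_cuts (by linarith) hHD e he).2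
  · refine pairwise_flatMap_of_cuts (0, 1) (fun i => (0, d.c i)) _ _ ?_ ?_ ?_ ?_
    · intro i j hij _
      simpa [lin] using d.c_lt hij
    · intro i hi
      simp only [c_succ]
      exact sideTooth_pairwise (by have := d.x_ge hi; linarith) hW (by linarith) hHD (hE i)
    · intro i hi e he
      simp only [c_succ] at he ⊢
      exact (sideTooth_cuts (by have := d.x_ge hi; linarith) hW (by linarith) hHD e he).1
    · intro i hi e he
      simp only [c_succ] at he ⊢
      exact (sideTooth_cuts (by have := d.x_ge hi; linarith) hW (by linarith) hHD e he).2
  · intro e he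
    simp only [List.mem_flatMap, List.mem_range, hs] at he
    obtain ⟨i, hi, he⟩ := he
    have h0 : 0 ≤ (i : ℤ) * d.D := by positivity
    have hh := d.h_ge hi
    revert e
    generalize (i : ℤ) * d.D = b at *
    simp only [barTooth, List.cons_append, List.nil_append, pathEdges, List.mem_cons,
      List.not_mem_nil, or_false, forall_eq_or_imp, forall_eq]
    and_intros <;> omega
  · intro e he
    simp only [List.mem_flatMap, List.mem_range, c_succ] at he
    obtain ⟨i, hi, he⟩ := he
    have hx := d.x_ge hi
    have hc := d.c_ge i
    have hu := hE' i
    revert e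
    simp only [sideTooth, List.cons_append, List.nil_append, pathEdges, List.mem_cons,
      List.not_mem_nil, or_false, forall_eq_or_imp, forall_eq]
    generalize (if i < d.n then 0 else d.H : ℤ) = E at *
    generalize (if i < d.n then 0 else 1 : ℤ) = u at *
    and_intros <;> omega
  · intro e he
    simp only [List.mem_flatMap, List.mem_range, hs] at he
    obtain ⟨i, hi, he⟩ := he
    have hcut := barTooth_cuts (by linarith) hHD e he
    constructor
    · have hB : Before (1, 0) (0, -1) ((-1, -1), (0, -1)) := by simp [Before, lin]
      simp only [Nat.cast_zero, zero_mul]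
      rcases Nat.eq_zero_or_pos i with rfl | h
      · exact hB.meetsAtEnds (by simpa using hcut.2)
      · refine hB.meetsAtEnds_of_lt hcut.2 ?_
        simpa [lin] using d.mul_D_lt h
    · have hA : After (1, 0) (d.n * d.D, -1) ((d.n * d.D, -1), (d.n * d.D, 0)) := by
        simp [After, lin]
      rcases (Nat.succ_le_of_lt hi).eq_or_lt with h | h
      · refine Before.meetsAtEnds ?_ hA
        rw [← h, Nat.succ_eq_add_one, hs]
        exact hcut.1
      · refine Before.meetsAtEnds_of_lt hcut.1 hA ?_
        have := d.mul_D_lt h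
        simp only [Nat.succ_eq_add_one, Nat.cast_add, Nat.cast_one] at this
        simp only [lin]; linarith
  · intro e he
    simp only [List.mem_flatMap, List.mem_range, c_succ] at he
    obtain ⟨i, hi, he⟩ := he
    have hx := d.x_ge hi
    have hcut := sideTooth_cuts (by linarith) hW (by linarith) hHD e he
    constructor
    · have hB : Before (0, 1) (0, d.c 0) ((0, 0), (0, d.c 0)) := by
        have := d.c_ge 0
        simp only [Before, lin, or_true, and_true]; linarith
      rcases Nat.eq_zero_or_pos i with rfl | h
      · exact hB.meetsAtEnds hcut.2
      · refine hB.meetsAtEnds_of_lt hcut.2 ?_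
        simpa [lin] using d.c_lt h
    · have hA : After (0, 1) (0, d.c (2 * d.n)) ((0, d.c (2 * d.n)), (-1, (2 * d.n + 1) * d.D)) := by
        simp [After, lin, c]
      rcases (Nat.succ_le_of_lt hi).eq_or_lt with h | h
      · refine Before.meetsAtEnds ?_ hA
        rw [← h, Nat.succ_eq_add_one, c_succ]
        exact hcut.1
      · refine Before.meetsAtEnds_of_lt hcut.1 hA ?_
        have := d.c_lt h
        rw [Nat.succ_eq_add_one, c_succ] at this
        simp only [lin]; linarith
  · have := d.mul_D_lt d.n_pos; push_cast at this; simp only; linarith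
  · simp
  · simp
  · have := d.mul_D_lt d.n_pos; push_cast at this; simp only [true_and]; linarith
  · have := d.c_ge 0; simp only; linarith
  · simp [c]
  · refine Alternates.flatMap fun i hi => ?_
    rw [List.mem_range] at hi
    simp only [hs]
    exact barTooth_alternates (d.h_ge hi).1 hW (by linarith) hHD
  · refine Alternates.flatMap fun i hi => ?_
    rw [List.mem_range] at hi
    simp only [c_succ]
    exact sideTooth_alternates (by have := d.x_ge hi; linarith) hW (by linarith) hHD (hE' i).2

theorem a_zero_ge : d.M ≤ d.a 0 := by
  have := d.scaled_le (d.Y₁_le 0 d.m_pos)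
  simp only [a, if_pos d.m_pos]; push_cast; linarith

theorem g_zero_ge : d.M ≤ d.g 0 := by
  have := d.scaled_le (d.Y₂_le 0 d.m_pos)
  simp only [g, if_pos d.m_pos]; push_cast; linarith

theorem g_m : d.g d.m = (d.m + 1) * d.M := by simp [g]

theorem a_ge {j : ℕ} (hj : j ≤ 3 * d.m) : d.M ≤ d.a j := by
  rcases Nat.eq_zero_or_pos j with rfl | h
  · exact d.a_zero_ge
  · exact d.a_zero_ge.trans (d.a_lt h hj).le

theorem g_ge {j : ℕ} (hj : j ≤ d.m) : d.M ≤ d.g j := by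
  rcases Nat.eq_zero_or_pos j with rfl | h
  · exact d.g_zero_ge
  · exact d.g_zero_ge.trans (d.g_lt h hj).le

theorem upTooth_shift (j : ℕ) :
    (if j < d.m then 0 else d.L : ℤ) = 0 ∨ (if j < d.m then 0 else d.L : ℤ) = d.L := by
  split_ifs <;> simp

/-- The first m teeth are vertical and are cut by x, the last 2m are diagonal and are cut by x - y.
Between the two groups x works again, because the diagonal teeth lean to the right, away from the
vertical ones. -/
theorem upTeeth_pairwise : ((List.range (3 * d.m)).flatMap (fun j => pathEdges (d.a j, 1)
    (upTooth (d.a j) d.W d.L (if j < d.m then 0 else d.L) ++ [(d.a (j + 1), 1)]))).Pairwise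
      MeetsAtEnds := by
  have hW := d.W_pos
  have hL : 1 ≤ d.L := by have := d.D_pos; have := d.L_ge; linarith
  have h3 : 3 * d.m = d.m + 2 * d.m := by ring
  rw [h3, List.range_add, List.flatMap_append, List.flatMap_map, List.pairwise_append]
  refine ⟨?_, ?_, ?_⟩
  · refine pairwise_flatMap_of_cuts (1, 0) (fun j => (d.a j, 1)) _ _ ?_ ?_ ?_ ?_
    · intro i j hij hj
      simpa [lin] using d.a_lt hij (by omega)
    · intro j hj
      exact upTooth_pairwise hW hL (d.a_succ (by omega)) (d.upTooth_shift j)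
    · intro j hj e he
      rw [if_pos hj] at he
      exact (upTooth_cuts hW hL (d.a_succ (by omega)) (Or.inl rfl) _ (Or.inl ⟨rfl, rfl⟩) e he).1
    · intro j hj e he
      rw [if_pos hj] at he
      exact (upTooth_cuts hW hL (d.a_succ (by omega)) (Or.inl rfl) _ (Or.inl ⟨rfl, rfl⟩) e he).2
  · refine pairwise_flatMap_of_cuts (1, -1) (fun j => (d.a (d.m + j), 1)) _ _ ?_ ?_ ?_ ?_
    · intro i j hij hj
      simpa [lin] using d.a_lt (i := d.m + i) (j := d.m + j) (by omega) (by omega)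
    · intro j hj
      exact upTooth_pairwise hW hL (d.a_succ (by omega)) (d.upTooth_shift _)
    · intro j hj e he
      rw [if_neg (by omega)] at he
      exact (upTooth_cuts hW hL (d.a_succ (by omega)) (Or.inr rfl) _ (Or.inr ⟨rfl, rfl⟩) e he).1
    · intro j hj e he
      rw [if_neg (by omega)] at he
      exact (upTooth_cuts hW hL (d.a_succ (by omega)) (Or.inr rfl) _ (Or.inr ⟨rfl, rfl⟩) e he).2
  · intro e he f hf
    simp only [List.mem_flatMap, List.mem_range] at he hf
    obtain ⟨i, hi, he⟩ := he
    obtain ⟨j, hj, hf⟩ := hf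
    rw [if_pos hi] at he
    rw [if_neg (by omega)] at hf
    have he := (upTooth_cuts hW hL (d.a_succ (by omega)) (Or.inl rfl) _ (Or.inl ⟨rfl, rfl⟩) e he).1
    have hf : After (1, 0) (d.a (d.m + j), 1) f := by
      revert f
      simp only [upTooth, List.cons_append, List.nil_append, pathEdges, List.mem_cons,
        List.not_mem_nil, or_false, forall_eq_or_imp, forall_eq, After, lin, ne_eq, Prod.mk.injEq,
        true_and, and_true]
      have := d.a_succ (j := d.m + j) (by omega)
      and_intros <;> first | rfl | omega
    rcases (show i + 1 ≤ d.m + j by omega).eq_or_lt with h | h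
    · rw [← h] at hf
      exact he.meetsAtEnds hf
    · exact he.meetsAtEnds_of_lt hf (by simpa [lin] using d.a_lt h (by omega))

theorem rightTeeth_pairwise : ((List.range d.m).flatMap (fun j => pathEdges (0, -d.g j)
    (rightTooth (d.g j) d.W d.L ++ [(0, -d.g (j + 1))]))).Pairwise MeetsAtEnds := by
  have hW := d.W_pos
  have hL : 1 ≤ d.L := by have := d.D_pos; have := d.L_ge; linarith
  refine pairwise_flatMap_of_cuts (0, -1) (fun j => (0, -d.g j)) _ _ ?_ ?_ ?_ ?_
  · intro i j hij hj
    simpa [lin] using d.g_lt hij hj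
  · intro j hj
    exact rightTooth_pairwise hW hL (d.g_succ hj)
  · intro j hj e he
    exact (rightTooth_cuts hW hL (d.g_succ hj) e he).1
  · intro j hj e he
    exact (rightTooth_cuts hW hL (d.g_succ hj) e he).2

theorem Q_isSimplePolygon : IsSimplePolygon d.Q := by
  have hW := d.W_pos
  have hL : 1 ≤ d.L := by have := d.D_pos; have := d.L_ge; linarith
  have hM := d.M_ge
  have ha0 := d.a_zero_ge
  have hg0 := d.g_zero_ge
  have haZ : d.a 0 < d.a (3 * d.m) := d.a_lt (by have := d.m_pos; omega) le_rfl
  have hgT : d.g 0 < (d.m + 1) * d.M := by rw [← g_m]; exact d.g_lt d.m_pos le_rfl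
  refine isSimplePolygon_comb (comb_pairwise rfl rfl (-1) (d.a 0) (d.a (3 * d.m)) (d.g 0)
    ((d.m + 1) * d.M) (Or.inr rfl) (by linarith) haZ (by linarith) hgT (by simp) (by simp) (by simp)
    (by simp) rfl rfl (by simp) (by simp [g_m]) d.upTeeth_pairwise d.rightTeeth_pairwise ?_ ?_ ?_ ?_)
    (comb_alternates rfl rfl ?_ ?_ ?_ ?_ ?_ ?_ ?_ ?_)
  · intro e he
    simp only [List.mem_flatMap, List.mem_range] at he
    obtain ⟨j, hj, he⟩ := he
    have := d.a_succ hj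
    have := d.a_ge hj.le
    have hE := d.upTooth_shift j
    revert e
    generalize (if j < d.m then 0 else d.L : ℤ) = E at *
    simp only [upTooth, List.cons_append, List.nil_append, pathEdges, List.mem_cons,
      List.not_mem_nil, or_false, forall_eq_or_imp, forall_eq]
    rcases hE with rfl | rfl <;> and_intros <;> omega
  · intro e he
    simp only [List.mem_flatMap, List.mem_range] at he
    obtain ⟨j, hj, he⟩ := he
    have := d.g_succ hj
    have := d.g_ge hj.le
    revert e
    simp only [rightTooth, List.cons_append, List.nil_append, pathEdges, List.mem_cons,
      List.not_mem_nil, or_false, forall_eq_or_imp, forall_eq]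
    and_intros <;> omega
  · intro e he
    simp only [List.mem_flatMap, List.mem_range] at he
    obtain ⟨j, hj, he⟩ := he
    have hs := d.a_succ hj
    have hA : After (1, 0) (d.a j, 1) e := by
      have hE := d.upTooth_shift j
      revert e
      generalize (if j < d.m then 0 else d.L : ℤ) = E at *
      simp only [upTooth, List.cons_append, List.nil_append, pathEdges, List.mem_cons,
        List.not_mem_nil, or_false, forall_eq_or_imp, forall_eq, After, lin, ne_eq, Prod.mk.injEq,
        true_and, and_true]
      rcases hE with rfl | rfl <;> and_intros <;> first | rfl | omega
    constructor
    · have hB : Before (1, 0) (d.a 0, 1) ((-1, 1), (d.a 0, 1)) := by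
        simp only [Before, lin, or_true, and_true]; linarith
      rcases Nat.eq_zero_or_pos j with rfl | h
      · exact hB.meetsAtEnds hA
      · exact hB.meetsAtEnds_of_lt hA (by simpa [lin] using d.a_lt h hj.le)
    -- The vertical spine edge after the last tooth lies behind the last cut for both functionals;
    -- the one parallel to the given tooth is used.
    · obtain ⟨k, hk⟩ : ∃ k : ℤ × ℤ, k = (1, 0) ∧ (if j < d.m then 0 else d.L : ℤ) = 0 ∨
          k = (1, -1) ∧ (if j < d.m then 0 else d.L : ℤ) = d.L := by
        rcases d.upTooth_shift j with h | h
        · exact ⟨(1, 0), Or.inl ⟨rfl, h⟩⟩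
        · exact ⟨(1, -1), Or.inr ⟨rfl, h⟩⟩
      have hcut := (upTooth_cuts hW hL hs (d.upTooth_shift j) k hk e he).1
      rcases hk with ⟨rfl, hk⟩ | ⟨rfl, hk⟩
      · have hA : After (1, 0) (d.a (3 * d.m), 1) ((d.a (3 * d.m), 1), (d.a (3 * d.m), 0)) := by
          simp [After, lin]
        rcases (Nat.succ_le_of_lt hj).eq_or_lt with h | h
        · rw [Nat.succ_eq_add_one] at h
          rw [h] at hcut
          exact hcut.meetsAtEnds hA
        · exact hcut.meetsAtEnds_of_lt hA (by simpa [lin] using d.a_lt h le_rfl)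
      · have hA : After (1, -1) (d.a (3 * d.m), 1) ((d.a (3 * d.m), 1), (d.a (3 * d.m), 0)) := by
          simp [After, lin]
        rcases (Nat.succ_le_of_lt hj).eq_or_lt with h | h
        · rw [Nat.succ_eq_add_one] at h
          rw [h] at hcut
          exact hcut.meetsAtEnds hA
        · exact hcut.meetsAtEnds_of_lt hA (by simpa [lin] using d.a_lt h le_rfl)
  · intro e he
    simp only [List.mem_flatMap, List.mem_range] at he
    obtain ⟨j, hj, he⟩ := he
    have hcut := rightTooth_cuts hW hL (d.g_succ hj) e he
    constructor
    · have hB : Before (0, -1) (0, -d.g 0) ((0, 0), (0, -d.g 0)) := by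
        simp only [Before, lin, or_true, and_true]; linarith
      rcases Nat.eq_zero_or_pos j with rfl | h
      · exact hB.meetsAtEnds hcut.2
      · exact hB.meetsAtEnds_of_lt hcut.2 (by simpa [lin] using d.g_lt h hj.le)
    · have hA : After (0, -1) (0, -d.g d.m) ((0, -d.g d.m), (-1, -((d.m + 1) * d.M))) := by
        simp [After, lin, g_m]
      rcases (Nat.succ_le_of_lt hj).eq_or_lt with h | h
      · rw [Nat.succ_eq_add_one] at h
        rw [h] at hcut
        exact hcut.1.meetsAtEnds hA
      · exact hcut.1.meetsAtEnds_of_lt hA (by simpa [lin] using d.g_lt h le_rfl)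
  · simp only; linarith
  · simp only [true_and]; linarith
  · simp
  · simp only [true_and]; linarith
  · simp only; linarith
  · simp [g_m]
  · refine Alternates.flatMap fun j hj => ?_
    rw [List.mem_range] at hj
    exact upTooth_alternates hW hL (d.a_succ hj)
  · refine Alternates.flatMap fun j hj => ?_
    rw [List.mem_range] at hj
    exact rightTooth_alternates hW hL (d.g_succ hj)

theorem P_edgesAdmissible : EdgesAdmissible d.P := by
  have hs : ∀ i : ℕ, (((i + 1 : ℕ) : ℤ) * d.D, (-1 : ℤ)) = (i * d.D + d.D, -1) := fun i => by
    push_cast; rw [add_mul, one_mul]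
  intro e he
  simp only [P, polyEdges_comb, List.mem_cons, List.mem_append, List.not_mem_nil, or_false,
    List.mem_flatMap, hs, c_succ] at he
  rcases he with rfl | rfl | ⟨i, -, he⟩ | rfl | rfl | rfl | ⟨i, -, he⟩ | rfl
  · simp
  · simp
  · exact barTooth_admissible e he
  · simp
  · simp
  · simp
  · exact sideTooth_admissible (by split_ifs <;> simp) e he
  · simp [c]

theorem Q_edgesAdmissible : EdgesAdmissible d.Q := by
  intro e he
  simp only [Q, polyEdges_comb, List.mem_cons, List.mem_append, List.not_mem_nil, or_false,
    List.mem_flatMap] at he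
  rcases he with rfl | rfl | ⟨j, -, he⟩ | rfl | rfl | rfl | ⟨j, -, he⟩ | rfl
  · simp
  · simp
  · exact upTooth_admissible (d.upTooth_shift j) e he
  · simp
  · simp
  · simp
  · exact rightTooth_admissible e he
  · simp [g_m]

theorem P_length : d.P.length = 18 * d.n + 6 := by
  simp only [P, comb, barTooth, sideTooth, List.length_cons, List.length_append, List.length_nil,
    List.length_flatMap, List.map_const', List.sum_replicate, List.length_range, smul_eq_mul]
  ring

theorem Q_length : d.Q.length = 16 * d.m + 6 := by
  simp only [Q, comb, upTooth, rightTooth, List.length_cons, List.length_append, List.length_nil,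
    List.length_flatMap, List.map_const', List.sum_replicate, List.length_range, smul_eq_mul]
  ring

end SumData

/-! ### Crossing parities -/

open Classical in
/-- The indicator of `CrossesAbove`, modulo `2`. -/
noncomputable def crossing (p : ℝ × ℝ) (e : (ℤ × ℤ) × (ℤ × ℤ)) : ZMod 2 :=
  if CrossesAbove p e then 1 else 0

/-- The number of crossings of a list of edges, modulo `2`. -/
noncomputable def parity (p : ℝ × ℝ) (l : List ((ℤ × ℤ) × (ℤ × ℤ))) : ZMod 2 :=
  (l.map (crossing p)).sum

open Classical in
/-- The indicator of the half-plane to the left of `a`. -/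
noncomputable def leftOf (p : ℝ × ℝ) (a : ℤ) : ZMod 2 := if p.1 < a then 1 else 0

open Classical in
/-- The indicator of the half-plane below `a`. -/
noncomputable def below (p : ℝ × ℝ) (a : ℤ) : ZMod 2 := if p.2 < a then 1 else 0

theorem parity_nil (p : ℝ × ℝ) : parity p [] = 0 := rfl

theorem parity_cons (p : ℝ × ℝ) (e : (ℤ × ℤ) × (ℤ × ℤ)) (l : List ((ℤ × ℤ) × (ℤ × ℤ))) :
    parity p (e :: l) = crossing p e + parity p l := by simp [parity]

theorem parity_append (p : ℝ × ℝ) (l l' : List ((ℤ × ℤ) × (ℤ × ℤ))) :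
    parity p (l ++ l') = parity p l + parity p l' := by simp [parity]

theorem parity_flatMap_range (p : ℝ × ℝ) (f : ℕ → List ((ℤ × ℤ) × (ℤ × ℤ))) (r : ℕ) :
    parity p ((List.range r).flatMap f) = ∑ i ∈ Finset.range r, parity p (f i) := by
  induction r with
  | zero => rfl
  | succ r ih =>
    rw [List.range_succ, List.flatMap_append, parity_append, ih, Finset.sum_range_succ]
    simp

open Classical in
theorem odd_countP_iff_parity (p : ℝ × ℝ) (l : List ((ℤ × ℤ) × (ℤ × ℤ))) :
    Odd (l.countP (fun e => decide (CrossesAbove p e))) ↔ parity p l = 1 := by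
  rw [← ZMod.natCast_eq_one_iff_odd]
  suffices ((l.countP (fun e => decide (CrossesAbove p e)) : ℕ) : ZMod 2) = parity p l by rw [this]
  induction l with
  | nil => simp [parity]
  | cons e l ih =>
    rw [parity_cons, List.countP_cons, Nat.cast_add, ih, add_comm]
    congr 1
    simp only [crossing]
    split_ifs <;> simp_all

open Classical in
/-- The indicator of the half-plane to the right of a diagonal line. -/
noncomputable def rightOfDiag (p : ℝ × ℝ) (a : ℤ) : ZMod 2 := if p.2 - p.1 < a then 1 else 0

theorem leftOf_eq_one {p : ℝ × ℝ} {a : ℤ} (h : p.1 < a) : leftOf p a = 1 := if_pos h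

theorem leftOf_eq_zero {p : ℝ × ℝ} {a : ℤ} (h : a ≤ p.1) : leftOf p a = 0 := if_neg h.not_gt

theorem below_eq_one {p : ℝ × ℝ} {a : ℤ} (h : p.2 < a) : below p a = 1 := if_pos h

theorem below_eq_zero {p : ℝ × ℝ} {a : ℤ} (h : a ≤ p.2) : below p a = 0 := if_neg h.not_gt

theorem rightOfDiag_eq_one {p : ℝ × ℝ} {a : ℤ} (h : p.2 - p.1 < a) : rightOfDiag p a = 1 :=
  if_pos h

theorem rightOfDiag_eq_zero {p : ℝ × ℝ} {a : ℤ} (h : a ≤ p.2 - p.1) : rightOfDiag p a = 0 :=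
  if_neg h.not_gt

theorem leftOf_add_ne_zero {p : ℝ × ℝ} {a a' : ℤ} (ha : a ≤ a')
    (h : leftOf p a + leftOf p a' ≠ 0) : a ≤ p.1 ∧ p.1 < a' := by
  have ha : (a : ℝ) ≤ a' := by exact_mod_cast ha
  contrapose! h
  rcases lt_or_ge p.1 a with h1 | h1
  · rw [leftOf_eq_one h1, leftOf_eq_one (h1.trans_le ha)]; rfl
  · rw [leftOf_eq_zero h1, leftOf_eq_zero (h h1)]; rfl

theorem below_add_ne_zero {p : ℝ × ℝ} {a a' : ℤ} (ha : a ≤ a')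
    (h : below p a + below p a' ≠ 0) : a ≤ p.2 ∧ p.2 < a' :=
  leftOf_add_ne_zero (p := p.swap) ha h

theorem rightOfDiag_add_ne_zero {p : ℝ × ℝ} {a a' : ℤ} (ha : a ≤ a')
    (h : rightOfDiag p a + rightOfDiag p a' ≠ 0) : a ≤ p.2 - p.1 ∧ p.2 - p.1 < a' :=
  leftOf_add_ne_zero (p := (p.2 - p.1, 0)) ha h

theorem zmod_two_eq_zero : (2 : ZMod 2) = 0 := rfl

theorem ne_zero_or_of_mul_add {a b c d : ZMod 2} (h : a * b + c * d ≠ 0) :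
    (a ≠ 0 ∧ b ≠ 0) ∨ (c ≠ 0 ∧ d ≠ 0) := by
  revert h; revert a b c d; decide

theorem crossing_vertical (p : ℝ × ℝ) (x y y' : ℤ) : crossing p ((x, y), (x, y')) = 0 := by
  refine if_neg ?_
  rintro ⟨⟨h, h'⟩ | ⟨h, h'⟩, -⟩ <;> linarith

/-- Modulo 2, the half-open range of x-coordinates is the sum of two half-plane indicators, in
whichever direction the edge runs. This makes every crossing a polynomial in half-plane indicators,
and cancellation becomes algebra. -/
theorem crossing_eq {p : ℝ × ℝ} {x x' y y' : ℤ} {q : Prop} [Decidable q]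
    (h : (x : ℝ) ≠ x' → (p.2 < y + (p.1 - x) * (y' - y) / (x' - x) ↔ q)) :
    crossing p ((x, y), (x', y')) = (leftOf p x + leftOf p x') * if q then 1 else 0 := by
  have h11 : (1 + 1 : ZMod 2) = 0 := rfl
  by_cases hx : x = x'
  · subst hx
    rw [crossing_vertical, ← two_mul, zmod_two_eq_zero, zero_mul, zero_mul]
  have h := h (by exact_mod_cast hx)
  simp only [crossing, CrossesAbove, leftOf, h, ← not_lt]
  by_cases h1 : p.1 < x <;> by_cases h2 : p.1 < x' <;> by_cases h3 : q <;> simp [h1, h2, h3, h11]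

theorem crossing_horizontal (p : ℝ × ℝ) (x x' y : ℤ) :
    crossing p ((x, y), (x', y)) = (leftOf p x + leftOf p x') * below p y := by
  classical
  rw [crossing_eq (q := p.2 < y) (fun _ => by simp)]
  simp only [below]

theorem crossing_diagonal (p : ℝ × ℝ) (x y x' y' : ℤ) (h : x' - x = y' - y) :
    crossing p ((x, y), (x', y')) =
      (leftOf p x + leftOf p x') * rightOfDiag p (y - x) := by
  classical
  have hR : (y' : ℝ) - y = x' - x := by exact_mod_cast h.symm
  rw [crossing_eq (q := p.2 - p.1 < (y - x : ℤ)) ?_]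
  · simp only [rightOfDiag]
  · intro hne
    rw [hR, mul_div_cancel_right₀ _ (sub_ne_zero.2 hne.symm)]
    push_cast
    constructor <;> intro <;> linarith

/-- The crossings of a diagonal edge by the upward ray, in terms of those by the leftward ray. -/
theorem crossing_diagonal' (p : ℝ × ℝ) (x y x' y' : ℤ) (h : x' - x = y' - y) :
    crossing p ((x, y), (x', y')) =
      (1 + leftOf p x) * below p y + (1 + leftOf p x') * below p y' +
        (below p y + below p y') * rightOfDiag p (y - x) := by
  rw [crossing_diagonal p x y x' y' h]
  -- The vertical, horizontal and diagonal lines through an endpoint are concurrent, so not all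
  -- eight sign patterns occur; on the possible ones the identity holds modulo 2.
  have key : ∀ a b : ℤ, b - a = y - x →
      leftOf p a * rightOfDiag p (y - x) =
        (1 + leftOf p a) * below p b + below p b * rightOfDiag p (y - x) := by
    intro a b hab
    have hab : (b : ℝ) - a = (y - x : ℤ) := by exact_mod_cast hab
    rcases lt_or_ge p.1 a with h1 | h1 <;> rcases lt_or_ge (p.2 - p.1) (y - x : ℤ) with h3 | h3
    · rw [leftOf_eq_one h1, rightOfDiag_eq_one h3, below_eq_one (by linarith)]; rfl
    · rw [leftOf_eq_one h1, rightOfDiag_eq_zero h3]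
      linear_combination (-below p b) * zmod_two_eq_zero
    · rw [leftOf_eq_zero h1, rightOfDiag_eq_one h3]
      linear_combination (-below p b) * zmod_two_eq_zero
    · rw [leftOf_eq_zero h1, rightOfDiag_eq_zero h3, below_eq_zero (by linarith)]; rfl
  linear_combination key x y rfl + key x' y' (by omega)

/-- The contribution of the two spines of a comb to the crossing parity. -/
noncomputable def spineParity (p : ℝ × ℝ) (y Z T : ℤ) : ZMod 2 :=
  (leftOf p (-1) + leftOf p Z) * below p y + (leftOf p Z + leftOf p 0) * below p 0 +
    (leftOf p 0 + leftOf p (-1)) * below p T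

/-- Each tooth of the first spine is closed by the chord along the spine, and the chords together
are returned to the spine; then teeth and spine contribute like separate closed curves. The chords
on the second spine are vertical and never crossed, so no correction is needed there. -/
theorem parity_comb (p : ℝ × ℝ) (T y : ℤ) (s t : ℕ → ℤ) (X Y : ℕ → List (ℤ × ℤ)) (r r' : ℕ)
    (hT : t r' = T) :
    parity p (polyEdges (comb (-1, T) (-1, y) (s r, 0) (0, 0) (fun i => (s i, y))
      (fun i => (0, t i)) X Y r r')) =
      ∑ i ∈ Finset.range r, (parity p (pathEdges (s i, y) (X i ++ [(s (i + 1), y)])) +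
        (leftOf p (s i) + leftOf p (s (i + 1))) * below p y) +
      ∑ i ∈ Finset.range r', parity p (pathEdges (0, t i) (Y i ++ [(0, t (i + 1))])) +
      spineParity p y (s r) T := by
  have h2 : (2 : ZMod 2) = 0 := rfl
  have htel : ∑ i ∈ Finset.range r, (leftOf p (s i) + leftOf p (s (i + 1))) * below p y =
      (leftOf p (s 0) + leftOf p (s r)) * below p y := by
    induction r with
    | zero => simp only [Finset.range_zero, Finset.sum_empty]; linear_combination (-leftOf p (s 0) * below p y) * h2
    | succ r ih => rw [Finset.sum_range_succ, ih]; linear_combination (leftOf p (s r) * below p y) * h2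
  rw [Finset.sum_add_distrib, htel, polyEdges_comb]
  simp only [parity_cons, parity_append, parity_flatMap_range, parity_nil, crossing_horizontal,
    crossing_vertical, hT, spineParity]
  linear_combination (-leftOf p (s r) * below p y) * h2

/-! ### Crossing parities of the teeth -/

theorem barTooth_parity (p : ℝ × ℝ) (b h W H D : ℤ) :
    parity p (pathEdges (b, -1) (barTooth b h W H ++ [(b + D, -1)])) +
        (leftOf p b + leftOf p (b + D)) * below p (-1) =
      (leftOf p b + leftOf p (b + 1)) * (below p (-h - W) + below p (-1)) +
        (leftOf p (b + 1) + leftOf p (b + H)) * (below p (-h - W) + below p (-h)) := by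
  simp only [barTooth, List.cons_append, List.nil_append, pathEdges, parity_cons, parity_nil,
    crossing_horizontal, crossing_vertical]
  linear_combination (leftOf p (b + D) * below p (-1) - leftOf p (b + 1) * below p (-h - W)) *
    zmod_two_eq_zero

/-- Exact half-open regions are not needed. A closed cover serves for upper bounds on the area, and
the open bar, on which the contribution is one, for lower bounds; the same pair of statements is
proved for each kind of tooth. -/
theorem barTooth_parity_cover {p : ℝ × ℝ} {b h W H D : ℤ} (hh : 2 ≤ h) (hW : 1 ≤ W) (hH : 2 ≤ H)
    (hp : parity p (pathEdges (b, -1) (barTooth b h W H ++ [(b + D, -1)])) +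
      (leftOf p b + leftOf p (b + D)) * below p (-1) ≠ 0) :
    (b ≤ p.1 ∧ p.1 ≤ b + H ∧ -h - W ≤ p.2 ∧ p.2 ≤ -h) ∨
      (b ≤ p.1 ∧ p.1 ≤ b + 1 ∧ -h ≤ p.2 ∧ p.2 ≤ -1) := by
  have hHR : (2 : ℝ) ≤ H := by exact_mod_cast hH
  rw [barTooth_parity] at hp
  rcases ne_zero_or_of_mul_add hp with ⟨h1, h2⟩ | ⟨h1, h2⟩
  · have h1 := leftOf_add_ne_zero (by omega) h1
    have h2 := below_add_ne_zero (by omega) h2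
    push_cast at h1 h2
    rcases le_total p.2 (-h) with h3 | h3
    · left; refine ⟨?_, ?_, ?_, ?_⟩ <;> linarith
    · right; refine ⟨?_, ?_, ?_, ?_⟩ <;> linarith
  · have h1 := leftOf_add_ne_zero (by omega) h1
    have h2 := below_add_ne_zero (by omega) h2
    push_cast at h1 h2
    left; refine ⟨?_, ?_, ?_, ?_⟩ <;> linarith

theorem barTooth_parity_open {p : ℝ × ℝ} {b h W H D : ℤ} (hh : 2 ≤ h)
    (h1 : b < p.1) (h2 : p.1 < b + H) (h3 : -h - W < p.2) (h4 : p.2 < -h) :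
    parity p (pathEdges (b, -1) (barTooth b h W H ++ [(b + D, -1)])) +
      (leftOf p b + leftOf p (b + D)) * below p (-1) = 1 := by
  have hhR : (2 : ℝ) ≤ h := by exact_mod_cast hh
  rw [barTooth_parity, leftOf_eq_zero h1.le, below_eq_zero (a := -h - W) (by push_cast; linarith),
    below_eq_one (a := -1) (by push_cast; linarith), below_eq_one (a := -h) (by push_cast; linarith),
    leftOf_eq_one (a := b + H) (by push_cast; linarith)]
  linear_combination leftOf p (b + 1) * zmod_two_eq_zero

theorem sideTooth_parity (p : ℝ × ℝ) (c X W H D : ℤ) :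
    parity p (pathEdges (0, c) (sideTooth c X W H 0 0 ++ [(0, c + D)])) =
      (leftOf p 0 + leftOf p X) * (below p c + below p (c + 1)) +
        (leftOf p X + leftOf p (X + W)) * (below p c + below p (c + H)) := by
  simp only [sideTooth, List.cons_append, List.nil_append, pathEdges, parity_cons, parity_nil,
    crossing_horizontal, crossing_vertical, add_zero]
  linear_combination (-(leftOf p X * below p c)) * zmod_two_eq_zero

/-- The diagonal sides are counted by the leftward ray, because the tooth is simple in horizontal
slices: a slice of height 1 that contains the stem, and the rest of the slanted bar above it. -/
theorem sideTooth_diagonal_parity (p : ℝ × ℝ) (c X W H D : ℤ) :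
    parity p (pathEdges (0, c) (sideTooth c X W H H 1 ++ [(0, c + D)])) =
      (below p c + below p (c + 1)) * (rightOfDiag p (c - X - W) + 1 + leftOf p 0) +
        (below p (c + 1) + below p (c + H)) *
          (rightOfDiag p (c - X - W) + rightOfDiag p (c - X)) := by
  simp only [sideTooth, List.cons_append, List.nil_append, pathEdges, parity_cons, parity_nil,
    crossing_horizontal, crossing_vertical, add_zero,
    crossing_diagonal' p (X + W) c (X + W + H) (c + H) (by ring),
    crossing_diagonal' p (X + H) (c + H) (X + 1) (c + 1) (by ring),
    show c - (X + W) = c - X - W by ring, show c + H - (X + H) = c - X by ring]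
  generalize rightOfDiag p (c - X - W) = r
  generalize rightOfDiag p (c - X) = r'
  generalize leftOf p 0 = l
  generalize leftOf p (X + W) = l1
  generalize leftOf p (X + 1) = l2
  generalize leftOf p (X + H) = l3
  generalize leftOf p (X + W + H) = l4
  generalize below p c = b
  generalize below p (c + 1) = b1
  generalize below p (c + H) = b2
  linear_combination (l1 * b + l4 * b2 + l3 * b2 + b2 + l2 * b1 - r * b1) * zmod_two_eq_zero

theorem sideTooth_parity_cover {p : ℝ × ℝ} {c X W H D E u : ℤ} (hX : 2 ≤ X) (hW : 1 ≤ W)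
    (hH : 2 ≤ H) (hE : E = 0 ∧ u = 0 ∨ E = H ∧ u = 1)
    (hp : parity p (pathEdges (0, c) (sideTooth c X W H E u ++ [(0, c + D)])) ≠ 0) :
    (X ≤ p.1 - u * (p.2 - c) ∧ p.1 - u * (p.2 - c) ≤ X + W ∧ c ≤ p.2 ∧ p.2 ≤ c + H) ∨
      (0 ≤ p.1 ∧ p.1 ≤ X + W + 1 ∧ c ≤ p.2 ∧ p.2 ≤ c + 1) := by
  have hWR : (1 : ℝ) ≤ W := by exact_mod_cast hW
  have hXR : (2 : ℝ) ≤ X := by exact_mod_cast hX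
  rcases hE with ⟨rfl, rfl⟩ | ⟨rfl, rfl⟩
  · rw [sideTooth_parity] at hp
    simp only [Int.cast_zero, zero_mul, sub_zero]
    rcases ne_zero_or_of_mul_add hp with ⟨h1, h2⟩ | ⟨h1, h2⟩
    · have h1 := leftOf_add_ne_zero (by omega) h1
      have h2 := below_add_ne_zero (by omega) h2
      push_cast at h1 h2
      right; refine ⟨?_, ?_, ?_, ?_⟩ <;> linarith
    · have h1 := leftOf_add_ne_zero (by omega) h1
      have h2 := below_add_ne_zero (by omega) h2
      push_cast at h1 h2
      left; refine ⟨?_, ?_, ?_, ?_⟩ <;> linarith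
  · rw [sideTooth_diagonal_parity] at hp
    simp only [Int.cast_one, one_mul]
    rcases ne_zero_or_of_mul_add hp with ⟨h2, h1⟩ | ⟨h2, h1⟩
    · have h2 := below_add_ne_zero (by omega) h2
      push_cast at h2
      right
      refine ⟨?_, ?_, by linarith, by linarith⟩
      · by_contra hneg
        push Not at hneg
        rw [leftOf_eq_one (by simpa using hneg), rightOfDiag_eq_zero (by push_cast; linarith)] at h1
        exact h1 rfl
      · by_contra hneg
        push Not at hneg
        rw [leftOf_eq_zero (by push_cast; linarith),
          rightOfDiag_eq_one (by push_cast; linarith)] at h1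
        exact h1 rfl
    · have h1 := rightOfDiag_add_ne_zero (by omega) h1
      have h2 := below_add_ne_zero (by omega) h2
      push_cast at h1 h2
      left; refine ⟨?_, ?_, ?_, ?_⟩ <;> linarith

theorem sideTooth_parity_open {p : ℝ × ℝ} {c X W H D E u : ℤ} (hX : 2 ≤ X)
    (hE : E = 0 ∧ u = 0 ∨ E = H ∧ u = 1)
    (h1 : X < p.1 - u * (p.2 - c)) (h2 : p.1 - u * (p.2 - c) < X + W) (h3 : c < p.2)
    (h4 : p.2 < c + H) :
    parity p (pathEdges (0, c) (sideTooth c X W H E u ++ [(0, c + D)])) = 1 := by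
  have hXR : (2 : ℝ) ≤ X := by exact_mod_cast hX
  rcases hE with ⟨rfl, rfl⟩ | ⟨rfl, rfl⟩
  · simp only [Int.cast_zero, zero_mul, sub_zero] at h1 h2
    rw [sideTooth_parity, leftOf_eq_zero (a := 0) (by push_cast; linarith),
      leftOf_eq_zero (a := X) (by linarith), leftOf_eq_one (a := X + W) (by push_cast; linarith),
      below_eq_zero (a := c) h3.le, below_eq_one (a := c + H) (by push_cast; linarith)]
    ring
  · simp only [Int.cast_one, one_mul] at h1 h2
    rw [sideTooth_diagonal_parity, leftOf_eq_zero (a := 0) (by push_cast; linarith),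
      below_eq_zero (a := c) h3.le, below_eq_one (a := c + E) (by push_cast; linarith),
      rightOfDiag_eq_zero (a := c - X - W) (by push_cast; linarith),
      rightOfDiag_eq_one (a := c - X) (by push_cast; linarith)]
    linear_combination below p (c + 1) * zmod_two_eq_zero

theorem upTooth_parity (p : ℝ × ℝ) (a a' W L : ℤ) :
    parity p (pathEdges (a, 1) (upTooth a W L 0 ++ [(a', 1)])) +
        (leftOf p a + leftOf p a') * below p 1 =
      (leftOf p a + leftOf p (a + W)) * (below p 1 + below p (1 + L)) := by
  simp only [upTooth, List.cons_append, List.nil_append, pathEdges, parity_cons, parity_nil,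
    crossing_horizontal, crossing_vertical, add_zero]
  linear_combination (leftOf p a' * below p 1) * zmod_two_eq_zero

theorem upTooth_diagonal_parity (p : ℝ × ℝ) (a a' W L : ℤ) :
    parity p (pathEdges (a, 1) (upTooth a W L L ++ [(a', 1)])) +
        (leftOf p a + leftOf p a') * below p 1 =
      (rightOfDiag p (1 - a - W) + rightOfDiag p (1 - a)) * (below p 1 + below p (1 + L)) := by
  simp only [upTooth, List.cons_append, List.nil_append, pathEdges, parity_cons, parity_nil,
    crossing_horizontal, add_zero,
    crossing_diagonal' p a 1 (a + L) (1 + L) (by ring),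
    crossing_diagonal' p (a + W + L) (1 + L) (a + W) 1 (by ring),
    show 1 + L - (a + W + L) = 1 - a - W by ring]
  generalize rightOfDiag p (1 - a - W) = r
  generalize rightOfDiag p (1 - a) = r'
  generalize leftOf p a = l
  generalize leftOf p a' = l0
  generalize leftOf p (a + W) = l1
  generalize leftOf p (a + L) = l3
  generalize leftOf p (a + W + L) = l4
  generalize below p 1 = b
  generalize below p (1 + L) = b1
  linear_combination (l * b + l3 * b1 + l4 * b1 + b1 + b + l1 * b + l0 * b) * zmod_two_eq_zero

theorem upTooth_parity_cover {p : ℝ × ℝ} {a a' W L E u : ℤ} (hW : 1 ≤ W) (hL : 1 ≤ L)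
    (hE : E = 0 ∧ u = 0 ∨ E = L ∧ u = 1)
    (hp : parity p (pathEdges (a, 1) (upTooth a W L E ++ [(a', 1)])) +
      (leftOf p a + leftOf p a') * below p 1 ≠ 0) :
    a ≤ p.1 - u * (p.2 - 1) ∧ p.1 - u * (p.2 - 1) ≤ a + W ∧ 1 ≤ p.2 ∧ p.2 ≤ 1 + L := by
  rcases hE with ⟨rfl, rfl⟩ | ⟨rfl, rfl⟩
  · rw [upTooth_parity] at hp
    have h1 := leftOf_add_ne_zero (by omega) (left_ne_zero_of_mul hp)
    have h2 := below_add_ne_zero (by omega) (right_ne_zero_of_mul hp)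
    push_cast at h1 h2 ⊢
    refine ⟨?_, ?_, ?_, ?_⟩ <;> linarith
  · rw [upTooth_diagonal_parity] at hp
    have h1 := rightOfDiag_add_ne_zero (by omega) (left_ne_zero_of_mul hp)
    have h2 := below_add_ne_zero (by omega) (right_ne_zero_of_mul hp)
    push_cast at h1 h2 ⊢
    refine ⟨?_, ?_, ?_, ?_⟩ <;> linarith

theorem upTooth_parity_open {p : ℝ × ℝ} {a a' W L E u : ℤ}
    (hE : E = 0 ∧ u = 0 ∨ E = L ∧ u = 1)
    (h1 : a < p.1 - u * (p.2 - 1)) (h2 : p.1 - u * (p.2 - 1) < a + W) (h3 : 1 < p.2)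
    (h4 : p.2 < 1 + L) :
    parity p (pathEdges (a, 1) (upTooth a W L E ++ [(a', 1)])) +
      (leftOf p a + leftOf p a') * below p 1 = 1 := by
  rcases hE with ⟨rfl, rfl⟩ | ⟨rfl, rfl⟩
  · simp only [Int.cast_zero, zero_mul, sub_zero] at h1 h2
    rw [upTooth_parity, leftOf_eq_zero (a := a) h1.le,
      leftOf_eq_one (a := a + W) (by push_cast; linarith),
      below_eq_zero (a := 1) (by push_cast; linarith),
      below_eq_one (a := 1 + L) (by push_cast; linarith)]
    rfl
  · simp only [Int.cast_one, one_mul] at h1 h2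
    rw [upTooth_diagonal_parity, below_eq_zero (a := 1) (by push_cast; linarith),
      below_eq_one (a := 1 + E) (by push_cast; linarith),
      rightOfDiag_eq_zero (a := 1 - a - W) (by push_cast; linarith),
      rightOfDiag_eq_one (a := 1 - a) (by push_cast; linarith)]
    rfl

theorem rightTooth_parity (p : ℝ × ℝ) (g g' W L : ℤ) :
    parity p (pathEdges (0, -g) (rightTooth g W L ++ [(0, -g')])) =
      (leftOf p 0 + leftOf p L) * (below p (-g - W) + below p (-g)) := by
  simp only [rightTooth, List.cons_append, List.nil_append, pathEdges, parity_cons, parity_nil,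
    crossing_horizontal, crossing_vertical]
  ring

theorem rightTooth_parity_cover {p : ℝ × ℝ} {g g' W L : ℤ} (hW : 1 ≤ W) (hL : 1 ≤ L)
    (hp : parity p (pathEdges (0, -g) (rightTooth g W L ++ [(0, -g')])) ≠ 0) :
    0 ≤ p.1 ∧ p.1 ≤ L ∧ -g - W ≤ p.2 ∧ p.2 ≤ -g := by
  rw [rightTooth_parity] at hp
  have h1 := leftOf_add_ne_zero (by omega) (left_ne_zero_of_mul hp)
  have h2 := below_add_ne_zero (by omega) (right_ne_zero_of_mul hp)
  push_cast at h1 h2 ⊢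
  refine ⟨?_, ?_, ?_, ?_⟩ <;> linarith

theorem rightTooth_parity_open {p : ℝ × ℝ} {g g' W L : ℤ}
    (h1 : 0 < p.1) (h2 : p.1 < L) (h3 : -g - W < p.2) (h4 : p.2 < -g) :
    parity p (pathEdges (0, -g) (rightTooth g W L ++ [(0, -g')])) = 1 := by
  rw [rightTooth_parity, leftOf_eq_zero (a := 0) (by push_cast; linarith), leftOf_eq_one h2,
    below_eq_zero (a := -g - W) (by push_cast; linarith),
    below_eq_one (a := -g) (by push_cast; linarith)]
  rfl

/-- The boxes are generous and symmetric in `T`, so that both orientations have the same conclusion;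
the waste is harmless since they remain thin. -/
theorem spineParity_cover {p : ℝ × ℝ} {y Z T : ℤ} (hy : y = 1 ∧ T < 0 ∨ y = -1 ∧ 0 < T) (hZ : 0 < Z)
    (hp : spineParity p y Z T ≠ 0) :
    (-1 ≤ p.1 ∧ p.1 ≤ Z ∧ -1 ≤ p.2 ∧ p.2 ≤ 1) ∨
      (-1 ≤ p.1 ∧ p.1 ≤ 0 ∧ -1 - |T| ≤ p.2 ∧ p.2 ≤ 1 + |T|) := by
  have h : spineParity p y Z T = (leftOf p (-1) + leftOf p 0) * (below p y + below p T) +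
      (leftOf p 0 + leftOf p Z) * (below p y + below p 0) := by
    simp only [spineParity]
    linear_combination (-leftOf p 0 * below p y) * zmod_two_eq_zero
  rw [h] at hp
  rcases ne_zero_or_of_mul_add hp with ⟨h1, h2⟩ | ⟨h1, h2⟩
  · right
    have h1 := leftOf_add_ne_zero (by omega) h1
    have hT := abs_nonneg (T : ℝ)
    have hT1 := neg_abs_le (T : ℝ)
    have hT2 := le_abs_self (T : ℝ)
    rcases hy with ⟨rfl, h0⟩ | ⟨rfl, h0⟩
    · rw [add_comm] at h2
      have h2 := below_add_ne_zero (by omega) h2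
      push_cast at h1 h2 ⊢
      refine ⟨?_, ?_, ?_, ?_⟩ <;> linarith
    · have h2 := below_add_ne_zero (by omega) h2
      push_cast at h1 h2 ⊢
      refine ⟨?_, ?_, ?_, ?_⟩ <;> linarith
  · left
    have h1 := leftOf_add_ne_zero (by omega) h1
    rcases hy with ⟨rfl, h0⟩ | ⟨rfl, h0⟩
    · rw [add_comm (below p 1)] at h2
      have h2 := below_add_ne_zero (by omega) h2
      push_cast at h1 h2 ⊢
      refine ⟨?_, ?_, ?_, ?_⟩ <;> linarith
    · have h2 := below_add_ne_zero (by omega) h2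
      push_cast at h1 h2 ⊢
      refine ⟨?_, ?_, ?_, ?_⟩ <;> linarith

/-! ### The regions bounded by the two polygons -/

theorem mem_polyRegion_of_parity {p : ℝ × ℝ} {l : List (ℤ × ℤ)} (h : parity p (polyEdges l) = 1) :
    p ∈ polyRegion l := Or.inr ((odd_countP_iff_parity p _).2 h)

theorem edge_or_parity_of_mem_polyRegion {p : ℝ × ℝ} {l : List (ℤ × ℤ)} (h : p ∈ polyRegion l) :
    (∃ e ∈ polyEdges l, p ∈ edgeSegment e) ∨ parity p (polyEdges l) = 1 :=
  h.imp id fun h => (odd_countP_iff_parity p _).1 h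

theorem exists_of_add_add_eq_one {r r' : ℕ} {β γ : ℕ → ZMod 2} {c : ZMod 2}
    (h : ∑ i ∈ Finset.range r, β i + ∑ i ∈ Finset.range r', γ i + c = 1) :
    (∃ i < r, β i ≠ 0) ∨ (∃ i < r', γ i ≠ 0) ∨ c ≠ 0 := by
  by_contra! hcon
  obtain ⟨h1, h2, h3⟩ := hcon
  rw [Finset.sum_eq_zero (fun i hi => h1 i (Finset.mem_range.1 hi)),
    Finset.sum_eq_zero (fun i hi => h2 i (Finset.mem_range.1 hi)), h3] at h
  exact absurd h (by decide)

namespace SumData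

variable (d : SumData)

/-- The offset of the diagonal bars. -/
def z (i : ℕ) : ℤ := d.m * d.M + 4 * d.W * d.V + 1 + 4 * d.W * d.X₃ i

theorem x_of_lt {i : ℕ} (hi : i < d.n) : d.x i = 4 * d.W * d.X₁ i := if_pos hi

theorem x_add (i : ℕ) : d.x (d.n + i) = d.c (d.n + i) + d.z i := by
  rw [x, if_neg (by omega), z, Nat.add_sub_cancel_left]

theorem c_gap {i j : ℕ} (hij : i < j) : d.c i + d.D ≤ d.c j := by
  rw [← c_succ]
  rcases (Nat.succ_le_of_lt hij).eq_or_lt with h | h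
  · rw [← h]
  · exact (d.c_lt h).le

theorem a_gap {i j : ℕ} (hij : i < j) (hj : j ≤ 3 * d.m) : d.a i + d.W < d.a j := by
  have h1 := d.a_succ (j := i) (by omega)
  rcases (Nat.succ_le_of_lt hij).eq_or_lt with h | h
  · rw [← h]; exact h1
  · exact h1.trans (d.a_lt h hj)

theorem g_gap {i j : ℕ} (hij : i < j) (hj : j ≤ d.m) : d.g i + d.W < d.g j := by
  have h1 := d.g_succ (j := i) (by omega)
  rcases (Nat.succ_le_of_lt hij).eq_or_lt with h | h
  · rw [← h]; exact h1
  · exact h1.trans (d.g_lt h hj)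

theorem mul_D_gap {i j : ℕ} (hij : i < j) : (i : ℤ) * d.D + d.D ≤ j * d.D := by
  have := d.c_gap hij
  simp only [c] at this; linarith

/-- The contribution of a tooth below the first polygon to the crossing parity. -/
noncomputable def barParity (p : ℝ × ℝ) (i : ℕ) : ZMod 2 :=
  parity p (pathEdges (i * d.D, -1) (barTooth (i * d.D) (d.h i) d.W d.H ++ [(i * d.D + d.D, -1)])) +
    (leftOf p (i * d.D) + leftOf p (i * d.D + d.D)) * below p (-1)

/-- The contribution of a tooth on the right of the first polygon to the crossing parity. -/
noncomputable def sideParity (p : ℝ × ℝ) (i : ℕ) : ZMod 2 :=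
  parity p (pathEdges (0, d.c i) (sideTooth (d.c i) (d.x i) d.W d.H (if i < d.n then 0 else d.H)
    (if i < d.n then 0 else 1) ++ [(0, d.c i + d.D)]))

/-- The contribution of a tooth above the second polygon to the crossing parity. -/
noncomputable def upParity (p : ℝ × ℝ) (j : ℕ) : ZMod 2 :=
  parity p (pathEdges (d.a j, 1) (upTooth (d.a j) d.W d.L (if j < d.m then 0 else d.L) ++
    [(d.a (j + 1), 1)])) + (leftOf p (d.a j) + leftOf p (d.a (j + 1))) * below p 1

/-- The contribution of a tooth on the right of the second polygon to the crossing parity. -/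
noncomputable def rightParity (p : ℝ × ℝ) (j : ℕ) : ZMod 2 :=
  parity p (pathEdges (0, -d.g j) (rightTooth (d.g j) d.W d.L ++ [(0, -d.g (j + 1))]))

theorem parity_P (p : ℝ × ℝ) :
    parity p (polyEdges d.P) = ∑ i ∈ Finset.range d.n, d.barParity p i +
      ∑ i ∈ Finset.range (2 * d.n), d.sideParity p i +
      spineParity p (-1) (d.n * d.D) ((2 * d.n + 1) * d.D) := by
  have hs : ∀ i : ℕ, ((i + 1 : ℕ) : ℤ) * d.D = i * d.D + d.D := fun i => by
    push_cast; ring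
  have := parity_comb p ((2 * d.n + 1) * d.D) (-1) (fun i => i * d.D) d.c
    (fun i => barTooth (i * d.D) (d.h i) d.W d.H)
    (fun i => sideTooth (d.c i) (d.x i) d.W d.H (if i < d.n then 0 else d.H)
      (if i < d.n then 0 else 1)) d.n (2 * d.n) (by simp [c])
  simp only [c_succ, hs] at this
  exact this

theorem parity_Q (p : ℝ × ℝ) :
    parity p (polyEdges d.Q) = ∑ j ∈ Finset.range (3 * d.m), d.upParity p j +
      ∑ j ∈ Finset.range d.m, d.rightParity p j +
      spineParity p 1 (d.a (3 * d.m)) (-((d.m + 1) * d.M)) :=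
  parity_comb p (-((d.m + 1) * d.M)) 1 d.a (fun j => -d.g j)
    (fun j => upTooth (d.a j) d.W d.L (if j < d.m then 0 else d.L))
    (fun j => rightTooth (d.g j) d.W d.L) (3 * d.m) d.m (by simp [g_m])

theorem bar_cover {p : ℝ × ℝ} {i : ℕ} (hi : i < d.n) (hp : d.barParity p i ≠ 0) :
    (i * d.D ≤ p.1 ∧ p.1 ≤ i * d.D + d.H ∧ -d.h i - d.W ≤ p.2 ∧ p.2 ≤ -d.h i) ∨
      (i * d.D ≤ p.1 ∧ p.1 ≤ i * d.D + 1 ∧ -d.h i ≤ p.2 ∧ p.2 ≤ -1) := by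
  have := barTooth_parity_cover (d.h_ge hi).1 d.W_pos (by have := d.D_pos; linarith) hp
  push_cast at this
  exact this

theorem side_cover {p : ℝ × ℝ} {i : ℕ} (hi : i < 2 * d.n) (hp : d.sideParity p i ≠ 0) :
    (d.x i ≤ p.1 - (if i < d.n then 0 else 1 : ℤ) * (p.2 - d.c i) ∧
        p.1 - (if i < d.n then 0 else 1 : ℤ) * (p.2 - d.c i) ≤ d.x i + d.W ∧
        d.c i ≤ p.2 ∧ p.2 ≤ d.c i + d.H) ∨
      (0 ≤ p.1 ∧ p.1 ≤ d.x i + d.W + 1 ∧ d.c i ≤ p.2 ∧ p.2 ≤ d.c i + 1) :=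
  sideTooth_parity_cover (d.x_ge hi) d.W_pos (by have := d.D_pos; linarith)
    (by split_ifs <;> simp) hp

theorem up_cover {p : ℝ × ℝ} {j : ℕ} (hp : d.upParity p j ≠ 0) :
    d.a j ≤ p.1 - (if j < d.m then 0 else 1 : ℤ) * (p.2 - 1) ∧
      p.1 - (if j < d.m then 0 else 1 : ℤ) * (p.2 - 1) ≤ d.a j + d.W ∧
      1 ≤ p.2 ∧ p.2 ≤ 1 + d.L :=
  upTooth_parity_cover d.W_pos (by have := d.D_pos; have := d.L_ge; linarith)
    (by split_ifs <;> simp) hp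

theorem right_cover {p : ℝ × ℝ} {j : ℕ} (hp : d.rightParity p j ≠ 0) :
    0 ≤ p.1 ∧ p.1 ≤ d.L ∧ -d.g j - d.W ≤ p.2 ∧ p.2 ≤ -d.g j :=
  rightTooth_parity_cover d.W_pos (by have := d.D_pos; have := d.L_ge; linarith) hp

theorem spineP_cover {p : ℝ × ℝ} (hp : spineParity p (-1) (d.n * d.D) ((2 * d.n + 1) * d.D) ≠ 0) :
    (-1 ≤ p.1 ∧ p.1 ≤ d.n * d.D ∧ -1 ≤ p.2 ∧ p.2 ≤ 1) ∨
      (-1 ≤ p.1 ∧ p.1 ≤ 0 ∧ -1 - (2 * d.n + 1) * d.D ≤ p.2 ∧ p.2 ≤ 1 + (2 * d.n + 1) * d.D) := by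
  have hD := d.D_pos
  have hT : 0 < (2 * (d.n : ℤ) + 1) * d.D := mul_pos (by positivity) (by linarith)
  have h := spineParity_cover (Or.inr ⟨rfl, hT⟩)
    (mul_pos (by exact_mod_cast d.n_pos) (by linarith)) hp
  rw [abs_of_pos (by exact_mod_cast hT)] at h
  push_cast at h
  exact h

theorem spineQ_cover {p : ℝ × ℝ} (hp : spineParity p 1 (d.a (3 * d.m)) (-((d.m + 1) * d.M)) ≠ 0) :
    (-1 ≤ p.1 ∧ p.1 ≤ d.a (3 * d.m) ∧ -1 ≤ p.2 ∧ p.2 ≤ 1) ∨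
      (-1 ≤ p.1 ∧ p.1 ≤ 0 ∧ -1 - (d.m + 1) * d.M ≤ p.2 ∧ p.2 ≤ 1 + (d.m + 1) * d.M) := by
  have hM := d.M_ge
  have hW := d.W_pos
  have hT : 0 < ((d.m : ℤ) + 1) * d.M := mul_pos (by positivity) (by linarith)
  have h := spineParity_cover (Or.inl ⟨rfl, neg_neg_of_pos hT⟩)
    (by have := d.a_ge (j := 3 * d.m) le_rfl; linarith) hp
  rw [abs_neg, abs_of_pos (by exact_mod_cast hT)] at h
  push_cast at h
  exact h

/-- All covers other than that of tooth `i` miss the point, so its parity is the contribution of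
this tooth alone. The three lemmas that follow have the same proof. -/
theorem mem_P_of_bar {p : ℝ × ℝ} {i : ℕ} (hi : i < d.n) (h1 : i * d.D < p.1)
    (h2 : p.1 < i * d.D + d.H) (h3 : -d.h i - d.W < p.2) (h4 : p.2 < -d.h i) :
    p ∈ polyRegion d.P := by
  have hD := d.D_pos.1
  have hHD := d.D_pos.2.2
  have hh : (2 : ℝ) ≤ d.h i := by exact_mod_cast (d.h_ge hi).1
  have hDR : (8 : ℝ) ≤ d.D := by exact_mod_cast hD
  have hHDR : (d.H : ℝ) < d.D := by exact_mod_cast hHD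
  have h0 : (0 : ℝ) ≤ i * d.D := by positivity
  apply mem_polyRegion_of_parity
  rw [parity_P, Finset.sum_eq_single_of_mem i (Finset.mem_range.2 hi) ?_,
    Finset.sum_eq_zero ?_, add_zero]
  · have hs : spineParity p (-1) (d.n * d.D) ((2 * d.n + 1) * d.D) = 0 := by
      by_contra hs
      rcases d.spineP_cover hs with h | h <;> linarith [h.1, h.2.1, h.2.2.1]
    rw [hs, add_zero]
    refine barTooth_parity_open (d.h_ge hi).1 ?_ ?_ ?_ ?_ <;> (push_cast; linarith)
  · intro k hk
    by_contra hs
    have hc : (d.D : ℝ) ≤ d.c k := by exact_mod_cast d.c_ge k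
    rcases d.side_cover (Finset.mem_range.1 hk) hs with h | h <;> linarith [h.2.2.1]
  · intro k hk hki
    by_contra hs
    have hk := Finset.mem_range.1 hk
    have hcov : k * d.D ≤ p.1 ∧ p.1 ≤ k * d.D + d.D := by
      rcases d.bar_cover hk hs with h | h <;> exact ⟨h.1, by linarith [h.2.1]⟩
    rcases lt_or_gt_of_ne hki with hlt | hlt
    · have h : ((k * d.D + d.D : ℤ) : ℝ) ≤ (i * d.D : ℤ) := by exact_mod_cast d.mul_D_gap hlt
      push_cast at h
      linarith [hcov.2]
    · have h : ((i * d.D + d.D : ℤ) : ℝ) ≤ (k * d.D : ℤ) := by exact_mod_cast d.mul_D_gap hlt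
      push_cast at h
      linarith [hcov.1]

theorem mem_P_of_side {p : ℝ × ℝ} {i : ℕ} (hi : i < 2 * d.n)
    (h1 : d.x i < p.1 - (if i < d.n then 0 else 1 : ℤ) * (p.2 - d.c i))
    (h2 : p.1 - (if i < d.n then 0 else 1 : ℤ) * (p.2 - d.c i) < d.x i + d.W)
    (h3 : d.c i < p.2) (h4 : p.2 < d.c i + d.H) : p ∈ polyRegion d.P := by
  have hD := d.D_pos.1
  have hHD := d.D_pos.2.2
  have hx : (2 : ℝ) ≤ d.x i := by exact_mod_cast d.x_ge hi
  have hDR : (8 : ℝ) ≤ d.D := by exact_mod_cast hD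
  have hHR : (4 : ℝ) ≤ d.H := by exact_mod_cast d.D_pos.2.1
  have hHDR : (d.H : ℝ) < d.D := by exact_mod_cast hHD
  have hc : (d.D : ℝ) ≤ d.c i := by exact_mod_cast d.c_ge i
  have hx1 : 2 < p.1 := by
    have hu : 0 ≤ (((if i < d.n then 0 else 1 : ℤ) : ℤ) : ℝ) * (p.2 - d.c i) :=
      mul_nonneg (by split_ifs <;> simp) (by linarith)
    linarith
  apply mem_polyRegion_of_parity
  rw [parity_P, Finset.sum_eq_zero ?_, Finset.sum_eq_single_of_mem i (Finset.mem_range.2 hi) ?_,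
    zero_add]
  · have hs : spineParity p (-1) (d.n * d.D) ((2 * d.n + 1) * d.D) = 0 := by
      by_contra hs
      rcases d.spineP_cover hs with h | h
      · linarith [h.2.2.2]
      · linarith [h.2.1]
    rw [hs, add_zero]
    exact sideTooth_parity_open (d.x_ge hi) (by split_ifs <;> simp) h1 h2 h3 h4
  · intro k hk hki
    by_contra hs
    have hk := Finset.mem_range.1 hk
    have hcov : d.c k ≤ p.2 ∧ p.2 ≤ d.c k + d.H := by
      rcases d.side_cover hk hs with h | h <;> exact ⟨h.2.2.1, by linarith [h.2.2.2]⟩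
    rcases lt_or_gt_of_ne hki with hlt | hlt
    · have h : ((d.c k + d.D : ℤ) : ℝ) ≤ d.c i := by exact_mod_cast d.c_gap hlt
      push_cast at h
      linarith [hcov.2]
    · have h : ((d.c i + d.D : ℤ) : ℝ) ≤ d.c k := by exact_mod_cast d.c_gap hlt
      push_cast at h
      linarith [hcov.1]
  · intro k hk
    by_contra hs
    have hk := Finset.mem_range.1 hk
    have hh : (2 : ℝ) ≤ d.h k := by exact_mod_cast (d.h_ge hk).1
    rcases d.bar_cover hk hs with h | h <;> linarith [h.2.2.2]

theorem mem_Q_of_up {p : ℝ × ℝ} {j : ℕ} (hj : j < 3 * d.m)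
    (h1 : d.a j < p.1 - (if j < d.m then 0 else 1 : ℤ) * (p.2 - 1))
    (h2 : p.1 - (if j < d.m then 0 else 1 : ℤ) * (p.2 - 1) < d.a j + d.W)
    (h3 : 1 < p.2) (h4 : p.2 < 1 + d.L) : p ∈ polyRegion d.Q := by
  have hW : (1 : ℝ) ≤ d.W := by exact_mod_cast d.W_pos
  have hM : 32 * (d.W : ℝ) ≤ d.M := by exact_mod_cast d.M_ge
  have ha : (d.M : ℝ) ≤ d.a j := by exact_mod_cast d.a_ge hj.le
  have hu : 0 ≤ (((if j < d.m then 0 else 1 : ℤ) : ℤ) : ℝ) * (p.2 - 1) :=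
    mul_nonneg (by split_ifs <;> simp) (by linarith)
  apply mem_polyRegion_of_parity
  rw [parity_Q, Finset.sum_eq_single_of_mem j (Finset.mem_range.2 hj) ?_, Finset.sum_eq_zero ?_,
    add_zero]
  · have hs : spineParity p 1 (d.a (3 * d.m)) (-((d.m + 1) * d.M)) = 0 := by
      by_contra hs
      rcases d.spineQ_cover hs with h | h
      · linarith [h.2.2.2]
      · linarith [h.2.1]
    rw [hs, add_zero]
    exact upTooth_parity_open (by split_ifs <;> simp) h1 h2 (by simpa using h3) h4
  · intro k hk
    by_contra hs
    have hg : (d.M : ℝ) ≤ d.g k := by exact_mod_cast d.g_ge (Finset.mem_range.1 hk).le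
    linarith [(d.right_cover hs).2.2.2]
  · intro k hk hkj
    by_contra hs
    have hk := Finset.mem_range.1 hk
    have hcov := d.up_cover hs
    rcases lt_or_gt_of_ne hkj with hlt | hlt
    · have h : ((d.a k + d.W : ℤ) : ℝ) < d.a j := by exact_mod_cast d.a_gap hlt hj.le
      push_cast at h
      -- The vertical teeth precede the diagonal ones, so the slant is monotone in the index, and
      -- the gap between the bases persists at every height.
      have hkj : (((if k < d.m then 0 else 1 : ℤ) : ℤ) : ℝ) * (p.2 - 1) ≤
          (((if j < d.m then 0 else 1 : ℤ) : ℤ) : ℝ) * (p.2 - 1) := by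
        refine mul_le_mul_of_nonneg_right (Int.cast_le.2 ?_) (by linarith)
        split_ifs <;> omega
      linarith [hcov.2.1]
    · have h : ((d.a j + d.W : ℤ) : ℝ) < d.a k := by exact_mod_cast d.a_gap hlt hk.le
      push_cast at h
      have hkj : (((if j < d.m then 0 else 1 : ℤ) : ℤ) : ℝ) * (p.2 - 1) ≤
          (((if k < d.m then 0 else 1 : ℤ) : ℤ) : ℝ) * (p.2 - 1) := by
        refine mul_le_mul_of_nonneg_right (Int.cast_le.2 ?_) (by linarith)
        split_ifs <;> omega
      linarith [hcov.1]

theorem mem_Q_of_right {p : ℝ × ℝ} {j : ℕ} (hj : j < d.m) (h1 : 0 < p.1) (h2 : p.1 < d.L)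
    (h3 : -d.g j - d.W < p.2) (h4 : p.2 < -d.g j) : p ∈ polyRegion d.Q := by
  have hW : (1 : ℝ) ≤ d.W := by exact_mod_cast d.W_pos
  have hM : 32 * (d.W : ℝ) ≤ d.M := by exact_mod_cast d.M_ge
  have hg : (d.M : ℝ) ≤ d.g j := by exact_mod_cast d.g_ge hj.le
  apply mem_polyRegion_of_parity
  rw [parity_Q, Finset.sum_eq_zero ?_, Finset.sum_eq_single_of_mem j (Finset.mem_range.2 hj) ?_,
    zero_add]
  · have hs : spineParity p 1 (d.a (3 * d.m)) (-((d.m + 1) * d.M)) = 0 := by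
      by_contra hs
      rcases d.spineQ_cover hs with h | h
      · linarith [h.2.2.1]
      · linarith [h.2.1]
    rw [hs, add_zero]
    exact rightTooth_parity_open h1 h2 h3 h4
  · intro k hk hkj
    by_contra hs
    have hk := Finset.mem_range.1 hk
    have hcov := d.right_cover hs
    rcases lt_or_gt_of_ne hkj with hlt | hlt
    · have h : ((d.g k + d.W : ℤ) : ℝ) < d.g j := by exact_mod_cast d.g_gap hlt hj.le
      push_cast at h
      linarith [hcov.2.2.1]
    · have h : ((d.g j + d.W : ℤ) : ℝ) < d.g k := by exact_mod_cast d.g_gap hlt hk.le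
      push_cast at h
      linarith [hcov.2.2.2]
  · intro k hk
    by_contra hs
    linarith [(d.up_cover hs).2.2.1]

end SumData

section Area

/-! ### Areas -/

/-- The three linear functionals that are constant along the edges. -/
def form (k : Fin 3) (p : ℝ × ℝ) : ℝ := ![p.1, p.2, p.1 - p.2] k

theorem form_add (k : Fin 3) (p q : ℝ × ℝ) : form k (p + q) = form k p + form k q := by
  fin_cases k <;> simp [form]
  ring

open MeasureTheory

theorem volume_fst_snd {s t : Set ℝ} :
    volume {p : ℝ × ℝ | p.1 ∈ s ∧ p.2 ∈ t} = volume s * volume t := by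
  rw [← Measure.prod_prod, ← Measure.volume_eq_prod]; rfl

/-- The shear (x, y) ↦ (x, y - x) preserves the area. -/
theorem volume_fst_sub {s t : Set ℝ} (hs : MeasurableSet s) (ht : MeasurableSet t) :
    volume {p : ℝ × ℝ | p.1 ∈ s ∧ p.2 - p.1 ∈ t} = volume s * volume t := by
  rw [← Measure.prod_prod]
  exact (measurePreserving_prod_sub (volume : Measure ℝ) (volume : Measure ℝ)).measure_preimage
    (hs.prod ht).nullMeasurableSet

theorem volume_snd_sub {s t : Set ℝ} (hs : MeasurableSet s) (ht : MeasurableSet t) :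
    volume {p : ℝ × ℝ | p.2 ∈ s ∧ p.1 - p.2 ∈ t} = volume s * volume t := by
  rw [← Measure.prod_prod]
  exact (measurePreserving_prod_sub_swap (volume : Measure ℝ) (volume : Measure ℝ)).measure_preimage
    (hs.prod ht).nullMeasurableSet

/-- Any two of the functionals x, y, x - y are the coordinates of a unimodular change of variables,
so two crossing strips of width `W` meet in a parallelogram of area `W²`, whatever their directions.
-/
theorem volume_form_form_le {k k' : Fin 3} (hk : k ≠ k') (a b W : ℝ) :
    volume {p : ℝ × ℝ | form k p ∈ Set.Icc a (a + W) ∧ form k' p ∈ Set.Icc b (b + W)} ≤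
      ENNReal.ofReal W * ENNReal.ofReal W := by
  have h1 : ∀ c : ℝ, volume (Set.Icc c (c + W)) = ENNReal.ofReal W := fun c => by
    rw [Real.volume_Icc, add_sub_cancel_left]
  have h2 : ∀ c : ℝ, volume (Set.Icc (-(c + W)) (-c)) = ENNReal.ofReal W := fun c => by
    rw [Real.volume_Icc]; congr 1; ring
  have key01 : ∀ a b : ℝ, volume {p : ℝ × ℝ | p.1 ∈ Set.Icc a (a + W) ∧ p.2 ∈ Set.Icc b (b + W)} ≤
      ENNReal.ofReal W * ENNReal.ofReal W := fun a b => by rw [volume_fst_snd, h1, h1]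
  have key12 : ∀ a b : ℝ, volume {p : ℝ × ℝ | p.2 ∈ Set.Icc a (a + W) ∧
      p.1 - p.2 ∈ Set.Icc b (b + W)} ≤ ENNReal.ofReal W * ENNReal.ofReal W := fun a b => by
    rw [volume_snd_sub measurableSet_Icc measurableSet_Icc, h1, h1]
  have key02 : ∀ a b : ℝ, volume {p : ℝ × ℝ | p.1 ∈ Set.Icc a (a + W) ∧
      p.1 - p.2 ∈ Set.Icc b (b + W)} ≤ ENNReal.ofReal W * ENNReal.ofReal W := fun a b => by
    have : {p : ℝ × ℝ | p.1 ∈ Set.Icc a (a + W) ∧ p.1 - p.2 ∈ Set.Icc b (b + W)} =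
        {p : ℝ × ℝ | p.1 ∈ Set.Icc a (a + W) ∧ p.2 - p.1 ∈ Set.Icc (-(b + W)) (-b)} := by
      ext p
      simp only [Set.mem_ofPred_eq, Set.mem_Icc]
      constructor <;> rintro ⟨h, h', h''⟩ <;> exact ⟨h, by linarith, by linarith⟩
    rw [this, volume_fst_sub measurableSet_Icc measurableSet_Icc, h1, h2]
  fin_cases k <;> fin_cases k' <;> try exact absurd rfl hk
  · exact key01 a b
  · exact key02 a b
  · refine le_of_eq_of_le (congrArg volume ?_) (key01 b a)
    ext p; exact and_comm
  · exact key12 a b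
  · refine le_of_eq_of_le (congrArg volume ?_) (key02 b a)
    ext p; exact and_comm
  · refine le_of_eq_of_le (congrArg volume ?_) (key12 b a)
    ext p; exact and_comm

theorem volume_setOf_box_le {s : Set (ℝ × ℝ)} {a b c e : ℝ}
    (h : ∀ p ∈ s, a ≤ p.1 ∧ p.1 ≤ b ∧ c ≤ p.2 ∧ p.2 ≤ e) (hab : a ≤ b) :
    volume s ≤ ENNReal.ofReal ((b - a) * (e - c)) := by
  rw [ENNReal.ofReal_mul (by linarith)]
  calc volume s ≤ volume {p : ℝ × ℝ | p.1 ∈ Set.Icc a b ∧ p.2 ∈ Set.Icc c e} :=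
        measure_mono fun p hp => by obtain ⟨h1, h2, h3, h4⟩ := h p hp; exact ⟨⟨h1, h2⟩, h3, h4⟩
    _ = _ := by rw [volume_fst_snd, Real.volume_Icc, Real.volume_Icc]

theorem volume_edgeSegment {e : (ℤ × ℤ) × (ℤ × ℤ)} (he : Admissible e) :
    volume (edgeSegment e) = 0 := by
  have hline : ∀ (k : Fin 3) (c : ℝ), volume {p : ℝ × ℝ | form k p = c} = 0 := by
    intro k c
    fin_cases k
    · have : {p : ℝ × ℝ | p.1 = c} = {p : ℝ × ℝ | p.1 ∈ ({c} : Set ℝ) ∧ p.2 ∈ Set.univ} := by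
        ext; simp
      change volume {p : ℝ × ℝ | p.1 = c} = 0
      rw [this, volume_fst_snd, Real.volume_singleton, zero_mul]
    · have : {p : ℝ × ℝ | p.2 = c} = {p : ℝ × ℝ | p.1 ∈ Set.univ ∧ p.2 ∈ ({c} : Set ℝ)} := by
        ext; simp
      change volume {p : ℝ × ℝ | p.2 = c} = 0
      rw [this, volume_fst_snd, Real.volume_singleton, mul_zero]
    · have : {p : ℝ × ℝ | p.1 - p.2 = c} =
          {p : ℝ × ℝ | p.2 ∈ Set.univ ∧ p.1 - p.2 ∈ ({c} : Set ℝ)} := by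
        ext; simp
      change volume {p : ℝ × ℝ | p.1 - p.2 = c} = 0
      rw [this, volume_snd_sub MeasurableSet.univ (measurableSet_singleton c),
        Real.volume_singleton, mul_zero]
  have key : ∀ k : Fin 3, form k (toPlane e.1) = form k (toPlane e.2) →
      volume (edgeSegment e) = 0 := by
    intro k hk
    refine measure_mono_null ?_ (hline k (form k (toPlane e.1)))
    rintro z ⟨a, b, -, -, hab, rfl⟩
    have hs : ∀ (c : ℝ) (q : ℝ × ℝ), form k (c • q) = c * form k q := by
      intro c q
      fin_cases k <;> simp [form]
      ring
    simp only [Set.mem_ofPred_eq]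
    rw [form_add, hs, hs, ← hk, ← add_mul, hab, one_mul]
  rcases he with h | h | h
  · exact key 1 (by simp [form, toPlane, h])
  · exact key 0 (by simp [form, toPlane, h])
  · refine key 2 ?_
    have : ((e.2.1 : ℝ) - e.1.1) = e.2.2 - e.1.2 := by exact_mod_cast h
    simp only [form, toPlane, Matrix.cons_val]
    linarith

theorem volume_edges {l : List (ℤ × ℤ)} (h : EdgesAdmissible l) :
    volume {p | ∃ e ∈ polyEdges l, p ∈ edgeSegment e} = 0 := by
  have : {p | ∃ e ∈ polyEdges l, p ∈ edgeSegment e} =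
      ⋃ e ∈ (polyEdges l).toFinset, edgeSegment e := by ext; simp
  rw [this]
  refine le_antisymm ((measure_biUnion_finset_le _ _).trans_eq (Finset.sum_eq_zero fun e he => ?_))
    zero_le
  exact volume_edgeSegment (h e (List.mem_toFinset.1 he))

/-- Apart from the thin parts, the intersection is covered by nine families, one for each pair of
directions. The six mixed ones consist of crossings of area at most `W²`. In a family with equal
directions, `huniq` leaves only one bar, of area at most `K`; and the family of the direction `k₀`
is empty, which leaves `2 * K`. -/
theorem volume_inter_le {S S' T T' : Set (ℝ × ℝ)} {A B : Fin 3 → ℕ → Set (ℝ × ℝ)} {n : ℕ}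
    {r : Fin 3 → ℕ} {p q : Fin 3 → ℕ → ℝ} {W : ℝ} {K : ENNReal} {R : ℕ} (hR : ∀ k, r k ≤ R)
    (hS : ∀ z ∈ S, z ∈ T ∨ ∃ k, ∃ i < n, z ∈ A k i)
    (hS' : ∀ z ∈ S', z ∈ T' ∨ ∃ k, ∃ j < r k, z ∈ B k j)
    (hA : ∀ k, ∀ i < n, ∀ z ∈ A k i, form k z ∈ Set.Icc (p k i) (p k i + W))
    (hB : ∀ k, ∀ j < r k, ∀ z ∈ B k j, form k z ∈ Set.Icc (q k j) (q k j + W))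
    (hAv : ∀ k, ∀ i < n, volume (A k i) ≤ K)
    (huniq : ∀ k, ∀ i < n, ∀ j < r k, ∀ i' < n, ∀ j' < r k, |p k i - q k j| ≤ W →
      |p k i' - q k j'| ≤ W → i = i')
    {k₀ : Fin 3} (hk₀ : ∀ i < n, ∀ j < r k₀, W < |p k₀ i - q k₀ j|) :
    volume (S ∩ S') ≤ volume T + volume T' +
      (2 * K + 6 * (n * (R * (ENNReal.ofReal W * ENNReal.ofReal W)))) := by
  set v : Fin 3 → Fin 3 → Set (ℝ × ℝ) := fun k k' =>
    ⋃ i ∈ Finset.range n, ⋃ j ∈ Finset.range (r k'), A k i ∩ B k' j with hv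
  have hclose : ∀ k i j z, i < n → j < r k → z ∈ A k i → z ∈ B k j → |p k i - q k j| ≤ W := by
    intro k i j z hi hj h1 h2
    obtain ⟨h3, h4⟩ := hA k i hi z h1
    obtain ⟨h5, h6⟩ := hB k j hj z h2
    rw [abs_le]; constructor <;> linarith
  have hdiag : ∀ k, volume (v k k) ≤ if k = k₀ then 0 else K := by
    intro k
    split_ifs with hk
    · subst hk
      suffices v k k = ∅ by rw [this, measure_empty]
      rw [Set.eq_empty_iff_forall_notMem]
      intro z hz
      simp only [hv, Set.mem_iUnion, Finset.mem_range] at hz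
      obtain ⟨i, hi, j, hj, hz1, hz2⟩ := hz
      exact (hk₀ i hi j hj).not_ge (hclose k i j z hi hj hz1 hz2)
    · rcases Set.eq_empty_or_nonempty (v k k) with h | ⟨z, hz⟩
      · rw [h, measure_empty]; exact zero_le
      · simp only [hv, Set.mem_iUnion, Finset.mem_range] at hz
        obtain ⟨i, hi, j, hj, hz1, hz2⟩ := hz
        refine le_trans (measure_mono ?_) (hAv k i hi)
        intro z' hz'
        simp only [hv, Set.mem_iUnion, Finset.mem_range] at hz'
        obtain ⟨i', hi', j', hj', hz1', hz2'⟩ := hz'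
        -- A single point `z` determines the bar; every other point of the family lies in the same
        -- one.
        rw [huniq k i hi j hj i' hi' j' hj' (hclose k i j z hi hj hz1 hz2)
          (hclose k i' j' z' hi' hj' hz1' hz2')]
        exact hz1'
  have hoff : ∀ k k', k ≠ k' → volume (v k k') ≤
      n * (R * (ENNReal.ofReal W * ENNReal.ofReal W)) := by
    intro k k' hk
    have hW : ∀ i ∈ Finset.range n, volume (⋃ j ∈ Finset.range (r k'), A k i ∩ B k' j) ≤
        R * (ENNReal.ofReal W * ENNReal.ofReal W) := by
      intro i hi
      refine (measure_biUnion_finset_le _ _).trans ?_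
      refine (Finset.sum_le_card_nsmul _ _ (ENNReal.ofReal W * ENNReal.ofReal W) ?_).trans ?_
      · intro j hj
        refine (measure_mono ?_).trans (volume_form_form_le hk (p k i) (q k' j) W)
        intro z hz
        exact ⟨hA k i (Finset.mem_range.1 hi) z hz.1, hB k' j (Finset.mem_range.1 hj) z hz.2⟩
      · rw [Finset.card_range, nsmul_eq_mul]
        gcongr
        exact hR k'
    refine (measure_biUnion_finset_le _ _).trans ?_
    refine (Finset.sum_le_card_nsmul _ _ _ hW).trans ?_
    rw [Finset.card_range, nsmul_eq_mul]
  have hsub : S ∩ S' ⊆ (T ∪ T') ∪ ⋃ k ∈ Finset.univ, ⋃ k' ∈ Finset.univ, v k k' := by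
    rintro z ⟨hz, hz'⟩
    rcases hS z hz with h | ⟨k, i, hi, h⟩
    · exact Or.inl (Or.inl h)
    · rcases hS' z hz' with h' | ⟨k', j, hj, h'⟩
      · exact Or.inl (Or.inr h')
      · right
        simp only [hv, Set.mem_iUnion, Finset.mem_range, Finset.mem_univ]
        exact ⟨k, trivial, k', trivial, i, hi, j, hj, h, h'⟩
  refine (measure_mono hsub).trans ((measure_union_le _ _).trans (add_le_add (measure_union_le _ _) ?_))
  refine (measure_biUnion_finset_le _ _).trans ((Finset.sum_le_sum fun k _ =>
    measure_biUnion_finset_le _ _).trans ?_)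
  generalize (n : ENNReal) * (R * (ENNReal.ofReal W * ENNReal.ofReal W)) = x at hoff ⊢
  simp only [Fin.sum_univ_three]
  calc _ ≤ ((if 0 = k₀ then 0 else K) + x + x) + (x + (if 1 = k₀ then 0 else K) + x) +
        (x + x + (if 2 = k₀ then 0 else K)) :=
        add_le_add (add_le_add
          (add_le_add (add_le_add (hdiag 0) (hoff 0 1 (by decide))) (hoff 0 2 (by decide)))
          (add_le_add (add_le_add (hoff 1 0 (by decide)) (hdiag 1)) (hoff 1 2 (by decide))))
          (add_le_add (add_le_add (hoff 2 0 (by decide)) (hoff 2 1 (by decide))) (hdiag 2))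
    _ = 2 * K + 6 * x := by
      obtain rfl | rfl | rfl := (by decide : ∀ k : Fin 3, k = 0 ∨ k = 1 ∨ k = 2) k₀
      · rw [if_pos rfl, if_neg (by decide), if_neg (by decide)]; ring
      · rw [if_pos rfl, if_neg (by decide), if_neg (by decide)]; ring
      · rw [if_pos rfl, if_neg (by decide), if_neg (by decide)]; ring

end Area

/-! ### Bars and teeth as strips; a large overlap yields a solution -/

section Rows

open MeasureTheory

/-- The coordinate along a bar. -/
def along (k : Fin 3) (p : ℝ × ℝ) : ℝ := ![p.2, p.1, p.2] k

theorem volume_form_along {k : Fin 3} {s t : Set ℝ} (hs : MeasurableSet s) (ht : MeasurableSet t) :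
    volume {p : ℝ × ℝ | form k p ∈ s ∧ along k p ∈ t} = volume s * volume t := by
  fin_cases k
  · exact volume_fst_snd
  · refine (congrArg volume ?_).trans ((volume_fst_snd (s := t) (t := s)).trans (mul_comm _ _))
    ext p; exact and_comm
  · refine (congrArg volume ?_).trans ((volume_snd_sub ht hs).trans (mul_comm _ _))
    ext p; exact and_comm

theorem measurableSet_form_along {k : Fin 3} {s t : Set ℝ} (hs : MeasurableSet s)
    (ht : MeasurableSet t) : MeasurableSet {p : ℝ × ℝ | form k p ∈ s ∧ along k p ∈ t} := by
  have h1 : Measurable (form k) := by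
    fin_cases k
    · exact measurable_fst
    · exact measurable_snd
    · exact measurable_fst.sub measurable_snd
  have h2 : Measurable (along k) := by
    fin_cases k
    · exact measurable_snd
    · exact measurable_fst
    · exact measurable_snd
  exact (h1 hs).inter (h2 ht)

namespace SumData

variable (d : SumData)

/-- The position of a bar of the first polygon. -/
def pOff (k : Fin 3) (i : ℕ) : ℤ := ![4 * d.W * d.X₁ i, -d.h i - d.W, d.z i] k

/-- The position of a long tooth of the second polygon. -/
def qOff (k : Fin 3) (j : ℕ) : ℤ := ![d.a j, -d.g j - d.W, d.a (d.m + j) - 1] k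

/-- The number of long teeth of the second polygon in one direction. -/
def teeth (k : Fin 3) : ℕ := ![d.m, d.m, 2 * d.m] k

/-- The end of a bar of the first polygon. -/
def lo (k : Fin 3) (i : ℕ) : ℤ := ![d.c i, i * d.D, d.c (d.n + i)] k

/-- A bar of the first polygon. -/
def bar (k : Fin 3) (i : ℕ) : Set (ℝ × ℝ) :=
  {p | form k p ∈ Set.Icc (d.pOff k i : ℝ) (d.pOff k i + d.W) ∧
    along k p ∈ Set.Icc (d.lo k i : ℝ) (d.lo k i + d.H)}

/-- The interior of a bar of the first polygon. -/
def openBar (k : Fin 3) (i : ℕ) : Set (ℝ × ℝ) :=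
  {p | form k p ∈ Set.Ioo (d.pOff k i : ℝ) (d.pOff k i + d.W) ∧
    along k p ∈ Set.Ioo (d.lo k i : ℝ) (d.lo k i + d.H)}

/-- What the first polygon consists of besides the bars. -/
def thinP : Set (ℝ × ℝ) :=
  {p | ∃ e ∈ polyEdges d.P, p ∈ edgeSegment e} ∪
    ({p | -1 ≤ p.1 ∧ p.1 ≤ d.n * d.D ∧ -1 ≤ p.2 ∧ p.2 ≤ 1} ∪
      {p | -1 ≤ p.1 ∧ p.1 ≤ 0 ∧ -1 - (2 * d.n + 1) * d.D ≤ p.2 ∧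
        p.2 ≤ 1 + (2 * d.n + 1) * d.D}) ∪
    ((⋃ i ∈ Finset.range d.n,
      {p | i * d.D ≤ p.1 ∧ p.1 ≤ i * d.D + 1 ∧ -d.h i ≤ p.2 ∧ p.2 ≤ -1}) ∪
    (⋃ i ∈ Finset.range (2 * d.n),
      {p | 0 ≤ p.1 ∧ p.1 ≤ d.x i + d.W + 1 ∧ d.c i ≤ p.2 ∧ p.2 ≤ d.c i + 1}))

/-- What the second polygon consists of besides the long teeth. -/
def thinQ : Set (ℝ × ℝ) :=
  {p | ∃ e ∈ polyEdges d.Q, p ∈ edgeSegment e} ∪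
    ({p | -1 ≤ p.1 ∧ p.1 ≤ d.a (3 * d.m) ∧ -1 ≤ p.2 ∧ p.2 ≤ 1} ∪
      {p | -1 ≤ p.1 ∧ p.1 ≤ 0 ∧ -1 - (d.m + 1) * d.M ≤ p.2 ∧ p.2 ≤ 1 + (d.m + 1) * d.M})

theorem P_subset {p : ℝ × ℝ} (hp : p ∈ polyRegion d.P) :
    p ∈ d.thinP ∨ ∃ k, ∃ i < d.n, p ∈ d.bar k i := by
  rcases edge_or_parity_of_mem_polyRegion hp with h | h
  · exact Or.inl (Or.inl (Or.inl h))
  rw [parity_P] at h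
  rcases exists_of_add_add_eq_one h with ⟨i, hi, h⟩ | ⟨i, hi, h⟩ | h
  · rcases d.bar_cover hi h with h | h
    · right
      refine ⟨1, i, hi, ⟨?_, ?_⟩, ?_, ?_⟩ <;> simp only [form, along, pOff, lo, Matrix.cons_val] <;>
        push_cast <;> linarith [h.1, h.2.1, h.2.2.1, h.2.2.2]
    · left; right; left
      simp only [Set.mem_iUnion, Finset.mem_range]
      exact ⟨i, hi, h⟩
  · rcases d.side_cover hi h with h | h
    · right
      by_cases hin : i < d.n
      · simp only [if_pos hin, x_of_lt d hin, Int.cast_zero, zero_mul, sub_zero] at h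
        refine ⟨0, i, hin, ⟨?_, ?_⟩, ?_, ?_⟩ <;>
          simp only [form, along, pOff, lo, Matrix.cons_val] <;>
          linarith [h.1, h.2.1, h.2.2.1, h.2.2.2]
      · obtain ⟨i, rfl⟩ := Nat.exists_eq_add_of_le (not_lt.1 hin)
        simp only [if_neg hin, x_add, Int.cast_one, one_mul, Int.cast_add] at h
        refine ⟨2, i, by omega, ⟨?_, ?_⟩, ?_, ?_⟩ <;>
          simp only [form, along, pOff, lo, Matrix.cons_val] <;>
          linarith [h.1, h.2.1, h.2.2.1, h.2.2.2]
    · left; right; right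
      simp only [Set.mem_iUnion, Finset.mem_range]
      exact ⟨i, hi, h⟩
  · exact Or.inl (Or.inl (Or.inr (d.spineP_cover h)))

theorem Q_subset {p : ℝ × ℝ} (hp : p ∈ polyRegion d.Q) :
    p ∈ d.thinQ ∨ ∃ k, ∃ j < d.teeth k,
      form k p ∈ Set.Icc (d.qOff k j : ℝ) (d.qOff k j + d.W) := by
  rcases edge_or_parity_of_mem_polyRegion hp with h | h
  · exact Or.inl (Or.inl h)
  rw [parity_Q] at h
  rcases exists_of_add_add_eq_one h with ⟨j, hj, h⟩ | ⟨j, hj, h⟩ | h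
  · right
    have h := d.up_cover h
    by_cases hjm : j < d.m
    · simp only [if_pos hjm, Int.cast_zero, zero_mul, sub_zero] at h
      exact ⟨0, j, hjm, h.1, h.2.1⟩
    · obtain ⟨j, rfl⟩ := Nat.exists_eq_add_of_le (not_lt.1 hjm)
      simp only [if_neg hjm, Int.cast_one, one_mul] at h
      refine ⟨2, j, by simp only [teeth, Matrix.cons_val]; omega, ?_, ?_⟩ <;>
        simp only [form, qOff, Matrix.cons_val] <;> push_cast <;> linarith [h.1, h.2.1]
  · right
    have h := d.right_cover h
    refine ⟨1, j, hj, ?_, ?_⟩ <;>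
      simp only [form, qOff, Matrix.cons_val] <;> push_cast <;> linarith [h.2.2.1, h.2.2.2]
  · exact Or.inl (Or.inr (d.spineQ_cover h))

theorem volume_bar (k : Fin 3) (i : ℕ) : volume (d.bar k i) = ENNReal.ofReal (d.W * d.H) := by
  have hW : (1 : ℝ) ≤ d.W := by exact_mod_cast d.W_pos
  rw [bar, volume_form_along measurableSet_Icc measurableSet_Icc, Real.volume_Icc, Real.volume_Icc,
    add_sub_cancel_left, add_sub_cancel_left, ENNReal.ofReal_mul (by linarith)]

theorem volume_openBar (k : Fin 3) (i : ℕ) :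
    volume (d.openBar k i) = ENNReal.ofReal (d.W * d.H) := by
  have hW : (1 : ℝ) ≤ d.W := by exact_mod_cast d.W_pos
  rw [openBar, volume_form_along measurableSet_Ioo measurableSet_Ioo, Real.volume_Ioo,
    Real.volume_Ioo, add_sub_cancel_left, add_sub_cancel_left, ENNReal.ofReal_mul (by linarith)]

theorem W_eq : d.W = 200 * (d.n * d.n) := rfl

theorem x_le {i : ℕ} (hi : i < 2 * d.n) : d.x i + d.W + 1 ≤ 4 * d.n * d.D := by
  have hW := d.W_pos
  have hM := d.M_ge
  have hM' := d.M_ge'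
  have hm := d.mM_nonneg
  have hH := d.H_ge_mM
  have hD : d.D = 2 * d.H := rfl
  have hn : (1 : ℤ) ≤ d.n := by exact_mod_cast d.n_pos
  have hnD : d.D ≤ d.n * d.D := le_mul_of_one_le_left (by linarith) hn
  by_cases hin : i < d.n
  · rw [x_of_lt d hin]
    have := d.scaled_le (d.X₁_le i hin)
    linarith
  · obtain ⟨i, rfl⟩ := Nat.exists_eq_add_of_le (not_lt.1 hin)
    rw [x_add, z, c]
    have := d.scaled_le (d.X₃_le i (by omega))
    have : ((d.n + i : ℕ) + 1 : ℤ) * d.D ≤ (2 * d.n) * d.D :=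
      mul_le_mul_of_nonneg_right (by push_cast; omega) (by linarith)
    linarith

/-- The main part is due to the 2n stems on the right, of width 1 and length at most 4nD. As D = 2H
and W = 200n², the total bound is 0.19 WH, well below the area of a bar. -/
theorem volume_thinP : volume d.thinP ≤ ENNReal.ofReal (19 * (d.n * d.n) * d.D) := by
  have hD : (8 : ℝ) ≤ d.D := by exact_mod_cast d.D_pos.1
  have hn : (1 : ℝ) ≤ d.n := by exact_mod_cast d.n_pos
  have hnD : (d.D : ℝ) ≤ d.n * d.D := le_mul_of_one_le_left (by linarith) hn
  have hnnD : d.n * (d.D : ℝ) ≤ d.n * (d.n * d.D) := mul_le_mul_of_nonneg_left hnD (by linarith)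
  have hMD : (d.M : ℝ) ≤ d.D := by
    have h1 := d.H_ge_mM
    have h2 := d.mM_nonneg
    have h3 := d.M_ge
    have h4 := d.W_pos
    have h5 : d.D = 2 * d.H := rfl
    exact_mod_cast (by linarith : d.M ≤ d.D)
  have hcast : ∀ k : ℕ, (k : ENNReal) = ENNReal.ofReal (k : ℝ) := fun k =>
    (ENNReal.ofReal_natCast k).symm
  have h1 : volume {p : ℝ × ℝ | -1 ≤ p.1 ∧ p.1 ≤ d.n * d.D ∧ -1 ≤ p.2 ∧ p.2 ≤ 1} ≤
      ENNReal.ofReal (3 * (d.n * d.D)) :=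
    (volume_setOf_box_le (fun p hp => hp) (by linarith)).trans
      (ENNReal.ofReal_le_ofReal (by linarith))
  have h2 : volume {p : ℝ × ℝ | -1 ≤ p.1 ∧ p.1 ≤ 0 ∧ -1 - (2 * d.n + 1) * d.D ≤ p.2 ∧
      p.2 ≤ 1 + (2 * d.n + 1) * d.D} ≤ ENNReal.ofReal (7 * (d.n * d.D)) :=
    (volume_setOf_box_le (fun p hp => hp) (by linarith)).trans
      (ENNReal.ofReal_le_ofReal (by linarith))
  have h3 : volume (⋃ i ∈ Finset.range d.n,
      {p : ℝ × ℝ | i * d.D ≤ p.1 ∧ p.1 ≤ i * d.D + 1 ∧ -d.h i ≤ p.2 ∧ p.2 ≤ -1}) ≤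
      ENNReal.ofReal (d.n * d.D) := by
    refine (measure_biUnion_finset_le _ _).trans ((Finset.sum_le_card_nsmul _ _
      (ENNReal.ofReal d.D) fun i hi => ?_).trans ?_)
    · have hh : (d.h i : ℝ) ≤ d.M := by exact_mod_cast (d.h_ge (Finset.mem_range.1 hi)).2
      exact (volume_setOf_box_le (fun p hp => hp) (by linarith)).trans
        (ENNReal.ofReal_le_ofReal (by linarith))
    · rw [Finset.card_range, nsmul_eq_mul, hcast, ← ENNReal.ofReal_mul (by linarith)]
  have h4 : volume (⋃ i ∈ Finset.range (2 * d.n),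
      {p : ℝ × ℝ | 0 ≤ p.1 ∧ p.1 ≤ d.x i + d.W + 1 ∧ d.c i ≤ p.2 ∧ p.2 ≤ d.c i + 1}) ≤
      ENNReal.ofReal (8 * (d.n * (d.n * d.D))) := by
    refine (measure_biUnion_finset_le _ _).trans ((Finset.sum_le_card_nsmul _ _
      (ENNReal.ofReal (4 * d.n * d.D)) fun i hi => ?_).trans ?_)
    · have hi := Finset.mem_range.1 hi
      have hx : (d.x i + d.W + 1 : ℝ) ≤ 4 * d.n * d.D := by exact_mod_cast d.x_le hi
      have hx' : (2 : ℝ) ≤ d.x i := by exact_mod_cast d.x_ge hi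
      have hW : (1 : ℝ) ≤ d.W := by exact_mod_cast d.W_pos
      exact (volume_setOf_box_le (fun p hp => hp) (by linarith)).trans
        (ENNReal.ofReal_le_ofReal (by linarith))
    · rw [Finset.card_range, nsmul_eq_mul, hcast, ← ENNReal.ofReal_mul (by positivity)]
      refine ENNReal.ofReal_le_ofReal ?_
      push_cast; linarith
  calc volume d.thinP ≤ 0 + (ENNReal.ofReal (3 * (d.n * d.D)) + ENNReal.ofReal (7 * (d.n * d.D))) +
        (ENNReal.ofReal (d.n * d.D) + ENNReal.ofReal (8 * (d.n * (d.n * d.D)))) := by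
        refine (measure_union_le _ _).trans (add_le_add ((measure_union_le _ _).trans (add_le_add ?_
          ((measure_union_le _ _).trans (add_le_add h1 h2))))
          ((measure_union_le _ _).trans (add_le_add h3 h4)))
        exact (volume_edges d.P_edgesAdmissible).le
    _ = ENNReal.ofReal (3 * (d.n * d.D) + 7 * (d.n * d.D) +
        (d.n * d.D + 8 * (d.n * (d.n * d.D)))) := by
        rw [zero_add, ENNReal.ofReal_add (by positivity) (by positivity),
          ENNReal.ofReal_add (by positivity) (by positivity),
          ENNReal.ofReal_add (by positivity) (by positivity)]
    _ ≤ _ := ENNReal.ofReal_le_ofReal (by linarith)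

theorem a_last : d.a (3 * d.m) = (3 * d.m + 2) * d.M := by
  rw [a, if_neg (by omega)]; push_cast; ring

theorem volume_thinQ : volume d.thinQ ≤ ENNReal.ofReal (3 * d.H) := by
  have hm : 0 ≤ (d.m : ℝ) * d.M := by exact_mod_cast d.mM_nonneg
  have hM : 32 * (d.W : ℝ) ≤ d.M := by exact_mod_cast d.M_ge
  have hW : (1 : ℝ) ≤ d.W := by exact_mod_cast d.W_pos
  have hH : 4 * ((d.m : ℝ) * d.M) + 4 * d.M ≤ d.H := by exact_mod_cast d.H_ge_mM
  have ha : (d.a (3 * d.m) : ℝ) = 3 * (d.m * d.M) + 2 * d.M := by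
    rw [a_last]; push_cast; ring
  have h1 : volume {p : ℝ × ℝ | -1 ≤ p.1 ∧ p.1 ≤ d.a (3 * d.m) ∧ -1 ≤ p.2 ∧ p.2 ≤ 1} ≤
      ENNReal.ofReal (2 * d.H) :=
    (volume_setOf_box_le (fun p hp => hp) (by linarith)).trans
      (ENNReal.ofReal_le_ofReal (by linarith))
  have h2 : volume {p : ℝ × ℝ | -1 ≤ p.1 ∧ p.1 ≤ 0 ∧ -1 - (d.m + 1) * d.M ≤ p.2 ∧
      p.2 ≤ 1 + (d.m + 1) * d.M} ≤ ENNReal.ofReal d.H :=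
    (volume_setOf_box_le (fun p hp => hp) (by linarith)).trans
      (ENNReal.ofReal_le_ofReal (by linarith))
  calc volume d.thinQ ≤ 0 + (ENNReal.ofReal (2 * d.H) + ENNReal.ofReal d.H) := by
        refine (measure_union_le _ _).trans (add_le_add ?_
          ((measure_union_le _ _).trans (add_le_add h1 h2)))
        exact (volume_edges d.Q_edgesAdmissible).le
    _ = ENNReal.ofReal (2 * d.H + d.H) := by
        rw [zero_add, ENNReal.ofReal_add (by linarith) (by linarith)]
    _ ≤ _ := ENNReal.ofReal_le_ofReal (by linarith)

/-- The area threshold. -/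
def threshold : ℕ := (3 * d.W * d.H - 1).toNat

theorem threshold_eq : (d.threshold : ℤ) = 3 * d.W * d.H - 1 := by
  have hW := d.W_pos
  have hH := d.D_pos.2.1
  exact Int.toNat_of_nonneg (by nlinarith)

/-- The position of a bar relative to a long tooth, in units of `4 * W` and up to a constant. -/
def rel (k : Fin 3) (i j : ℕ) : ℤ :=
  (![(d.X₁ i : ℤ) - d.Y₁ j - (j + 1) * (8 * (d.V + 1)),
    (d.X₂ i : ℤ) + d.Y₂ j + (j + 1) * (8 * (d.V + 1)),
    (d.X₃ i : ℤ) - (j + 2) * (8 * (d.V + 1))] : Fin 3 → ℤ) k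

/-- The constant part of the position of a bar relative to a long tooth. -/
def base (k : Fin 3) : ℤ := ![0, -(4 * d.W * d.V + 2), 4 * d.W * d.V + 2] k

/-- Up to a constant that depends on the direction only, all relative positions lie on a lattice of
mesh `4 * W`. Errors of a few `W` can therefore be rounded away. -/
theorem pOff_sub_qOff {k : Fin 3} {i j : ℕ} (hj : j < d.teeth k) :
    d.pOff k i - d.qOff k j = 4 * d.W * d.rel k i j + d.base k := by
  fin_cases k
  · have hj : j < d.m := hj
    simp only [pOff, qOff, rel, base, Fin.zero_eta, Matrix.cons_val, a, if_pos hj, M]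
    ring
  · have hj : j < d.m := hj
    simp only [pOff, qOff, rel, base, Fin.mk_one, Matrix.cons_val, g, if_pos hj, h, M]
    ring
  · simp only [pOff, qOff, rel, base, Fin.reduceFinMk, Matrix.cons_val, a,
      if_neg (show ¬ d.m + j < d.m by omega), z, M]
    push_cast
    ring

/-- The coarse spacing 8(V + 1) exceeds every difference of fine parts, so first the teeth agree;
then the entries of X agree, and these are distinct. The entries of Y may repeat, which the padding
of short pieces requires. -/
theorem rel_inj {k : Fin 3} {i i' j j' : ℕ} (hi : i < d.n) (hj : j < d.teeth k) (hi' : i' < d.n)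
    (hj' : j' < d.teeth k) (h : d.rel k i j = d.rel k i' j') : i = i' := by
  have coarse : ∀ u u' : ℤ, -(4 * d.V) ≤ u - u' → u - u' ≤ 4 * d.V →
      u + (j : ℤ) * (8 * (d.V + 1)) = u' + j' * (8 * (d.V + 1)) → j = j' := by
    intro u u' h1 h2 h3
    by_contra hne
    rcases lt_or_gt_of_ne hne with hlt | hlt
    · have : ((j : ℤ) + 1) * (8 * (d.V + 1)) ≤ j' * (8 * (d.V + 1)) :=
        mul_le_mul_of_nonneg_right (by exact_mod_cast hlt) (by positivity)
      linarith
    · have : ((j' : ℤ) + 1) * (8 * (d.V + 1)) ≤ j * (8 * (d.V + 1)) :=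
        mul_le_mul_of_nonneg_right (by exact_mod_cast hlt) (by positivity)
      linarith
  fin_cases k
  · have hx := d.X₁_le i hi
    have hx' := d.X₁_le i' hi'
    have hy := d.Y₁_le j hj
    have hy' := d.Y₁_le j' hj'
    simp only [rel, Fin.zero_eta, Matrix.cons_val] at h
    obtain rfl := coarse (d.X₁ i' - d.Y₁ j') (d.X₁ i - d.Y₁ j) (by omega) (by omega) (by linarith)
    exact d.X₁_inj hi hi' (by omega)
  · have hx := d.X₂_le i hi
    have hx' := d.X₂_le i' hi'
    have hy := d.Y₂_le j hj
    have hy' := d.Y₂_le j' hj'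
    simp only [rel, Fin.mk_one, Matrix.cons_val] at h
    obtain rfl := coarse (d.X₂ i + d.Y₂ j) (d.X₂ i' + d.Y₂ j') (by omega) (by omega) (by linarith)
    exact d.X₂_inj hi hi' (by omega)
  · have hx := d.X₃_le i hi
    have hx' := d.X₃_le i' hi'
    simp only [rel, Fin.reduceFinMk, Matrix.cons_val] at h
    obtain rfl := coarse (d.X₃ i') (d.X₃ i) (by omega) (by omega) (by linarith)
    exact d.X₃_inj hi hi' (by omega)

/-- The fine part of the equation has absolute value at most 4V and equals a multiple of 8(V + 1);
so both parts vanish. -/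
theorem solution_of_rel {i₁ i₂ i₃ j₁ j₂ j : ℕ} (h₁ : i₁ < d.n) (h₂ : i₂ < d.n) (h₃ : i₃ < d.n)
    (hj₁ : j₁ < d.m) (hj₂ : j₂ < d.m) (h : d.rel 0 i₁ j₁ = d.rel 1 i₂ j₂ + d.rel 2 i₃ j) :
    d.X₁ i₁ = d.X₂ i₂ + d.X₃ i₃ + d.Y₁ j₁ + d.Y₂ j₂ := by
  simp only [rel, Matrix.cons_val] at h
  have a1 := d.X₁_le i₁ h₁
  have a2 := d.X₂_le i₂ h₂
  have a3 := d.X₃_le i₃ h₃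
  have a4 := d.Y₁_le j₁ hj₁
  have a5 := d.Y₂_le j₂ hj₂
  have key : (d.X₁ i₁ : ℤ) - d.X₂ i₂ - d.X₃ i₃ - d.Y₁ j₁ - d.Y₂ j₂ =
      ((j₁ : ℤ) + j₂ - j) * (8 * (d.V + 1)) := by linarith
  have hzero : (j₁ : ℤ) + j₂ - j = 0 := by
    by_contra hne
    rcases lt_or_gt_of_ne hne with hlt | hlt
    · have : ((j₁ : ℤ) + j₂ - j) * (8 * (d.V + 1)) ≤ (-1) * (8 * (d.V + 1)) :=
        mul_le_mul_of_nonneg_right (by omega) (by positivity)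
      omega
    · have : 1 * (8 * (d.V + 1)) ≤ ((j₁ : ℤ) + j₂ - j) * (8 * (d.V + 1)) :=
        mul_le_mul_of_nonneg_right (by omega) (by positivity)
      omega
  rw [hzero, zero_mul] at key
  omega

theorem small_multiple {W : ℝ} (hW : 0 < W) {e : ℤ} (h : |4 * W * e| ≤ 3 * W) : e = 0 := by
  by_contra hne
  have h1 : (1 : ℝ) ≤ |(e : ℝ)| := by
    rw [← Int.cast_abs]; exact_mod_cast Int.one_le_abs hne
  rw [abs_mul, abs_of_pos (by linarith : 0 < 4 * W)] at h
  nlinarith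

/-- A direction without a contact would limit the overlap to two bars and an error, which is below
the threshold. So there are three approximate matches, and rounding to the lattice of mesh `4 * W`
turns them into an exact equation. -/
theorem exists_solution_of_overlap {τ : ℝ × ℝ}
    (h : (d.threshold : ENNReal) < volume (polyRegion d.P ∩ (fun q => q + τ) '' polyRegion d.Q)) :
    ∃ i₁ < d.n, ∃ i₂ < d.n, ∃ i₃ < d.n, ∃ j₁ < d.m, ∃ j₂ < d.m,
      d.X₁ i₁ = d.X₂ i₂ + d.X₃ i₃ + d.Y₁ j₁ + d.Y₂ j₂ := by
  have hW : (1 : ℝ) ≤ d.W := by exact_mod_cast d.W_pos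
  have hH : (4 : ℝ) ≤ d.H := by exact_mod_cast d.D_pos.2.1
  have hW0 : (0 : ℝ) ≤ d.W := by linarith
  have hH0 : (0 : ℝ) ≤ d.H := by linarith
  have hD0 : (0 : ℝ) ≤ d.D := by exact_mod_cast (by linarith [d.D_pos.1] : 0 ≤ d.D)
  have hmatch : ∀ k, ∃ i < d.n, ∃ j < d.teeth k,
      |(d.pOff k i : ℝ) - (d.qOff k j + form k τ)| ≤ d.W := by
    intro k₀
    by_contra! hk₀
    refine h.not_ge ?_
    have hT : volume ((fun q => q + τ) '' d.thinQ) ≤ ENNReal.ofReal (3 * d.H) := by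
      rw [Set.image_add_right, measure_preimage_add_right]
      exact d.volume_thinQ
    have hle := volume_inter_le (S := polyRegion d.P) (S' := (fun q => q + τ) '' polyRegion d.Q)
      (T := d.thinP) (T' := (fun q => q + τ) '' d.thinQ) (A := d.bar)
      (B := fun k j => {p | form k p ∈ Set.Icc ((d.qOff k j : ℝ) + form k τ)
        (d.qOff k j + form k τ + d.W)}) (n := d.n) (r := d.teeth)
      (p := fun k i => d.pOff k i) (q := fun k j => d.qOff k j + form k τ) (W := d.W)
      (K := ENNReal.ofReal (d.W * d.H)) (R := 2 * d.m)
      (by intro k; fin_cases k <;> simp [teeth] <;> omega)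
      (fun z hz => d.P_subset hz) ?_ (fun k i _ z hz => hz.1) (fun k j _ z hz => hz)
      (fun k i _ => (d.volume_bar k i).le) ?_ hk₀
    · refine hle.trans ((add_le_add (add_le_add d.volume_thinP hT) le_rfl).trans ?_)
      have hn : (1 : ℝ) ≤ d.n := by exact_mod_cast d.n_pos
      have hD : (d.D : ℝ) = 2 * d.H := by exact_mod_cast (rfl : d.D = 2 * d.H)
      have hWn : (d.W : ℝ) = 200 * (d.n * d.n) := by exact_mod_cast d.W_eq
      have e1 : (2 : ENNReal) = ENNReal.ofReal 2 := by simp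
      have e2 : (6 : ENNReal) = ENNReal.ofReal 6 := by simp
      have e3 : (d.n : ENNReal) = ENNReal.ofReal d.n := (ENNReal.ofReal_natCast _).symm
      have e4 : ((2 * d.m : ℕ) : ENNReal) = ENNReal.ofReal (2 * d.m : ℕ) :=
        (ENNReal.ofReal_natCast _).symm
      have e5 : (d.threshold : ENNReal) = ENNReal.ofReal (3 * d.W * d.H - 1) := by
        rw [← ENNReal.ofReal_natCast]
        congr 1
        exact_mod_cast d.threshold_eq
      rw [e1, e2, e3, e4, e5, ← ENNReal.ofReal_mul (by linarith), ← ENNReal.ofReal_mul (by positivity),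
        ← ENNReal.ofReal_mul (by positivity), ← ENNReal.ofReal_mul (by positivity),
        ← ENNReal.ofReal_mul (by positivity), ← ENNReal.ofReal_add (by positivity) (by positivity),
        ← ENNReal.ofReal_add (by positivity) (by positivity),
        ← ENNReal.ofReal_add (by positivity) (by positivity)]
      refine ENNReal.ofReal_le_ofReal ?_
      -- The error budget in units of WH: the thin part of P costs 38/200, that of Q at most 3/200,
      -- and the crossings, of total area 12nmW², at most 12/128. The sum is less than 0.3, while WH
      -- - 1 is available.
      have hHge : 128 * ((d.n : ℝ) * d.m * d.W) ≤ d.H := by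
        have h1 : 32 * (d.W : ℝ) ≤ d.M := by exact_mod_cast d.M_ge
        have h2 : (d.H : ℝ) = 4 * d.n * (d.m + 1) * d.M := by
          exact_mod_cast (rfl : d.H = 4 * d.n * (d.m + 1) * d.M)
        rw [h2]
        have h3 : 4 * (d.n : ℝ) * (d.m + 1) * (32 * d.W) ≤ 4 * d.n * (d.m + 1) * d.M :=
          mul_le_mul_of_nonneg_left h1 (by positivity)
        have h4 : 0 ≤ (d.n : ℝ) * d.W := by positivity
        linarith
      have h1 : (d.W : ℝ) * (128 * ((d.n : ℝ) * d.m * d.W)) ≤ d.W * d.H :=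
        mul_le_mul_of_nonneg_left hHge (by linarith)
      have h2 : 19 * ((d.n : ℝ) * d.n) * d.D = 38 / 200 * (d.W * d.H) := by
        rw [hD, hWn]; ring
      have h3 : 200 * (d.H : ℝ) ≤ d.W * d.H := by
        refine mul_le_mul_of_nonneg_right ?_ (by linarith)
        rw [hWn]; nlinarith
      push_cast
      rw [h2]
      nlinarith
    · rintro z ⟨q, hq, rfl⟩
      rcases d.Q_subset hq with h | ⟨k, j, hj, h1, h2⟩
      · exact Or.inl ⟨q, h, rfl⟩
      · refine Or.inr ⟨k, j, hj, ?_, ?_⟩ <;> simp only [form_add] <;> linarith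
    -- Two contacts under the same translation have relative positions that differ by at most `2 *
    -- W`, less than the mesh `4 * W`.
    · intro k i hi j hj i' hi' j' hj' h1 h2
      refine d.rel_inj hi hj hi' hj' (sub_eq_zero.1 (small_multiple (by linarith : (0 : ℝ) < d.W) ?_))
      have e1 : (d.pOff k i : ℝ) - d.qOff k j = 4 * d.W * d.rel k i j + d.base k := by
        exact_mod_cast d.pOff_sub_qOff hj
      have e2 : (d.pOff k i' : ℝ) - d.qOff k j' = 4 * d.W * d.rel k i' j' + d.base k := by
        exact_mod_cast d.pOff_sub_qOff hj'
      push_cast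
      rw [abs_le] at h1 h2 ⊢
      constructor <;> linarith
  obtain ⟨i₁, h₁, j₁, hj₁, m₁⟩ := hmatch 0
  obtain ⟨i₂, h₂, j₂, hj₂, m₂⟩ := hmatch 1
  obtain ⟨i₃, h₃, j₃, hj₃, m₃⟩ := hmatch 2
  refine ⟨i₁, h₁, i₂, h₂, i₃, h₃, j₁, hj₁, j₂, hj₂, d.solution_of_rel (j := j₃) h₁ h₂ h₃ hj₁ hj₂ ?_⟩
  refine sub_eq_zero.1 (small_multiple (by linarith : (0 : ℝ) < d.W) ?_)
  have e1 : (d.pOff 0 i₁ : ℝ) - d.qOff 0 j₁ = 4 * d.W * d.rel 0 i₁ j₁ + d.base 0 := by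
    exact_mod_cast d.pOff_sub_qOff hj₁
  have e2 : (d.pOff 1 i₂ : ℝ) - d.qOff 1 j₂ = 4 * d.W * d.rel 1 i₂ j₂ + d.base 1 := by
    exact_mod_cast d.pOff_sub_qOff hj₂
  have e3 : (d.pOff 2 i₃ : ℝ) - d.qOff 2 j₃ = 4 * d.W * d.rel 2 i₃ j₃ + d.base 2 := by
    exact_mod_cast d.pOff_sub_qOff hj₃
  have eb : (d.base 0 : ℝ) = d.base 1 + d.base 2 := by
    exact_mod_cast (by simp [base] : d.base 0 = d.base 1 + d.base 2)
  -- This relation is the only link between the three matches. The constants in `base` are chosen to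
  -- satisfy it too, so they drop out.
  have ef : form 0 τ - form 1 τ = form 2 τ := rfl
  push_cast
  rw [abs_le] at m₁ m₂ m₃ ⊢
  constructor <;> linarith

end SumData

end Rows

/-! ### A solution yields a translation with large overlap -/

section Overlap

open MeasureTheory

namespace SumData

variable (d : SumData)

theorem openBar_subset_P {k : Fin 3} {i : ℕ} (hi : i < d.n) :
    d.openBar k i ⊆ polyRegion d.P := by
  rintro p ⟨⟨h1, h2⟩, h3, h4⟩
  fin_cases k <;> simp only [form, along, pOff, lo, Matrix.cons_val, Fin.zero_eta, Fin.mk_one,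
    Fin.reduceFinMk] at h1 h2 h3 h4
  · refine d.mem_P_of_side (i := i) (by omega) ?_ ?_ h3 h4 <;>
      rw [if_pos hi, x_of_lt d hi, Int.cast_zero, zero_mul, sub_zero] <;> assumption
  · push_cast at h1 h2 h3 h4
    exact d.mem_P_of_bar hi h3 h4 (by linarith) (by linarith)
  · refine d.mem_P_of_side (i := d.n + i) (by omega) ?_ ?_ h3 h4 <;>
      rw [if_neg (by omega), x_add] <;> push_cast <;> linarith

/-- Across the bar the offsets agree by `hτ`. Along the bar there is room: the translation moves it
by at most `H` in each coordinate, the upright bars start at height at least D = 2H, and the teeth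
have length (2n + 4)D. -/
theorem mem_Q_of_openBar {k : Fin 3} {i j : ℕ} (hi : i < d.n) (hj : j < d.teeth k) {τ : ℝ × ℝ}
    (hτ : form k τ = d.pOff k i - d.qOff k j) (h1 : -d.H ≤ τ.1) (h2 : τ.1 ≤ 0) (h3 : 0 ≤ τ.2)
    (h4 : τ.2 ≤ d.H) {p : ℝ × ℝ} (hp : p ∈ d.openBar k i) : p - τ ∈ polyRegion d.Q := by
  obtain ⟨⟨p1, p2⟩, p3, p4⟩ := hp
  have hf : form k (p - τ) = form k p - form k τ := by
    rw [eq_sub_iff_add_eq, ← form_add, sub_add_cancel]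
  have f1 : (d.qOff k j : ℝ) < form k (p - τ) := by linarith
  have f2 : form k (p - τ) < (d.qOff k j : ℝ) + d.W := by linarith
  have hD : (8 : ℝ) ≤ d.D := by exact_mod_cast d.D_pos.1
  have hH : (4 : ℝ) ≤ d.H := by exact_mod_cast d.D_pos.2.1
  have hDH : (d.D : ℝ) = 2 * d.H := by exact_mod_cast (rfl : d.D = 2 * d.H)
  have hL : (d.L : ℝ) = (2 * d.n + 4) * d.D := by
    exact_mod_cast (rfl : d.L = (2 * d.n + 4) * d.D)
  have hc : ∀ l : ℕ, (d.D : ℝ) ≤ d.c l := fun l => by exact_mod_cast d.c_ge l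
  have hcl : ∀ l : ℕ, l < 2 * d.n → (d.c l : ℝ) ≤ 2 * d.n * d.D := fun l hl => by
    rw [c]; push_cast
    exact mul_le_mul_of_nonneg_right (by exact_mod_cast hl) (by linarith)
  have hiD : (i : ℝ) * d.D ≤ d.n * d.D :=
    mul_le_mul_of_nonneg_right (by exact_mod_cast hi.le) (by linarith)
  have hiD0 : 0 ≤ (i : ℝ) * d.D := by positivity
  fin_cases k <;> simp only [form, along, qOff, lo, teeth, Matrix.cons_val, Fin.zero_eta,
    Fin.mk_one, Fin.reduceFinMk] at p3 p4 f1 f2 hj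
  · have := hc i
    have := hcl i (by omega)
    refine d.mem_Q_of_up (j := j) (by omega) ?_ ?_ ?_ ?_
    · rw [if_pos hj, Int.cast_zero, zero_mul, sub_zero]; exact f1
    · rw [if_pos hj, Int.cast_zero, zero_mul, sub_zero]; exact f2
    · simp only [Prod.snd_sub]; linarith
    · simp only [Prod.snd_sub]; linarith
  · push_cast at p3 p4 f1 f2
    refine d.mem_Q_of_right hj ?_ ?_ ?_ ?_
    · simp only [Prod.fst_sub]; linarith
    · simp only [Prod.fst_sub]; linarith
    · exact f1
    · linarith
  · have := hc (d.n + i)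
    have := hcl (d.n + i) (by omega)
    push_cast at f1 f2
    refine d.mem_Q_of_up (j := d.m + j) (by omega) ?_ ?_ ?_ ?_
    · rw [if_neg (by omega)]; push_cast; linarith
    · rw [if_neg (by omega)]; push_cast; linarith
    · simp only [Prod.snd_sub]; linarith
    · simp only [Prod.snd_sub]; linarith

theorem disjoint_openBar {i₁ i₂ i₃ : ℕ} (h₁ : i₁ < d.n) (h₂ : i₂ < d.n) :
    Disjoint (d.openBar 0 i₁) (d.openBar 1 i₂) ∧
      Disjoint (d.openBar 0 i₁ ∪ d.openBar 1 i₂) (d.openBar 2 i₃) := by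
  have hc : ∀ l : ℕ, (d.D : ℝ) ≤ d.c l := fun l => by exact_mod_cast d.c_ge l
  have hD : (8 : ℝ) ≤ d.D := by exact_mod_cast d.D_pos.1
  have hHD : (d.H : ℝ) < d.D := by exact_mod_cast d.D_pos.2.2
  have hh : (2 : ℝ) ≤ d.h i₂ := by exact_mod_cast (d.h_ge h₂).1
  have hgap : (d.c i₁ : ℝ) + d.D ≤ d.c (d.n + i₃) := by
    exact_mod_cast d.c_gap (i := i₁) (j := d.n + i₃) (by omega)
  have neg : ∀ p ∈ d.openBar 1 i₂, p.2 < 0 := by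
    rintro p ⟨⟨-, p2⟩, -⟩
    simp only [form, pOff, Matrix.cons_val] at p2
    push_cast at p2
    linarith
  simp only [Set.disjoint_left]
  refine ⟨fun p h0 h1 => ?_, fun p h01 h2 => ?_⟩
  · have h0 := h0.2.1
    simp only [along, lo, Matrix.cons_val] at h0
    linarith [neg p h1, hc i₁]
  · have h2 := h2.2.1
    simp only [along, lo, Matrix.cons_val] at h2
    rcases h01 with h0 | h1
    · have h0 := h0.2.2
      simp only [along, lo, Matrix.cons_val] at h0
      linarith
    · linarith [neg p h1, hc (d.n + i₃)]

theorem exists_overlap_of_solution {i₁ i₂ i₃ j₁ j₂ : ℕ} (h₁ : i₁ < d.n) (h₂ : i₂ < d.n)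
    (h₃ : i₃ < d.n) (hj₁ : j₁ < d.m) (hj₂ : j₂ < d.m)
    (h : d.X₁ i₁ = d.X₂ i₂ + d.X₃ i₃ + d.Y₁ j₁ + d.Y₂ j₂) :
    ∃ τ : ℝ × ℝ,
      (d.threshold : ENNReal) < volume (polyRegion d.P ∩ (fun q => q + τ) '' polyRegion d.Q) := by
  have hWi := d.W_pos
  have hMi := d.M_ge
  have hM'i := d.M_ge'
  have hHi := d.H_ge_mM
  have hmi := d.mM_nonneg
  have hx := d.scaled_le (d.X₁_le i₁ h₁)
  have hh := d.h_ge h₂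
  have ha0 := d.a_ge (j := j₁) (by omega)
  have ha1 := d.a_lt (i := j₁) (j := 3 * d.m) (by omega) le_rfl
  have ha2 := d.a_last
  have hg0 := d.g_ge hj₂.le
  have hg1 := d.g_lt hj₂ le_rfl
  have hg2 := d.g_m
  have k0 := d.pOff_sub_qOff (k := 0) (i := i₁) (j := j₁) hj₁
  have k1 := d.pOff_sub_qOff (k := 1) (i := i₂) (j := j₂) hj₂
  -- The matching diagonal tooth has index `j₁ + j₂`; therefore there are 2m of them.
  have hj : j₁ + j₂ < d.teeth 2 := by simp only [teeth, Matrix.cons_val]; omega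
  have k2 := d.pOff_sub_qOff (k := 2) (i := i₃) hj
  set u := d.pOff 0 i₁ - d.qOff 0 j₁ with hu
  set v := d.pOff 1 i₂ - d.qOff 1 j₂ with hv
  have huv : u - v = d.pOff 2 i₃ - d.qOff 2 (j₁ + j₂) := by
    have hrel : d.rel 0 i₁ j₁ = d.rel 1 i₂ j₂ + d.rel 2 i₃ (j₁ + j₂) := by
      simp only [rel, Matrix.cons_val, h]
      push_cast
      ring
    have hbase : d.base 0 = d.base 1 + d.base 2 := by simp [base]
    rw [k0, k1, k2, hrel, hbase]
    ring
  -- The offsets of the relevant bars are below `M` in absolute value up to `W`, those of the teeth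
  -- start at `M`, and `H` exceeds them all; this determines the signs and sizes of `u` and `v`.
  have u1 : -d.H ≤ u := by simp only [hu, pOff, qOff, Matrix.cons_val]; linarith
  have u2 : u ≤ 0 := by simp only [hu, pOff, qOff, Matrix.cons_val]; linarith
  have v1 : 0 ≤ v := by simp only [hv, pOff, qOff, Matrix.cons_val]; linarith
  have v2 : v ≤ d.H := by simp only [hv, pOff, qOff, Matrix.cons_val]; linarith
  have u1 : (-d.H : ℝ) ≤ u := by exact_mod_cast u1
  have u2 : (u : ℝ) ≤ 0 := by exact_mod_cast u2
  have v1 : (0 : ℝ) ≤ v := by exact_mod_cast v1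
  have v2 : (v : ℝ) ≤ d.H := by exact_mod_cast v2
  refine ⟨((u : ℝ), (v : ℝ)), ?_⟩
  obtain ⟨disj, disj'⟩ := d.disjoint_openBar (i₃ := i₃) h₁ h₂
  have hsub : ∀ k i j, i < d.n → j < d.teeth k →
      form k ((u : ℝ), (v : ℝ)) = d.pOff k i - d.qOff k j → d.openBar k i ⊆
        polyRegion d.P ∩ (fun q => q + ((u : ℝ), (v : ℝ))) '' polyRegion d.Q := by
    intro k i j hi hj hτ p hp
    exact ⟨d.openBar_subset_P hi hp, p - ((u : ℝ), (v : ℝ)),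
      d.mem_Q_of_openBar hi hj hτ u1 u2 v1 v2 hp, sub_add_cancel _ _⟩
  have hle := measure_mono (μ := volume) (Set.union_subset (Set.union_subset
    (hsub 0 i₁ j₁ h₁ hj₁ (by simp only [form, hu]; push_cast; rfl))
    (hsub 1 i₂ j₂ h₂ hj₂ (by simp only [form, hv]; push_cast; rfl)))
    (hsub 2 i₃ (j₁ + j₂) h₃ hj (show (u : ℝ) - v = _ by exact_mod_cast huv)))
  refine lt_of_lt_of_le ?_ hle
  have hmeas : ∀ k i, MeasurableSet (d.openBar k i) := fun k i =>
    measurableSet_form_along measurableSet_Ioo measurableSet_Ioo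
  have hW : (1 : ℝ) ≤ d.W := by exact_mod_cast d.W_pos
  have hH : (4 : ℝ) ≤ d.H := by exact_mod_cast d.D_pos.2.1
  have hWH : 0 ≤ (d.W : ℝ) * d.H := mul_nonneg (by linarith) (by linarith)
  rw [measure_union disj' (hmeas _ _), measure_union disj (hmeas _ _), volume_openBar,
    volume_openBar, volume_openBar, ← ENNReal.ofReal_add hWH hWH,
    ← ENNReal.ofReal_add (by linarith) hWH, ← ENNReal.ofReal_natCast]
  refine (ENNReal.ofReal_lt_ofReal_iff_of_nonneg (by positivity)).2 ?_
  have e : (d.threshold : ℝ) = 3 * d.W * d.H - 1 := by exact_mod_cast d.threshold_eq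
  rw [e]; linarith

/-- The polygon overlap instance that encodes an instance of the sum problem. -/
def overlapInstance : OverlapInstance where
  P := d.P
  Q := d.Q
  δ := d.threshold
  simple_P := d.P_isSimplePolygon
  simple_Q := d.Q_isSimplePolygon
  admissible_P := d.P_edgesAdmissible
  admissible_Q := d.Q_edgesAdmissible
  δ_pos := by
    have h := d.threshold_eq
    have hW := d.W_pos
    have hH := d.D_pos.2.1
    have : (0 : ℤ) < d.threshold := by rw [h]; nlinarith
    exact_mod_cast this

theorem hasOverlap_iff : d.overlapInstance.HasOverlap ↔
    ∃ i₁ < d.n, ∃ i₂ < d.n, ∃ i₃ < d.n, ∃ j₁ < d.m, ∃ j₂ < d.m,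
      d.X₁ i₁ = d.X₂ i₂ + d.X₃ i₃ + d.Y₁ j₁ + d.Y₂ j₂ := by
  constructor
  · rintro ⟨τ, h⟩
    exact d.exists_solution_of_overlap h
  · rintro ⟨i₁, h₁, i₂, h₂, i₃, h₃, j₁, hj₁, j₂, hj₂, h⟩
    exact d.exists_overlap_of_solution h₁ h₂ h₃ hj₁ hj₂ h

end SumData

end Overlap

section Simulation

/-! ## Verified programs for the word RAM -/

theorem toNat_ofInt_of_lt {w : ℕ} {z : ℤ} (h0 : 0 ≤ z) (h1 : z < 2 ^ w) :
    (BitVec.ofInt w z).toNat = z.toNat := by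
  rw [BitVec.toNat_ofInt, Int.emod_eq_of_lt h0 (by exact_mod_cast h1)]

/-- Arithmetic expressions over numbered variables and the input. -/
inductive Expr : Type
  | const (c : ℕ)
  | var (r : ℕ)
  | read (e : Expr)
  | add (e f : Expr)
  | sub (e f : Expr)
  | mul (e f : Expr)
  | lt (e f : Expr)

namespace Expr

/-- The value of an expression; comparisons have value `0` or `1`. -/
def eval (inp : List ℤ) (env : ℕ → ℤ) : Expr → ℤ
  | const c => c
  | var r => env r
  | read e => inp.getD (e.eval inp env).toNat 0
  | add e f => e.eval inp env + f.eval inp env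
  | sub e f => e.eval inp env - f.eval inp env
  | mul e f => e.eval inp env * f.eval inp env
  | lt e f => if e.eval inp env < f.eval inp env then 1 else 0

/-- Indices and operands of comparisons are words. -/
def Ok (w : ℕ) (inp : List ℤ) (env : ℕ → ℤ) : Expr → Prop
  | const _ => True
  | var _ => True
  | read e => e.Ok w inp env ∧ 0 ≤ e.eval inp env ∧ e.eval inp env < 2 ^ w
  | add e f => e.Ok w inp env ∧ f.Ok w inp env
  | sub e f => e.Ok w inp env ∧ f.Ok w inp env
  | mul e f => e.Ok w inp env ∧ f.Ok w inp env
  | lt e f => (e.Ok w inp env ∧ f.Ok w inp env) ∧ (0 ≤ e.eval inp env ∧ e.eval inp env < 2 ^ w) ∧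
      0 ≤ f.eval inp env ∧ f.eval inp env < 2 ^ w

/-- A program that computes an expression, with the result in register `4 * d + 1`.  Variable `r`
is stored in register `4 * r`. -/
def code : Expr → ℕ → Prog
  | const c, d => .const (4 * d + 1) c
  | var r, d => .op .or (4 * d + 1) (4 * r) (4 * r)
  | read e, d => .seq (e.code d) (.load (4 * d + 1) 0 (4 * d + 1))
  | add e f, d => .seq (e.code d) (.seq (f.code (d + 1))
      (.op .add (4 * d + 1) (4 * d + 1) (4 * (d + 1) + 1)))
  | sub e f, d => .seq (e.code d) (.seq (f.code (d + 1))
      (.op .sub (4 * d + 1) (4 * d + 1) (4 * (d + 1) + 1)))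
  | mul e f, d => .seq (e.code d) (.seq (f.code (d + 1))
      (.op .mul (4 * d + 1) (4 * d + 1) (4 * (d + 1) + 1)))
  | lt e f, d => .seq (e.code d) (.seq (f.code (d + 1))
      (.op .lt (4 * d + 1) (4 * d + 1) (4 * (d + 1) + 1)))

/-- The running time of `Expr.code`. -/
def cost : Expr → ℕ
  | const _ => 1
  | var _ => 1
  | read e => e.cost + 1
  | add e f => e.cost + (f.cost + 1)
  | sub e f => e.cost + (f.cost + 1)
  | mul e f => e.cost + (f.cost + 1)
  | lt e f => e.cost + (f.cost + 1)

/-- The state is changed only in scratch registers, and the value `v` is in register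
`4 * d + 1`. -/
def Computes {w : ℕ} (s : RamState w) (d : ℕ) (v : ℤ) (s' : RamState w) : Prop :=
  s'.arr = s.arr ∧ (∀ r, r % 4 ≠ 1 ∨ r < 4 * d + 1 → s'.reg r = s.reg r) ∧
    s'.reg (4 * d + 1) = BitVec.ofInt w v

variable {w : ℕ} {inp : List ℤ} {env : ℕ → ℤ}

theorem binary_code {e f : Expr} {d : ℕ} {s : RamState w} {o : WordOp} {v : ℤ}
    (he : ∃ s', Exec (e.code d) s s' e.cost ∧ Computes s d (e.eval inp env) s')
    (hf : ∀ s', Computes s d (e.eval inp env) s' → ∃ s'', Exec (f.code (d + 1)) s' s'' f.cost ∧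
      Computes s' (d + 1) (f.eval inp env) s'')
    (ho : o.eval (BitVec.ofInt w (e.eval inp env)) (BitVec.ofInt w (f.eval inp env)) =
      BitVec.ofInt w v) :
    ∃ s', Exec (.seq (e.code d) (.seq (f.code (d + 1))
      (.op o (4 * d + 1) (4 * d + 1) (4 * (d + 1) + 1)))) s s' (e.cost + (f.cost + 1)) ∧
      Computes s d v s' := by
  obtain ⟨s₁, h₁, c₁⟩ := he
  obtain ⟨s₂, h₂, c₂⟩ := hf s₁ c₁
  refine ⟨_, h₁.seq (h₂.seq (.op s₂ o _ _ _)), c₂.1.trans c₁.1, fun r hr => ?_, ?_⟩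
  · simp only [RamState.setReg]
    rw [Function.update_of_ne (by omega), c₂.2.1 r (by omega), c₁.2.1 r hr]
  · simp only [RamState.setReg, Function.update_self]
    rw [c₂.2.2, c₂.2.1 _ (by omega), c₁.2.2, ho]

/-- Reduction modulo `2 ^ w` is a ring homomorphism, so intermediate values may be negative or large
without harm. Only array indices and comparisons need the true value, and `Ok` asks for no more. -/
theorem exec_code (e : Expr) (d : ℕ) (s : RamState w)
    (hv : ∀ r, s.reg (4 * r) = BitVec.ofInt w (env r))
    (ha : s.arr 0 = (RamState.init w inp).arr 0) (hok : e.Ok w inp env) :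
    ∃ s', Exec (e.code d) s s' e.cost ∧ Computes s d (e.eval inp env) s' := by
  have next : ∀ {d v} {s s' : RamState w}, (∀ r, s.reg (4 * r) = BitVec.ofInt w (env r)) →
      s.arr 0 = (RamState.init w inp).arr 0 → Computes s d v s' →
      (∀ r, s'.reg (4 * r) = BitVec.ofInt w (env r)) ∧
        s'.arr 0 = (RamState.init w inp).arr 0 := fun hv ha h =>
    ⟨fun r => (h.2.1 _ (by omega)).trans (hv r), (congrFun h.1 0).trans ha⟩
  induction e generalizing d s with
  | const c =>
    refine ⟨_, .const s _ c, rfl, fun r hr => ?_, ?_⟩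
    · simp only [RamState.setReg]
      rw [Function.update_of_ne (by omega)]
    · simp [RamState.setReg, eval]
  | var r =>
    refine ⟨_, .op s .or _ _ _, rfl, fun r hr => ?_, ?_⟩
    · simp only [RamState.setReg]
      rw [Function.update_of_ne (by omega)]
    · simp [RamState.setReg, eval, WordOp.eval, hv]
  | read e ih =>
    obtain ⟨s₁, h₁, c₁⟩ := ih d s hv ha hok.1
    refine ⟨_, h₁.seq (.load s₁ _ _ _), c₁.1, fun r hr => ?_, ?_⟩
    · simp only [RamState.setReg]
      rw [Function.update_of_ne (by omega), c₁.2.1 r hr]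
    · simp only [RamState.setReg, Function.update_self]
      rw [(next hv ha c₁).2, c₁.2.2]
      simp only [RamState.init, if_true, toNat_ofInt_of_lt hok.2.1 hok.2.2, eval]
  | add e f ihe ihf =>
    refine binary_code (ihe d s hv ha hok.1) (fun s' h => ihf _ s' (next hv ha h).1 (next hv ha h).2
      hok.2) ?_
    simp [WordOp.eval, eval, BitVec.ofInt_add]
  | sub e f ihe ihf =>
    refine binary_code (ihe d s hv ha hok.1) (fun s' h => ihf _ s' (next hv ha h).1 (next hv ha h).2
      hok.2) ?_
    simp [WordOp.eval, eval, sub_eq_add_neg, BitVec.ofInt_add, BitVec.ofInt_neg]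
  | mul e f ihe ihf =>
    refine binary_code (ihe d s hv ha hok.1) (fun s' h => ihf _ s' (next hv ha h).1 (next hv ha h).2
      hok.2) ?_
    simp [WordOp.eval, eval, BitVec.ofInt_mul]
  | lt e f ihe ihf =>
    refine binary_code (ihe d s hv ha hok.1.1) (fun s' h => ihf _ s' (next hv ha h).1
      (next hv ha h).2 hok.1.2) ?_
    simp only [WordOp.eval, eval, toNat_ofInt_of_lt hok.2.1.1 hok.2.1.2,
      toNat_ofInt_of_lt hok.2.2.1 hok.2.2.2]
    have : (eval inp env e).toNat < (eval inp env f).toNat ↔ eval inp env e < eval inp env f := by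
      have := hok.2.1.1; have := hok.2.2.1; omega
    simp only [this]
    split_ifs <;> simp

end Expr

/-- What a program knows about the memory besides the input: the values of the variables, the
output list, and the number of output lists that were completed. -/
structure Ghost where
  env : ℕ → ℤ
  out : List ℤ
  cur : ℕ

/-- Change the value of a variable. -/
def Ghost.set (g : Ghost) (r : ℕ) (v : ℤ) : Ghost := { g with env := Function.update g.env r v }

/-- The memory of a simulated machine whose array `a` is stored in array `2 * a + 1`.  An entry
counts only if its time stamp in array `2 * a + 2` agrees with register `3`, and is `0`
otherwise. -/
def RamState.view {w : ℕ} (s : RamState w) (a : ℕ) (i : BitVec w) : BitVec w :=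
  if s.arr (2 * a + 2) i = s.reg 3 then s.arr (2 * a + 1) i else 0

/-- The memory is as described by the ghost state. -/
structure Holds {w : ℕ} (inp : List ℤ) (g : Ghost) (s : RamState w) : Prop where
  vars : ∀ r, s.reg (4 * r) = BitVec.ofInt w (g.env r)
  input : s.arr 0 = (RamState.init w inp).arr 0
  cur : s.reg 3 = BitVec.ofNat w g.cur
  pos : s.reg 7 = BitVec.ofNat w g.out.length
  cur_lt : g.cur < 2 ^ w
  stamp : ∀ a i, (s.arr (2 * a + 2) i).toNat ≤ g.cur
  view : ∀ a i, s.view a i = (RamState.init w g.out).arr a i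

/-- The program takes one ghost state to another one in the given time. -/
def Triple (w : ℕ) (inp : List ℤ) (p : Prog) (g g' : Ghost) (t : ℕ) : Prop :=
  ∀ s : RamState w, Holds inp g s → ∃ s' t', Exec p s s' t' ∧ t' ≤ t ∧ Holds inp g' s'

variable {w : ℕ} {inp : List ℤ} {g g' g'' : Ghost} {p p' : Prog} {t t' : ℕ}

theorem Holds.of_computes {s s' : RamState w} (h : Holds inp g s) {d : ℕ} {v : ℤ}
    (hs : Expr.Computes s d v s') : Holds inp g s' := by
  have hr : ∀ r, r % 4 ≠ 1 → s'.reg r = s.reg r := fun r hr => hs.2.1 r (Or.inl hr)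
  refine ⟨fun r => (hr _ (by omega)).trans (h.vars r), (congrFun hs.1 0).trans h.input,
    (hr _ (by omega)).trans h.cur, (hr _ (by omega)).trans h.pos, h.cur_lt, ?_, fun a i => ?_⟩
  · rw [hs.1]; exact h.stamp
  · rw [← h.view, RamState.view, RamState.view, hs.1, hr 3 (by omega)]

theorem Holds.setReg_var {s : RamState w} (h : Holds inp g s) (r : ℕ) (v : ℤ) :
    Holds inp (g.set r v) (s.setReg (4 * r) (BitVec.ofInt w v)) := by
  have hr : ∀ k, k % 4 ≠ 0 → (s.setReg (4 * r) (BitVec.ofInt w v)).reg k = s.reg k := fun k hk =>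
    Function.update_of_ne (by omega) _ _
  refine ⟨fun k => ?_, h.input, (hr _ (by omega)).trans h.cur, (hr _ (by omega)).trans h.pos,
    h.cur_lt, h.stamp, fun a i => ?_⟩
  · by_cases hk : k = r
    · subst hk; simp [RamState.setReg, Ghost.set]
    · simp only [RamState.setReg, Ghost.set]
      rw [Function.update_of_ne (by omega), Function.update_of_ne hk]
      exact h.vars k
  · refine Eq.trans ?_ (h.view a i)
    rw [RamState.view, RamState.view, hr 3 (by omega)]
    rfl

theorem Triple.seq (h : Triple w inp p g g' t) (h' : Triple w inp p' g' g'' t') :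
    Triple w inp (.seq p p') g g'' (t + t') := fun s hs => by
  obtain ⟨s₁, t₁, e₁, l₁, h₁⟩ := h s hs
  obtain ⟨s₂, t₂, e₂, l₂, h₂⟩ := h' s₁ h₁
  exact ⟨s₂, _, e₁.seq e₂, add_le_add l₁ l₂, h₂⟩

theorem Triple.mono (h : Triple w inp p g g' t) (ht : t ≤ t') : Triple w inp p g g' t' :=
  fun s hs => by
    obtain ⟨s₁, t₁, e₁, l₁, h₁⟩ := h s hs
    exact ⟨s₁, t₁, e₁, l₁.trans ht, h₁⟩

theorem Triple.skip : Triple w inp .skip g g 1 := fun s hs => ⟨s, 1, .skip s, le_rfl, hs⟩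

/-- The program `r := e`. -/
def Prog.assign (r : ℕ) (e : Expr) : Prog := .seq (e.code 0) (.op .or (4 * r) 1 1)

theorem Triple.assign {r : ℕ} {e : Expr} (he : e.Ok w inp g.env) :
    Triple w inp (.assign r e) g (g.set r (e.eval inp g.env)) (e.cost + 1) := fun s hs => by
  obtain ⟨s₁, e₁, c₁⟩ := e.exec_code 0 s hs.vars hs.input he
  refine ⟨_, _, e₁.seq (.op s₁ .or _ _ _), le_rfl, ?_⟩
  have h := (hs.of_computes c₁).setReg_var r (e.eval inp g.env)
  rw [WordOp.eval, show s₁.reg 1 = _ from c₁.2.2, BitVec.or_self]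
  exact h

/-- The program that appends `e` to the output list. -/
def Prog.emit (e : Expr) : Prog :=
  .seq (e.code 0) (.seq (.store 1 7 1) (.seq (.store 2 7 3) (.seq (.const 1 1) (.op .add 7 7 1))))

/-- The output list is array `0` of the simulated machine: the value goes to array `1` and the
current time stamp to array `2`. Hence the list is already in place as the input of the next
simulated run. -/
theorem Triple.emit {e : Expr} (he : e.Ok w inp g.env) (hlen : g.out.length < 2 ^ w) :
    Triple w inp (.emit e) g { g with out := g.out ++ [e.eval inp g.env] } (e.cost + 4) :=
      fun s hs => by
  obtain ⟨s₁, e₁, c₁⟩ := e.exec_code 0 s hs.vars hs.input he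
  have h := hs.of_computes c₁
  refine ⟨_, _, e₁.seq ((Exec.store s₁ _ _ _).seq ((Exec.store _ _ _ _).seq
    ((Exec.const _ _ _).seq (.op _ .add _ _ _)))), le_rfl, ?_⟩
  have hv : s₁.reg 1 = _ := c₁.2.2
  have hp := h.pos
  have hc := h.cur
  refine ⟨fun r => ?_, ?_, ?_, ?_, h.cur_lt, fun a i => ?_, fun a i => ?_⟩
  · simp only [RamState.setReg, RamState.setArr]
    rw [Function.update_of_ne (by omega), Function.update_of_ne (by omega)]
    exact h.vars r
  · simp only [RamState.setReg, RamState.setArr]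
    rw [Function.update_of_ne (by omega), Function.update_of_ne (by omega)]
    exact h.input
  · simp only [RamState.setReg, RamState.setArr]
    rw [Function.update_of_ne (by omega), Function.update_of_ne (by omega)]
    exact hc
  · simp [RamState.setReg, RamState.setArr, WordOp.eval, hp, BitVec.ofNat_add]
  · simp only [RamState.setReg, RamState.setArr]
    by_cases ha : a = 0
    · subst ha
      simp only [Function.update_self, mul_zero, zero_add, Function.update_apply]
      split_ifs
      · rw [hc, BitVec.toNat_ofNat]
        exact Nat.mod_le _ _
      · omega
      · exact h.stamp 0 i
    · rw [Function.update_of_ne (by omega), Function.update_of_ne (by omega)]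
      exact h.stamp a i
  · have hview := h.view a i
    simp only [RamState.view, RamState.init] at hview ⊢
    simp only [RamState.setReg, RamState.setArr]
    by_cases ha : a = 0
    · subst ha
      simp only [if_true] at hview ⊢
      simp only [mul_zero, zero_add, Function.update_apply, OfNat.ofNat_ne_one, if_true, if_false,
        OfNat.one_ne_ofNat, Nat.reduceEqDiff] at hview ⊢
      by_cases hi : i = s₁.reg 7
      · have hi' : i.toNat = g.out.length := by
          rw [hi, hp, BitVec.toNat_ofNat, Nat.mod_eq_of_lt hlen]
        simp [hi, ← hi', hv]
      · have hi' : i.toNat ≠ g.out.length := by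
          intro h'
          apply hi
          apply BitVec.eq_of_toNat_eq
          rw [hp, BitVec.toNat_ofNat, Nat.mod_eq_of_lt hlen, h']
        have hget : (g.out ++ [e.eval inp g.env]).getD i.toNat 0 = g.out.getD i.toNat 0 := by
          rcases lt_or_gt_of_ne hi' with hlt | hlt
          · rw [List.getD_append _ _ _ _ hlt]
          · rw [List.getD_eq_default _ _ (by simp; omega), List.getD_eq_default _ _ hlt.le]
        simp only [hi, if_false, hget]
        exact hview
    · simp only [ha, if_false] at hview ⊢
      have n1 : 2 * a + 2 ≠ 1 := by omega
      have n2 : 2 * a + 2 ≠ 2 := by omega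
      have n3 : 2 * a + 1 ≠ 1 := by omega
      have n4 : 2 * a + 1 ≠ 2 := by omega
      simp only [Function.update_apply, n1, n2, n3, n4, if_false, OfNat.ofNat_ne_one,
        Nat.reduceEqDiff]
      exact hview

/-- The program that appends the values of several expressions to the output list. -/
def Prog.emits : List Expr → Prog
  | [] => .skip
  | e :: es => .seq (.emit e) (.emits es)

/-- The running time of `Prog.emits`. -/
def emitsCost : List Expr → ℕ
  | [] => 1
  | e :: es => e.cost + 4 + emitsCost es

theorem Triple.emits {es : List Expr} (he : ∀ e ∈ es, e.Ok w inp g.env)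
    (hlen : g.out.length + es.length ≤ 2 ^ w) :
    Triple w inp (.emits es) g { g with out := g.out ++ es.map (fun e => e.eval inp g.env) }
      (emitsCost es) := by
  induction es generalizing g with
  | nil => simpa [Prog.emits, emitsCost] using Triple.skip
  | cons e es ih =>
    rw [List.length_cons] at hlen
    have h1 : Triple w inp (.emit e) g _ _ := Triple.emit (he e (by simp)) (by omega)
    have h2 := ih (g := { g with out := g.out ++ [e.eval inp g.env] })
      (fun f hf => he f (by simp [hf])) (by simp; omega)
    simpa [Prog.emits, emitsCost] using h1.seq h2

/-- The loop `for i < b do body`, for variables `i` and `b`; at the end `i` is `0`. -/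
def Prog.for (i b : ℕ) (body : Prog) : Prog :=
  .seq (.assign i (.const 0)) (.seq ((Expr.lt (.var i) (.var b)).code 0)
    (.seq (.loop 1 (.seq body (.seq (.assign i (.add (.var i) (.const 1)))
      ((Expr.lt (.var i) (.var b)).code 0)))) (.assign i (.const 0))))

theorem Ghost.set_set (g : Ghost) (r : ℕ) (u v : ℤ) : (g.set r u).set r v = g.set r v := by
  simp [Ghost.set]

theorem Ghost.set_env_self (g : Ghost) (r : ℕ) (v : ℤ) : (g.set r v).env r = v := by
  simp [Ghost.set]

theorem Ghost.set_env_of_ne (g : Ghost) {r k : ℕ} (v : ℤ) (h : k ≠ r) :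
    (g.set r v).env k = g.env k := by
  simp [Ghost.set, h]

theorem Ghost.set_eq_self {g : Ghost} {r : ℕ} {v : ℤ} (h : g.env r = v) : g.set r v = g := by
  subst h; simp [Ghost.set]

/-- `B` is the loop invariant, up to the value of the loop variable. That variable is reset at the
end, so that the same one can be used again from a known state. -/
theorem Triple.for {i b n : ℕ} {body : Prog} {B : ℕ → Ghost} (hib : b ≠ i) (hn : n < 2 ^ w)
    (hb : ∀ k ≤ n, (B k).env b = n)
    (hbody : ∀ k < n, Triple w inp body ((B k).set i k) ((B (k + 1)).set i k) t) :
    Triple w inp (.for i b body) (B 0) ((B n).set i 0) (n * (t + 8) + 8) := by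
  have hcond : ∀ k ≤ n, ∀ s : RamState w, Holds inp ((B k).set i k) s → ∃ s',
      Exec ((Expr.lt (.var i) (.var b)).code 0) s s' 3 ∧ Holds inp ((B k).set i k) s' ∧
        s'.reg 1 = if k < n then 1 else 0 := by
    intro k hk s hs
    have hk' : ((B k).set i k).env b = n := by rw [Ghost.set_env_of_ne _ _ hib, hb k hk]
    obtain ⟨s', h1, h2⟩ := (Expr.lt (.var i) (.var b)).exec_code (env := ((B k).set i k).env) 0 s
      hs.vars hs.input ⟨⟨trivial, trivial⟩, by
        simp only [Expr.eval, hk', Ghost.set_env_self]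
        refine ⟨⟨by positivity, ?_⟩, by positivity, ?_⟩ <;> exact_mod_cast (by omega)⟩
    refine ⟨s', h1, hs.of_computes h2, ?_⟩
    rw [show s'.reg 1 = _ from h2.2.2]
    simp only [Expr.eval, hk', Ghost.set_env_self, Nat.cast_lt]
    split_ifs <;> simp
  have hloop : ∀ l k, k + l = n → ∀ s : RamState w, Holds inp ((B k).set i k) s →
      (s.reg 1 = if k < n then 1 else 0) → ∃ s' t', Exec (.loop 1 (.seq body
        (.seq (.assign i (.add (.var i) (.const 1))) ((Expr.lt (.var i) (.var b)).code 0)))) s s' t' ∧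
          t' ≤ l * (t + 8) + 1 ∧ Holds inp ((B n).set i n) s' := by
    intro l
    induction l with
    | zero =>
      rintro k rfl s hs h1
      rw [if_neg (by omega)] at h1
      exact ⟨s, 1, .loop_false h1, by omega, hs⟩
    | succ l ih =>
      intro k hk s hs h1
      rw [if_pos (by omega)] at h1
      have hne : s.reg 1 ≠ 0 := by
        rw [h1]
        intro h0
        have := congrArg BitVec.toNat h0
        have hw : 1 < 2 ^ w := by omega
        simp [Nat.mod_eq_of_lt hw] at this
      obtain ⟨s₁, t₁, e₁, l₁, h₁⟩ := hbody k (by omega) s hs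
      obtain ⟨s₂, t₂, e₂, l₂, h₂⟩ := Triple.assign (r := i) (e := .add (.var i) (.const 1))
        (g := (B (k + 1)).set i k) (w := w) (inp := inp) ⟨trivial, trivial⟩ s₁ h₁
      simp only [Expr.eval, Ghost.set_set, Ghost.set_env_self] at h₂
      obtain ⟨s₃, e₃, h₃, c₃⟩ := hcond (k + 1) (by omega) s₂ (by push_cast at h₂ ⊢; exact h₂)
      obtain ⟨s₄, t₄, e₄, l₄, h₄⟩ := ih (k + 1) (by omega) s₃ h₃ c₃
      refine ⟨s₄, _, .loop_true hne (e₁.seq (e₂.seq e₃)) e₄, ?_, h₄⟩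
      simp only [Expr.cost] at l₂
      rw [add_mul]
      omega
  intro s hs
  obtain ⟨s₁, t₁, e₁, l₁, h₁⟩ := Triple.assign (r := i) (e := .const 0) (g := B 0) (w := w)
    (inp := inp) trivial s hs
  obtain ⟨s₂, e₂, h₂, c₂⟩ := hcond 0 (by omega) s₁ h₁
  obtain ⟨s₃, t₃, e₃, l₃, h₃⟩ := hloop n 0 (by omega) s₂ h₂ c₂
  obtain ⟨s₄, t₄, e₄, l₄, h₄⟩ := Triple.assign (r := i) (e := .const 0) (g := (B n).set i n) (w := w)
    (inp := inp) trivial s₃ h₃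
  refine ⟨s₄, _, e₁.seq (e₂.seq (e₃.seq e₄)), ?_, ?_⟩
  · simp only [Expr.cost] at l₁ l₄
    omega
  · simpa [Ghost.set_set, Expr.eval] using h₄

end Simulation

section Compilation

/-! ## Simulating a program on the output list -/

namespace Prog

/-- A bound for the registers that a program uses. -/
def regBound : Prog → ℕ
  | skip => 1
  | const r _ => r + 1
  | op _ r x y => max (r + 1) (max (x + 1) (y + 1))
  | load r _ i => max (r + 1) (i + 1)
  | store _ i r => max (i + 1) (r + 1)
  | seq p q => max p.regBound q.regBound
  | ite r p q => max (r + 1) (max p.regBound q.regBound)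
  | loop r p => max (r + 1) p.regBound

/-- The simulation of a program on the memory given by `RamState.view`. -/
def sim : Prog → Prog
  | skip => skip
  | const r c => const (4 * r + 2) c
  | op o r x y => op o (4 * r + 2) (4 * x + 2) (4 * y + 2)
  | load r a i => seq (load 1 (2 * a + 2) (4 * i + 2)) (seq (op .eq 1 1 3)
      (seq (load 5 (2 * a + 1) (4 * i + 2)) (op .mul (4 * r + 2) 1 5)))
  | store a i r => seq (store (2 * a + 1) (4 * i + 2) (4 * r + 2)) (store (2 * a + 2) (4 * i + 2) 3)
  | seq p q => seq p.sim q.sim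
  | ite r p q => ite (4 * r + 2) p.sim q.sim
  | loop r p => loop (4 * r + 2) p.sim

/-- Set the simulated registers to `0`. -/
def clear : ℕ → Prog
  | 0 => skip
  | n + 1 => seq (const (4 * n + 2) 0) (clear n)

end Prog

variable {w : ℕ}

/-- The state `S` contains the simulated state `s`. -/
def Simulates (B : ℕ) (s S : RamState w) : Prop :=
  (∀ r < B, S.reg (4 * r + 2) = s.reg r) ∧ ∀ a i, S.view a i = s.arr a i

/-- What the simulation preserves. -/
def SimFrame (S S' : RamState w) : Prop :=
  (∀ r, r % 4 = 0 ∨ r % 4 = 3 → S'.reg r = S.reg r) ∧ S'.arr 0 = S.arr 0 ∧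
    ∀ a i, S'.arr (2 * a + 2) i = S.arr (2 * a + 2) i ∨ S'.arr (2 * a + 2) i = S.reg 3

theorem SimFrame.refl (S : RamState w) : SimFrame S S :=
  ⟨fun _ _ => rfl, rfl, fun _ _ => Or.inl rfl⟩

theorem SimFrame.trans {S S' S'' : RamState w} (h : SimFrame S S') (h' : SimFrame S' S'') :
    SimFrame S S'' := by
  refine ⟨fun r hr => (h'.1 r hr).trans (h.1 r hr), h'.2.1.trans h.2.1, fun a i => ?_⟩
  rcases h'.2.2 a i with e | e
  · rw [e]; exact h.2.2 a i
  · rw [e]; exact Or.inr (h.1 3 (Or.inr rfl))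

theorem SimFrame.setReg (S : RamState w) {r : ℕ} (h0 : r % 4 ≠ 0) (h3 : r % 4 ≠ 3)
    (v : BitVec w) : SimFrame S (S.setReg r v) :=
  ⟨fun k hk => Function.update_of_ne (by rintro rfl; omega) _ _, rfl, fun _ _ => Or.inl rfl⟩

theorem RamState.reg_setReg_self (S : RamState w) (r : ℕ) (v : BitVec w) :
    (S.setReg r v).reg r = v := Function.update_self _ _ _

theorem RamState.reg_setReg_of_ne (S : RamState w) {r k : ℕ} (h : k ≠ r) (v : BitVec w) :
    (S.setReg r v).reg k = S.reg k := Function.update_of_ne h _ _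

theorem WordOp.mul_eval_eq (x y z : BitVec w) :
    WordOp.mul.eval (WordOp.eq.eval x y) z = if x = y then z else 0 := by
  simp only [WordOp.eval]
  split_ifs <;> simp

theorem RamState.view_setReg (S : RamState w) {r : ℕ} (h : r ≠ 3) (v : BitVec w) :
    (S.setReg r v).view = S.view := by
  funext a i
  simp only [RamState.view, RamState.setReg, Function.update_of_ne h.symm]

theorem Simulates.setReg {B : ℕ} {s S : RamState w} (h : Simulates B s S) (r : ℕ) (v : BitVec w) :
    Simulates B (s.setReg r v) (S.setReg (4 * r + 2) v) := by
  refine ⟨fun k hk => ?_, fun a i => ?_⟩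
  · simp only [RamState.setReg, Function.update_apply, Nat.add_right_cancel_iff,
      mul_eq_mul_left_iff, OfNat.ofNat_ne_zero, or_false]
    rw [h.1 k hk]
  · rw [RamState.view_setReg _ (by omega)]; exact h.2 a i

theorem Simulates.setReg_scratch {B : ℕ} {s S : RamState w} (h : Simulates B s S) {r : ℕ}
    (hr : r % 4 = 1) (v : BitVec w) : Simulates B s (S.setReg r v) := by
  refine ⟨fun k hk => ?_, fun a i => ?_⟩
  · refine (Function.update_of_ne ?_ _ _).trans (h.1 k hk)
    rintro rfl; omega
  · rw [RamState.view_setReg _ (by rintro rfl; omega)]; exact h.2 a i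

/-- One step becomes at most four. A load is the costly case: the stored value is multiplied by the
result of the comparison of time stamps, so that outdated entries read as zero without a branch. -/
theorem Exec.sim {p : Prog} {s s' : RamState w} {t : ℕ} (h : Exec p s s' t) {B : ℕ}
    (hB : p.regBound ≤ B) {S : RamState w} (hS : Simulates B s S) :
    ∃ S' t', Exec p.sim S S' t' ∧ t' ≤ 4 * t ∧ Simulates B s' S' ∧ SimFrame S S' := by
  induction h generalizing S with
  | skip s => exact ⟨S, 1, .skip S, by omega, hS, .refl S⟩
  | const s r c => exact ⟨_, 1, .const S _ c, by omega, hS.setReg _ _,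
      .setReg _ (by omega) (by omega) _⟩
  | op s o r x y =>
    simp only [Prog.regBound, Nat.max_le] at hB
    refine ⟨_, 1, .op S o _ _ _, by omega, ?_, .setReg _ (by omega) (by omega) _⟩
    rw [hS.1 x hB.2.1, hS.1 y hB.2.2]
    exact hS.setReg _ _
  | load s r a i =>
    simp only [Prog.regBound, Nat.max_le] at hB
    refine ⟨_, _, (Exec.load S 1 _ _).seq ((Exec.op _ .eq 1 1 3).seq ((Exec.load _ 5 _ _).seq
      (.op _ .mul _ 1 5))), by omega, ?_, ?_⟩
    · have hval := hS.2 a (s.reg i)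
      rw [← hS.1 i hB.2, RamState.view] at hval
      have h1 : S.reg (4 * i + 2) = s.reg i := hS.1 i hB.2
      convert ((hS.setReg_scratch (r := 1) rfl _).setReg_scratch (r := 1) rfl _).setReg_scratch
        (r := 5) rfl _ |>.setReg r (s.arr a (s.reg i)) using 1
      rw [← h1, ← hval, RamState.reg_setReg_self, RamState.reg_setReg_of_ne _ (by omega : 1 ≠ 5),
        RamState.reg_setReg_self, RamState.reg_setReg_self,
        RamState.reg_setReg_of_ne _ (by omega : 3 ≠ 1), WordOp.mul_eval_eq]
      simp only [RamState.reg_setReg_of_ne _ (by omega : 4 * i + 2 ≠ 1)]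
      rfl
    · exact (((SimFrame.setReg S (by omega) (by omega) _).trans
        (.setReg _ (by omega) (by omega) _)).trans (.setReg _ (by omega) (by omega) _)).trans
          (.setReg _ (by omega) (by omega) _)
  | store s a i r =>
    simp only [Prog.regBound, Nat.max_le] at hB
    refine ⟨_, _, (Exec.store S _ _ _).seq (.store _ _ _ _), by omega, ⟨fun k hk => hS.1 k hk,
      fun b j => ?_⟩, fun k hk => rfl, ?_, fun b j => ?_⟩
    · have hv := hS.2 b j
      rw [← hS.1 i hB.1, ← hS.1 r hB.2]
      simp only [RamState.view, RamState.setArr] at hv ⊢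
      by_cases hb : b = a
      · subst hb
        have n1 : 2 * b + 2 ≠ 2 * b + 1 := by omega
        have n2 : 2 * b + 1 ≠ 2 * b + 2 := by omega
        simp only [Function.update_apply, n1, n2, if_true, if_false]
        by_cases hj : j = S.reg (4 * i + 2)
        · simp [hj]
        · simp only [hj, if_false]; exact hv
      · have n1 : 2 * b + 2 ≠ 2 * a + 2 := by omega
        have n2 : 2 * b + 2 ≠ 2 * a + 1 := by omega
        have n3 : 2 * b + 1 ≠ 2 * a + 2 := by omega
        have n4 : 2 * b + 1 ≠ 2 * a + 1 := by omega
        simp only [Function.update_apply, n1, n2, n3, n4, hb, if_false]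
        exact hv
    · simp only [RamState.setArr]
      rw [Function.update_of_ne (by omega), Function.update_of_ne (by omega)]
    · simp only [RamState.setArr]
      by_cases hb : b = a
      · subst hb
        have n1 : 2 * b + 2 ≠ 2 * b + 1 := by omega
        simp only [Function.update_apply, n1, if_true, if_false]
        split_ifs
        · exact Or.inr rfl
        · exact Or.inl rfl
      · rw [Function.update_of_ne (by omega), Function.update_of_ne (by omega)]
        exact Or.inl rfl
  | seq _ _ ih₁ ih₂ =>
    simp only [Prog.regBound, Nat.max_le] at hB
    obtain ⟨S₁, t₁, e₁, l₁, h₁, f₁⟩ := ih₁ hB.1 hS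
    obtain ⟨S₂, t₂, e₂, l₂, h₂, f₂⟩ := ih₂ hB.2 h₁
    exact ⟨S₂, _, e₁.seq e₂, by omega, h₂, f₁.trans f₂⟩
  | ite_true hr _ ih =>
    simp only [Prog.regBound, Nat.max_le] at hB
    obtain ⟨S₁, t₁, e₁, l₁, h₁, f₁⟩ := ih hB.2.1 hS
    exact ⟨S₁, _, .ite_true (by rwa [hS.1 _ hB.1]) e₁, by omega, h₁, f₁⟩
  | ite_false hr _ ih =>
    simp only [Prog.regBound, Nat.max_le] at hB
    obtain ⟨S₁, t₁, e₁, l₁, h₁, f₁⟩ := ih hB.2.2 hS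
    exact ⟨S₁, _, .ite_false (by rwa [hS.1 _ hB.1]) e₁, by omega, h₁, f₁⟩
  | loop_false hr =>
    simp only [Prog.regBound, Nat.max_le] at hB
    exact ⟨S, _, .loop_false (by rwa [hS.1 _ hB.1]), by omega, hS, .refl S⟩
  | loop_true hr _ _ ih₁ ih₂ =>
    have hB' := hB
    simp only [Prog.regBound, Nat.max_le] at hB'
    obtain ⟨S₁, t₁, e₁, l₁, h₁, f₁⟩ := ih₁ hB'.2 hS
    obtain ⟨S₂, t₂, e₂, l₂, h₂, f₂⟩ := ih₂ hB h₁
    exact ⟨S₂, _, .loop_true (by rwa [hS.1 _ hB'.1]) e₁ e₂, by omega, h₂, f₁.trans f₂⟩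

theorem Prog.exec_clear (n : ℕ) (S : RamState w) : ∃ S', Exec (.clear n) S S' (n + 1) ∧
    (∀ r < n, S'.reg (4 * r + 2) = 0) ∧ (∀ r, r % 4 ≠ 2 ∨ 4 * n < r → S'.reg r = S.reg r) ∧
      S'.arr = S.arr := by
  induction n generalizing S with
  | zero => exact ⟨S, .skip S, by simp, fun _ _ => rfl, rfl⟩
  | succ n ih =>
    obtain ⟨S', e, h0, hr, ha⟩ := ih (S.setReg (4 * n + 2) 0)
    refine ⟨S', ?_, fun r hlt => ?_, fun r h => ?_, ha⟩
    · rw [add_comm (n + 1) 1]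
      exact (Exec.const S _ 0).seq e
    · rcases Nat.lt_succ_iff_lt_or_eq.1 hlt with h | rfl
      · exact h0 r h
      · rw [hr _ (by omega)]; simp [RamState.setReg]
    · rw [hr r (by omega)]
      exact Function.update_of_ne (by omega) _ _

/-- The program that runs `p` on the output list, sets variable `r` to `1` if the answer is yes,
and starts a new output list. -/
def Prog.query (p : Prog) (r : ℕ) : Prog :=
  .seq (.clear p.regBound) (.seq p.sim (.seq (.ite 2 (.assign r (.const 1)) .skip)
    (.seq (.const 1 1) (.seq (.op .add 3 3 1) (.const 7 0)))))

theorem Prog.regBound_pos (p : Prog) : 0 < p.regBound := by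
  induction p <;> simp only [Prog.regBound] <;> omega

-- Advancing the time stamp erases the simulated arrays at once: all stamps are at most the old
-- time, and the new time does not wrap around. Only the finitely many registers that `p` uses are
-- cleared explicitly.
open Classical in
theorem Triple.query {inp : List ℤ} {g : Ghost} {p : Prog} {T : ℕ} {ans : Prop} (r : ℕ)
    (hp : ∃ (s : RamState w) (t : ℕ), Exec p (RamState.init w g.out) s t ∧ t ≤ T ∧
      (s.reg 0 ≠ 0 ↔ ans)) (hcur : g.cur + 1 < 2 ^ w) :
    Triple w inp (.query p r) g
      ⟨Function.update g.env r (if ans then 1 else g.env r), [], g.cur + 1⟩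
      (p.regBound + 4 * T + 8) := by
  intro s hs
  obtain ⟨s₀, t₀, e₀, l₀, ha⟩ := hp
  obtain ⟨s₁, e₁, z₁, r₁, a₁⟩ := Prog.exec_clear p.regBound s
  have hsim : Simulates p.regBound (RamState.init w g.out) s₁ := by
    refine ⟨fun k hk => z₁ k hk, fun a i => ?_⟩
    rw [← hs.view, RamState.view, RamState.view, r₁ 3 (by omega), a₁]
  obtain ⟨s₂, t₂, e₂, l₂, h₂, f₂⟩ := e₀.sim le_rfl hsim
  have hreg : ∀ k, k % 4 = 0 ∨ k % 4 = 3 → s₂.reg k = s.reg k := fun k hk =>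
    (f₂.1 k hk).trans (r₁ k (by omega))
  have hcur₂ : s₂.reg 3 = BitVec.ofNat w g.cur := (hreg 3 (by omega)).trans hs.cur
  have hstamp : ∀ a i, (s₂.arr (2 * a + 2) i).toNat ≤ g.cur := by
    intro a i
    rcases f₂.2.2 a i with h | h <;> rw [h]
    · rw [a₁]; exact hs.stamp a i
    · rw [r₁ 3 (by omega), hs.cur, BitVec.toNat_ofNat]; exact Nat.mod_le _ _
  obtain ⟨s₃, e₃, v₃, o₃, a₃⟩ : ∃ s₃, Exec (.ite 2 (.assign r (.const 1)) .skip) s₂ s₃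
      (if ans then 3 else 2) ∧
      s₃.reg (4 * r) = BitVec.ofInt w (if ans then 1 else g.env r) ∧
      (∀ k, k % 4 ≠ 1 → k ≠ 4 * r → s₃.reg k = s₂.reg k) ∧ s₃.arr = s₂.arr := by
    have h0 : s₂.reg 2 = s₀.reg 0 := h₂.1 0 p.regBound_pos
    by_cases hans : ans
    · have hne : s₂.reg 2 ≠ 0 := by rw [h0]; exact ha.2 hans
      rw [if_pos hans]
      refine ⟨_, .ite_true hne ((Exec.const s₂ 1 1).seq (.op _ .or (4 * r) 1 1)), ?_,
        fun k h1 h2 => ?_, rfl⟩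
      · simp [RamState.setReg, WordOp.eval, hans]
      · simp only [RamState.setReg]
        rw [Function.update_of_ne h2, Function.update_of_ne (by omega)]
    · have he : s₂.reg 2 = 0 := by
        by_contra h
        exact hans (ha.1 (by rwa [← h0]))
      refine ⟨s₂, by rw [if_neg hans]; exact .ite_false he (.skip s₂), ?_, fun _ _ _ => rfl, rfl⟩
      rw [if_neg hans, hreg _ (by omega), hs.vars]
  refine ⟨_, _, e₁.seq (e₂.seq (e₃.seq ((Exec.const s₃ 1 1).seq ((Exec.op _ .add 3 3 1).seq
    (.const _ 7 0))))), ?_, ?_⟩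
  · split_ifs <;> omega
  have hcur' : s₃.reg 3 + 1#w = BitVec.ofNat w (g.cur + 1) := by
    rw [o₃ 3 (by omega) (by omega), hcur₂, BitVec.ofNat_add]
  refine ⟨fun k => ?_, ?_, ?_, ?_, hcur, fun a i => ?_, fun a i => ?_⟩
  · simp only [RamState.setReg]
    rw [Function.update_of_ne (by omega), Function.update_of_ne (by omega),
      Function.update_of_ne (by omega)]
    by_cases hk : k = r
    · subst hk; rw [v₃, Function.update_self]
    · rw [o₃ _ (by omega) (by omega), hreg _ (by omega), Function.update_of_ne hk, hs.vars]
  · simp only [RamState.setReg]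
    rw [a₃, f₂.2.1, a₁, hs.input]
  · simp only [RamState.setReg, WordOp.eval]
    rw [Function.update_of_ne (by omega), Function.update_self, Function.update_of_ne (by omega),
      Function.update_self, hcur']
  · simp [RamState.setReg]
  · simp only [RamState.setReg]
    rw [a₃]
    exact (hstamp a i).trans (Nat.le_succ _)
  · rw [RamState.view, if_neg]
    · simp [RamState.init]
    · intro h
      have h1 := hstamp a i
      -- A valid entry would carry the new time, which exceeds every stamp written so far.
      have h2 : s₂.arr (2 * a + 2) i = BitVec.ofNat w (g.cur + 1) := by
        rw [← a₃]
        refine Eq.trans h ?_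
        simp only [RamState.setReg, WordOp.eval]
        rw [Function.update_of_ne (by omega), Function.update_self,
          Function.update_of_ne (by omega), Function.update_self, hcur']
      rw [h2, BitVec.toNat_ofNat, Nat.mod_eq_of_lt hcur] at h1
      omega

theorem holds_init (inp : List ℤ) : Holds inp ⟨fun _ => 0, [], 0⟩ (RamState.init w inp) := by
  refine ⟨fun r => by simp [RamState.init], rfl, by simp [RamState.init], by simp [RamState.init],
    by positivity, fun a i => by simp [RamState.init], fun a i => ?_⟩
  simp [RamState.view, RamState.init]

end Compilation

section StepBounds

/-! ## Writing the polygons -/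

variable {w : ℕ}

/-- The program that, for each `(b, es)` in a list, appends the values of the expressions `es` for
each value of variable `i` below variable `b`. -/
def Prog.pieces (i : ℕ) : List (ℕ × List Expr) → Prog
  | [] => .skip
  | q :: l => .seq (.for i q.1 (.emits q.2)) (.pieces i l)

/-- The running time of `Prog.pieces` per iteration. -/
def piecesCost : List (ℕ × List Expr) → ℕ
  | [] => 1
  | q :: l => emitsCost q.2 + 16 + piecesCost l

namespace Expr

instance : Add Expr := ⟨add⟩
instance : Sub Expr := ⟨sub⟩
instance : Mul Expr := ⟨mul⟩
instance (n : ℕ) : OfNat Expr n := ⟨const n⟩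
instance : Neg Expr := ⟨fun e => sub 0 e⟩

/-- The conditional expression `if e < f then a else b`. -/
def ifLt (e f a b : Expr) : Expr := lt e f * a + (1 - lt e f) * b

variable {inp : List ℤ} {env : ℕ → ℤ}

theorem eval_add (e f : Expr) : (e + f).eval inp env = e.eval inp env + f.eval inp env := rfl
theorem eval_sub (e f : Expr) : (e - f).eval inp env = e.eval inp env - f.eval inp env := rfl
theorem eval_mul (e f : Expr) : (e * f).eval inp env = e.eval inp env * f.eval inp env := rfl
theorem eval_neg (e : Expr) : (-e).eval inp env = -e.eval inp env := zero_sub _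

theorem eval_ifLt (e f a b : Expr) : (ifLt e f a b).eval inp env =
    if e.eval inp env < f.eval inp env then a.eval inp env else b.eval inp env := by
  simp only [ifLt, eval_add, eval_sub, eval]
  split_ifs <;> simp


theorem ok_ifLt {e f a b : Expr} (he : e.Ok w inp env) (hf : f.Ok w inp env)
    (ha : a.Ok w inp env) (hb : b.Ok w inp env)
    (he' : 0 ≤ e.eval inp env ∧ e.eval inp env < 2 ^ w)
    (hf' : 0 ≤ f.eval inp env ∧ f.eval inp env < 2 ^ w) : (ifLt e f a b).Ok w inp env :=
  ⟨⟨⟨⟨he, hf⟩, he', hf'⟩, ha⟩, ⟨trivial, ⟨he, hf⟩, he', hf'⟩, hb⟩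

end Expr

section Evals

open Expr

variable {inp : List ℤ} {E : ℕ → ℤ}

/-- The expression has the given value, and its subexpressions are in the range of a word where
this is needed. -/
def Evals (w : ℕ) (inp : List ℤ) (E : ℕ → ℤ) (e : Expr) (v : ℤ) : Prop :=
  e.Ok w inp E ∧ e.eval inp E = v

theorem Evals.var {r : ℕ} {v : ℤ} (h : E r = v) : Evals w inp E (var r) v := ⟨trivial, h⟩

theorem Evals.num (n : ℕ) : Evals w inp E (OfNat.ofNat n) (OfNat.ofNat n : ℕ) := ⟨trivial, rfl⟩

theorem Evals.add {e f : Expr} {u v : ℤ} (he : Evals w inp E e u) (hf : Evals w inp E f v) :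
    Evals w inp E (e + f) (u + v) := ⟨⟨he.1, hf.1⟩, by rw [eval_add, he.2, hf.2]⟩

theorem Evals.sub {e f : Expr} {u v : ℤ} (he : Evals w inp E e u) (hf : Evals w inp E f v) :
    Evals w inp E (e - f) (u - v) := ⟨⟨he.1, hf.1⟩, by rw [eval_sub, he.2, hf.2]⟩

theorem Evals.mul {e f : Expr} {u v : ℤ} (he : Evals w inp E e u) (hf : Evals w inp E f v) :
    Evals w inp E (e * f) (u * v) := ⟨⟨he.1, hf.1⟩, by rw [eval_mul, he.2, hf.2]⟩

theorem Evals.neg {e : Expr} {u : ℤ} (he : Evals w inp E e u) : Evals w inp E (-e) (-u) :=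
  ⟨⟨trivial, he.1⟩, by rw [eval_neg, he.2]⟩

theorem Evals.read {e : Expr} {k : ℕ} (he : Evals w inp E e k) (hk : k < 2 ^ w) :
    Evals w inp E (read e) (inp.getD k 0) :=
  ⟨⟨he.1, by rw [he.2]; positivity, by rw [he.2]; exact_mod_cast hk⟩, by
    simp only [eval, he.2, Int.toNat_natCast]⟩

theorem Evals.ifLt {e f a b : Expr} {i j : ℕ} {u v : ℤ} (he : Evals w inp E e i)
    (hf : Evals w inp E f j) (ha : Evals w inp E a u) (hb : Evals w inp E b v) (hi : i < 2 ^ w)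
    (hj : j < 2 ^ w) : Evals w inp E (ifLt e f a b) (if i < j then u else v) := by
  refine ⟨ok_ifLt he.1 hf.1 ha.1 hb.1 ?_ ?_, ?_⟩
  · rw [he.2]; exact ⟨by positivity, by exact_mod_cast hi⟩
  · rw [hf.2]; exact ⟨by positivity, by exact_mod_cast hj⟩
  · simp only [eval_ifLt, he.2, hf.2, ha.2, hb.2, Nat.cast_lt]

theorem Evals.congr {e : Expr} {u v : ℤ} (he : Evals w inp E e u) (h : u = v) :
    Evals w inp E e v := h ▸ he

/-- The expressions have the given values. -/
def EvalsList (w : ℕ) (inp : List ℤ) (E : ℕ → ℤ) (es : List Expr) (vs : List ℤ) : Prop :=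
  List.Forall₂ (Evals w inp E) es vs

theorem EvalsList.ok {es : List Expr} {vs : List ℤ} (h : EvalsList w inp E es vs) :
    (∀ e ∈ es, e.Ok w inp E) ∧ es.map (fun e => e.eval inp E) = vs := by
  induction h with
  | nil => simp
  | cons h _ ih => exact ⟨by simpa using ⟨h.1, ih.1⟩, by simp [h.2, ih.2]⟩

end Evals

theorem Triple.piece {inp : List ℤ} {g : Ghost} {i : ℕ} {q : ℕ × List Expr} {n : ℕ}
    {f : ℕ → List ℤ} (hi : g.env i = 0) (hq : q.1 ≠ i) (hn : g.env q.1 = n) (hw : n < 2 ^ w)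
    (hok : ∀ k < n, EvalsList w inp (Function.update g.env i k) q.2 (f k))
    (hlen : (g.out ++ (List.range n).flatMap f).length ≤ 2 ^ w) :
    Triple w inp (.for i q.1 (.emits q.2)) g
      { g with out := g.out ++ (List.range n).flatMap f } (n * (emitsCost q.2 + 8) + 8) := by
  have h := Triple.for (w := w) (inp := inp) (i := i) (b := q.1) (n := n) (body := .emits q.2)
    (t := emitsCost q.2) (B := fun k => { g with out := g.out ++ (List.range k).flatMap f })
    hq hw (fun k _ => hn) ?_
  · simpa [Ghost.set, ← hi] using h
  · intro k hk
    have hout : (List.range (k + 1)).flatMap f = (List.range k).flatMap f ++ f k := by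
      simp [List.range_succ]
    have hle : ((List.range (k + 1)).flatMap f).length ≤ ((List.range n).flatMap f).length := by
      obtain ⟨l, rfl⟩ := Nat.exists_eq_add_of_le (Nat.succ_le_of_lt hk)
      simp [List.range_add]
    have hf := (hok k hk).length_eq
    have := Triple.emits (w := w) (inp := inp) (es := q.2)
      (g := Ghost.set { g with out := g.out ++ (List.range k).flatMap f } i k) (hok k hk).ok.1 (by
        rw [hout] at hle
        simp only [List.length_append, Ghost.set] at hle hlen ⊢
        omega)
    have hmap := (hok k hk).ok.2
    simpa [Ghost.set, hout, hmap] using this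

/-- The pair from `Prog.pieces` appends `f k` for each `k < n`, where `D = (n, f)`. -/
def PieceEvals (w : ℕ) (inp : List ℤ) (E : ℕ → ℤ) (i N : ℕ) (q : ℕ × List Expr)
    (D : ℕ × (ℕ → List ℤ)) : Prop :=
  q.1 ≠ i ∧ E q.1 = D.1 ∧ D.1 < 2 ^ w ∧ D.1 ≤ N ∧
    ∀ k < D.1, EvalsList w inp (Function.update E i k) q.2 (D.2 k)

theorem Triple.pieces {inp : List ℤ} {g : Ghost} {i : ℕ} {l : List (ℕ × List Expr)}
    {Ds : List (ℕ × (ℕ → List ℤ))} {N : ℕ} {E : ℕ → ℤ} (hN : 1 ≤ N)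
    (hE : g.env = E) (hi : E i = 0) (hl : List.Forall₂ (PieceEvals w inp E i N) l Ds)
    (hlen : (g.out ++ Ds.flatMap fun D => (List.range D.1).flatMap D.2).length ≤ 2 ^ w) :
    Triple w inp (.pieces i l) g
      { g with out := g.out ++ Ds.flatMap fun D => (List.range D.1).flatMap D.2 }
      (piecesCost l * N) := by
  induction hl generalizing g with
  | nil => simpa [Prog.pieces] using Triple.skip.mono (by simpa [piecesCost] using hN)
  | @cons q D l Ds hq hl ih =>
    obtain ⟨h1, h2, h3, h4, h5⟩ := hq
    have hlen' : (g.out ++ (List.range D.1).flatMap D.2).length ≤ 2 ^ w := by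
      simp only [List.flatMap_cons, List.length_append] at hlen ⊢
      omega
    subst hE
    have hfirst := Triple.piece hi h1 h2 h3 h5 hlen'
    have hlen_rest : ((g.out ++ (List.range D.1).flatMap D.2) ++
        Ds.flatMap fun D => (List.range D.1).flatMap D.2).length ≤ 2 ^ w := by simpa using hlen
    have hrest := ih (g := { g with out := g.out ++ (List.range D.1).flatMap D.2 }) rfl hlen_rest
    have h := hfirst.seq hrest
    simp only [List.append_assoc] at h
    simp only [List.flatMap_cons]
    refine h.mono ?_
    have := Nat.mul_le_mul_right (emitsCost q.2 + 8) h4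
    simp only [piecesCost]
    nlinarith

/-- The coordinates of a list of points. -/
def coords {α : Type} (l : List (α × α)) : List α := l.flatMap fun a => [a.1, a.2]

theorem coords_append {α : Type} (l l' : List (α × α)) : coords (l ++ l') = coords l ++ coords l' :=
  List.flatMap_append

theorem coords_flatMap {α β : Type} (l : List β) (f : β → List (α × α)) :
    coords (l.flatMap f) = l.flatMap fun b => coords (f b) :=
  List.flatMap_assoc

theorem coords_comb (A B F G : ℤ × ℤ) (s t : ℕ → ℤ × ℤ) (X Y : ℕ → List (ℤ × ℤ)) (r r' : ℕ) :
    coords (comb A B F G s t X Y r r') = coords [A, B, s 0] ++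
      ((List.range r).flatMap (fun i => coords (X i ++ [s (i + 1)])) ++ (coords [F, G, t 0] ++
        (List.range r').flatMap (fun i => coords (Y i ++ [t (i + 1)])))) := by
  rw [← coords_flatMap, ← coords_flatMap, ← coords_append, ← coords_append, ← coords_append]
  rfl

/-! The variables are: `1` for `n`, `2` for `m`, `3` to `8` for `V`, `W`, `M`, `H`, `D`, `L`, `9` for
the number of pieces of the lists `Y`, `10` and `11` for the indices of the current pieces, `12` for
a loop counter, and `13`, `14`, `15` for `1`, `2 * n`, `3 * m`. -/

namespace PolyCode

open Expr

/-- The multiple `4 * W * e`. -/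
def scaled (e : Expr) : Expr := 4 * var 4 * e

/-- An entry of the fourth or fifth list of the input. -/
def yEntry (l r e : Expr) : Expr :=
  read (1 + l * var 1 + ifLt (r * var 2 + e) (var 1) (r * var 2 + e) 0)

/-- `SumData.h` -/
def h (e : Expr) : Expr := scaled (var 3) + 2 - scaled (read (1 + var 1 + e))

/-- `SumData.c` -/
def c (e : Expr) : Expr := (e + 1) * var 7

/-- `SumData.x` -/
def x (e : Expr) : Expr := ifLt e (var 1) (scaled (read (1 + e)))
  (c e + (var 2 * var 5 + scaled (var 3) + 1 + scaled (read (1 + var 1 + e))))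

/-- `SumData.a` -/
def a (e : Expr) : Expr :=
  ifLt e (var 2) ((e + 1) * var 5 + scaled (yEntry 3 (var 10) e)) ((e + 2) * var 5)

/-- `SumData.g` -/
def g (e : Expr) : Expr :=
  ifLt e (var 2) ((e + 1) * var 5 + scaled (yEntry 4 (var 11) e)) ((e + 1) * var 5)

/-- `barTooth` -/
def barTooth (b h W H : Expr) : List (Expr × Expr) :=
  [(b, -h - W), (b + H, -h - W), (b + H, -h), (b + 1, -h), (b + 1, -1)]

/-- `sideTooth` -/
def sideTooth (c X W H E u : Expr) : List (Expr × Expr) :=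
  [(X + W, c), (X + W + E, c + H), (X + E, c + H), (X + u, c + 1), (0, c + 1)]

/-- `upTooth` -/
def upTooth (a W L E : Expr) : List (Expr × Expr) :=
  [(a + E, 1 + L), (a + W + E, 1 + L), (a + W, 1)]

/-- `rightTooth` -/
def rightTooth (g W L : Expr) : List (Expr × Expr) := [(L, -g), (L, -g - W), (0, -g - W)]

/-- The expressions that describe an instance of the polygon overlap problem. -/
def overlap : List (ℕ × List Expr) :=
  [(13, [18 * var 1 + 6, 16 * var 2 + 6, 3 * var 4 * var 6 - 1]),
    (13, coords [(-1, (2 * var 1 + 1) * var 7), (-1, -1), (0, -1)]),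
    (1, coords (barTooth (var 12 * var 7) (h (var 12)) (var 4) (var 6) ++
      [((var 12 + 1) * var 7, -1)])),
    (13, coords [(var 1 * var 7, 0), (0, 0), (0, c 0)]),
    (14, coords (sideTooth (c (var 12)) (x (var 12)) (var 4) (var 6)
      (ifLt (var 12) (var 1) 0 (var 6)) (ifLt (var 12) (var 1) 0 1) ++ [(0, c (var 12 + 1))])),
    (13, coords [(-1, -((var 2 + 1) * var 5)), (-1, 1), (a 0, 1)]),
    (15, coords (upTooth (a (var 12)) (var 4) (var 8) (ifLt (var 12) (var 2) 0 (var 8)) ++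
      [(a (var 12 + 1), 1)])),
    (13, coords [(a (var 15), 0), (0, 0), (0, -g 0)]),
    (2, coords (rightTooth (g (var 12)) (var 4) (var 8) ++ [(0, -g (var 12 + 1))]))]

end PolyCode

end StepBounds

/-! ### Evaluating the expressions that describe the polygons -/

namespace PolyCode

open Expr

variable {w : ℕ} {inp : List ℤ} {E : ℕ → ℤ}

/-- The variables and the input describe an instance of the sum problem. -/
structure Represents (w : ℕ) (inp : List ℤ) (E : ℕ → ℤ) (d : SumData) (r₁ r₂ : ℕ) : Prop where
  n : E 1 = d.n
  m : E 2 = d.m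
  V : E 3 = d.V
  W : E 4 = d.W
  M : E 5 = d.M
  H : E 6 = d.H
  D : E 7 = d.D
  L : E 8 = d.L
  piece₁ : E 10 = r₁
  piece₂ : E 11 = r₂
  one : E 13 = 1
  twoN : E 14 = (2 * d.n : ℕ)
  threeM : E 15 = (3 * d.m : ℕ)
  X₁ : ∀ i, inp.getD (1 + i) 0 = d.X₁ i
  X₂ : ∀ i, inp.getD (1 + d.n + i) 0 = d.X₂ i
  X₃ : ∀ i, inp.getD (1 + 2 * d.n + i) 0 = d.X₃ i
  Y₁ : ∀ j, inp.getD (1 + 3 * d.n + if r₁ * d.m + j < d.n then r₁ * d.m + j else 0) 0 = d.Y₁ j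
  Y₂ : ∀ j, inp.getD (1 + 4 * d.n + if r₂ * d.m + j < d.n then r₂ * d.m + j else 0) 0 = d.Y₂ j
  lt : 1 + 5 * d.n < 2 ^ w
  lt₁ : r₁ * d.m + 3 * d.m < 2 ^ w
  lt₂ : r₂ * d.m + 3 * d.m < 2 ^ w

theorem Represents.update {d : SumData} {r₁ r₂ : ℕ} (R : Represents w inp E d r₁ r₂) (k : ℤ) :
    Represents w inp (Function.update E 12 k) d r₁ r₂ := by
  obtain ⟨h1, h2, h3, h4, h5, h6, h7, h8, h9, h10, h11, h12, h13, h14, h15, h16, h17, h18, h19, h20,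
    h21⟩ := R
  exact ⟨h1, h2, h3, h4, h5, h6, h7, h8, h9, h10, h11, h12, h13, h14, h15, h16, h17, h18, h19, h20,
    h21⟩

variable {d : SumData} {r₁ r₂ : ℕ}

theorem evals_scaled (R : Represents w inp E d r₁ r₂) {e : Expr} {v : ℤ} (he : Evals w inp E e v) :
    Evals w inp E (scaled e) (4 * d.W * v) :=
  ((Evals.num 4).mul (.var R.W)).mul he

theorem evals_h (R : Represents w inp E d r₁ r₂) {e : Expr} {i : ℕ} (he : Evals w inp E e i) (hi : i < d.n) :
    Evals w inp E (h e) (d.h i) := by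
  have hr : Evals w inp E (.read (1 + .var 1 + e)) (d.X₂ i) := by
    rw [← R.X₂ i]
    refine Evals.read (((Evals.num 1).add (.var R.n)).add he |>.congr (by push_cast; ring)) ?_
    have := R.lt; omega
  exact ((evals_scaled R (.var R.V)).add (.num 2)).sub (evals_scaled R hr)

theorem evals_c (R : Represents w inp E d r₁ r₂) {e : Expr} {i : ℕ} (he : Evals w inp E e i) : Evals w inp E (c e) (d.c i) :=
  (he.add (.num 1)).mul (.var R.D)

theorem evals_x (R : Represents w inp E d r₁ r₂) {e : Expr} {i : ℕ} (he : Evals w inp E e i) (hi : i < 2 * d.n) :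
    Evals w inp E (x e) (d.x i) := by
  have hw := R.lt
  -- Both branches of a conditional expression are computed, so both array accesses must be in
  -- range, including the one that is not used.
  refine (Evals.ifLt he (.var R.n) (evals_scaled R (Evals.read (k := 1 + i) (((Evals.num 1).add
    he).congr (by push_cast; ring)) (by omega))) ((evals_c R he).add ((((((Evals.var R.m).mul
      (.var R.M)).add (evals_scaled R (.var R.V))).add (.num 1))).add (evals_scaled R
        (Evals.read (k := 1 + d.n + i) ((((Evals.num 1).add (.var R.n)).add he).congr
          (by push_cast; ring)) (by omega))))) (by omega) (by omega)).congr ?_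
  rw [SumData.x]
  split_ifs with hin
  · rw [R.X₁]
  · obtain ⟨j, rfl⟩ := Nat.exists_eq_add_of_le (not_lt.1 hin)
    rw [show 1 + d.n + (d.n + j) = 1 + 2 * d.n + j by ring, R.X₃, Nat.add_sub_cancel_left]
    push_cast; ring

/-- An index beyond the end of the list is replaced by `0`, so a short last piece is padded with an
element that is present anyway. The range of `j` goes up to 3m because the entry is computed also
for diagonal teeth, where it is discarded. -/
theorem evals_yEntry (R : Represents w inp E d r₁ r₂) {l r e : Expr} {k ρ j : ℕ} (hl : Evals w inp E l k)
    (hr : Evals w inp E r ρ) (he : Evals w inp E e j) (hk : k ≤ 4) (hj : j ≤ 3 * d.m)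
    (hlt : ρ * d.m + 3 * d.m < 2 ^ w) :
    Evals w inp E (yEntry l r e)
      (inp.getD (1 + k * d.n + if ρ * d.m + j < d.n then ρ * d.m + j else 0) 0) := by
  have hw := R.lt
  have ht : Evals w inp E (r * .var 2 + e) ((ρ * d.m + j : ℕ) : ℤ) :=
    ((hr.mul (.var R.m)).add he).congr (by push_cast; ring)
  refine Evals.read ((((Evals.num 1).add (hl.mul (.var R.n))).add (.ifLt ht (.var R.n) ht (.num 0)
    (by omega) (by omega))).congr ?_) ?_
  · push_cast; rfl
  · have : k * d.n ≤ 4 * d.n := Nat.mul_le_mul_right _ hk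
    split_ifs <;> omega

theorem evals_a (R : Represents w inp E d r₁ r₂) {e : Expr} {j : ℕ} (he : Evals w inp E e j) (hj : j ≤ 3 * d.m) :
    Evals w inp E (a e) (d.a j) := by
  have hlt := R.lt₁
  have hy : Evals w inp E (yEntry 3 (.var 10) e) (d.Y₁ j) := by
    rw [← R.Y₁ j]
    exact evals_yEntry R (Evals.num 3) (.var R.piece₁) he (by norm_num) hj R.lt₁
  exact Evals.ifLt he (.var R.m) (((he.add (.num 1)).mul (.var R.M)).add (evals_scaled R hy))
    ((he.add (.num 2)).mul (.var R.M)) (by omega) (by omega)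

theorem evals_g (R : Represents w inp E d r₁ r₂) {e : Expr} {j : ℕ} (he : Evals w inp E e j) (hj : j ≤ d.m) :
    Evals w inp E (g e) (d.g j) := by
  have hlt := R.lt₂
  have hy : Evals w inp E (yEntry 4 (.var 11) e) (d.Y₂ j) := by
    rw [← R.Y₂ j]
    exact evals_yEntry R (Evals.num 4) (.var R.piece₂) he (by norm_num) (by omega) R.lt₂
  exact Evals.ifLt he (.var R.m) (((he.add (.num 1)).mul (.var R.M)).add (evals_scaled R hy))
    ((he.add (.num 1)).mul (.var R.M)) (by omega) (by omega)

end PolyCode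

namespace SumData

variable (d : SumData)

theorem enc_eq : d.overlapInstance.enc =
    [(18 * d.n + 6 : ℤ), 16 * d.m + 6, 3 * d.W * d.H - 1] ++ (coords d.P ++ coords d.Q) := by
  rw [← coords_append]
  simp only [OverlapInstance.enc, OverlapInstance.n, OverlapInstance.m, overlapInstance, P_length,
    Q_length, threshold_eq, coords]
  push_cast
  rfl

end SumData

namespace PolyCode

open Expr

variable {w : ℕ} {inp : List ℤ} {E : ℕ → ℤ}

/-- The pairs of expressions have the given points as values. -/
def EvalsPoints (w : ℕ) (inp : List ℤ) (E : ℕ → ℤ) (ps : List (Expr × Expr)) (qs : List (ℤ × ℤ)) :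
    Prop :=
  List.Forall₂ (fun p q => Evals w inp E p.1 q.1 ∧ Evals w inp E p.2 q.2) ps qs

theorem EvalsPoints.append {ps ps' : List (Expr × Expr)} {qs qs' : List (ℤ × ℤ)}
    (h : EvalsPoints w inp E ps qs) (h' : EvalsPoints w inp E ps' qs') :
    EvalsPoints w inp E (ps ++ ps') (qs ++ qs') := by
  induction h with
  | nil => exact h'
  | cons h _ ih => exact .cons h ih

theorem EvalsPoints.coords {ps : List (Expr × Expr)} {qs : List (ℤ × ℤ)}
    (h : EvalsPoints w inp E ps qs) : EvalsList w inp E (coords ps) (coords qs) := by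
  induction h with
  | nil => exact .nil
  | cons h _ ih => exact .cons h.1 (.cons h.2 ih)

theorem EvalsPoints.single {p : Expr × Expr} {x y : ℤ} (hx : Evals w inp E p.1 x)
    (hy : Evals w inp E p.2 y) : EvalsPoints w inp E [p] [(x, y)] :=
  .cons ⟨hx, hy⟩ .nil

theorem EvalsPoints.triple {p q r : Expr × Expr} {a a' b b' c c' : ℤ} (ha : Evals w inp E p.1 a)
    (ha' : Evals w inp E p.2 a') (hb : Evals w inp E q.1 b) (hb' : Evals w inp E q.2 b')
    (hc : Evals w inp E r.1 c) (hc' : Evals w inp E r.2 c') :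
    EvalsPoints w inp E [p, q, r] [(a, a'), (b, b'), (c, c')] :=
  .cons ⟨ha, ha'⟩ (.cons ⟨hb, hb'⟩ (EvalsPoints.single hc hc'))

theorem evals_zero : Evals w inp E 0 0 := Evals.num 0

theorem evals_one : Evals w inp E 1 1 := Evals.num 1

theorem evals_barTooth {b h W H : Expr} {b' h' W' H' : ℤ} (hb : Evals w inp E b b')
    (hh : Evals w inp E h h') (hW : Evals w inp E W W') (hH : Evals w inp E H H') :
    EvalsPoints w inp E (barTooth b h W H) (_root_.barTooth b' h' W' H') :=
  .cons ⟨hb, hh.neg.sub hW⟩ <| .cons ⟨hb.add hH, hh.neg.sub hW⟩ <|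
    EvalsPoints.triple (hb.add hH) hh.neg (hb.add evals_one) hh.neg (hb.add evals_one) evals_one.neg

theorem evals_sideTooth {c X W H e u : Expr} {c' X' W' H' e' u' : ℤ} (hc : Evals w inp E c c')
    (hX : Evals w inp E X X') (hW : Evals w inp E W W') (hH : Evals w inp E H H')
    (he : Evals w inp E e e') (hu : Evals w inp E u u') :
    EvalsPoints w inp E (sideTooth c X W H e u) (_root_.sideTooth c' X' W' H' e' u') :=
  .cons ⟨hX.add hW, hc⟩ <| .cons ⟨(hX.add hW).add he, hc.add hH⟩ <|
    EvalsPoints.triple (hX.add he) (hc.add hH) (hX.add hu) (hc.add evals_one) evals_zero (hc.add evals_one)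

theorem evals_upTooth {a W L e : Expr} {a' W' L' e' : ℤ} (ha : Evals w inp E a a')
    (hW : Evals w inp E W W') (hL : Evals w inp E L L') (he : Evals w inp E e e') :
    EvalsPoints w inp E (upTooth a W L e) (_root_.upTooth a' W' L' e') :=
  .triple (ha.add he) (evals_one.add hL) ((ha.add hW).add he) (evals_one.add hL) (ha.add hW)
    evals_one

theorem evals_rightTooth {g W L : Expr} {g' W' L' : ℤ} (hg : Evals w inp E g g')
    (hW : Evals w inp E W W') (hL : Evals w inp E L L') :
    EvalsPoints w inp E (rightTooth g W L) (_root_.rightTooth g' W' L') :=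
  .triple hL hg.neg hL (hg.neg.sub hW) evals_zero (hg.neg.sub hW)

/-- The values of `overlap`. -/
def overlapValues (d : SumData) : List (ℕ × (ℕ → List ℤ)) :=
  [(1, fun _ => [18 * d.n + 6, 16 * d.m + 6, 3 * d.W * d.H - 1]),
    (1, fun _ => coords [(-1, (2 * d.n + 1) * d.D), (-1, -1), (0, -1)]),
    (d.n, fun i => coords (_root_.barTooth (i * d.D) (d.h i) d.W d.H ++
      [((i + 1 : ℕ) * d.D, -1)])),
    (1, fun _ => coords [(d.n * d.D, 0), (0, 0), (0, d.c 0)]),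
    (2 * d.n, fun i => coords (_root_.sideTooth (d.c i) (d.x i) d.W d.H (if i < d.n then 0 else d.H)
      (if i < d.n then 0 else 1) ++ [(0, d.c (i + 1))])),
    (1, fun _ => coords [(-1, -((d.m + 1) * d.M)), (-1, 1), (d.a 0, 1)]),
    (3 * d.m, fun j => coords (_root_.upTooth (d.a j) d.W d.L (if j < d.m then 0 else d.L) ++
      [(d.a (j + 1), 1)])),
    (1, fun _ => coords [(d.a (3 * d.m), 0), (0, 0), (0, -d.g 0)]),
    (d.m, fun j => coords (_root_.rightTooth (d.g j) d.W d.L ++ [(0, -d.g (j + 1))]))]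

theorem overlapValues_eq (d : SumData) :
    (overlapValues d).flatMap (fun D => (List.range D.1).flatMap D.2) = d.overlapInstance.enc := by
  rw [d.enc_eq, SumData.P, SumData.Q, coords_comb, coords_comb]
  simp [overlapValues]

theorem evals_overlap {d : SumData} {r₁ r₂ : ℕ} (R : Represents w inp E d r₁ r₂) (hmn : d.m ≤ d.n) :
    List.Forall₂ (PieceEvals w inp E 12 (3 * d.n)) overlap (overlapValues d) := by
  have hn := d.n_pos
  have hm := d.m_pos
  have hlt := R.lt
  have hlt₁ := R.lt₁
  -- Isolated vertices are written by a loop with one round, whose bound is variable `13`.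
  have single : ∀ {es : List Expr} {vs : List ℤ},
      EvalsList w inp (Function.update E 12 (0 : ℕ)) es vs →
      PieceEvals w inp E 12 (3 * d.n) (13, es) (1, fun _ => vs) := by
    intro es vs h
    refine ⟨by norm_num, R.one, by omega, by omega, fun k hk => ?_⟩
    obtain rfl : k = 0 := by simpa using hk
    exact h
  have R0 := R.update (0 : ℕ)
  refine .cons ?_ <| .cons ?_ <| .cons ?_ <| .cons ?_ <| .cons ?_ <| .cons ?_ <| .cons ?_ <|
    .cons ?_ <| .cons ?_ .nil
  · exact single (.cons (((Evals.num 18).mul (.var R0.n)).add (.num 6))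
      (.cons (((Evals.num 16).mul (.var R0.m)).add (.num 6))
        (.cons ((((Evals.num 3).mul (.var R0.W)).mul (.var R0.H)).sub evals_one) .nil)))
  · exact single (EvalsPoints.coords (.triple evals_one.neg ((((Evals.num 2).mul (.var R0.n)).add
      evals_one).mul (.var R0.D)) evals_one.neg evals_one.neg evals_zero evals_one.neg))
  · refine ⟨by norm_num, R.n, by omega, by omega, fun k hk => ?_⟩
    have Rk := R.update k
    have hk' : Evals w inp (Function.update E 12 (k : ℤ)) (.var 12) k := .var (by simp)
    exact ((evals_barTooth (hk'.mul (.var Rk.D)) (evals_h Rk hk' hk) (.var Rk.W)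
      (.var Rk.H)).append (.single (((hk'.add evals_one).mul (.var Rk.D)).congr (by push_cast; rfl))
        evals_one.neg)).coords
  · exact single (EvalsPoints.coords (.triple ((Evals.var R0.n).mul (.var R0.D)) evals_zero evals_zero
      evals_zero evals_zero (evals_c R0 (i := 0) evals_zero)))
  · refine ⟨by norm_num, R.twoN, by omega, by omega, fun k hk => ?_⟩
    have hk : k < 2 * d.n := hk
    have Rk := R.update k
    have hk' : Evals w inp (Function.update E 12 (k : ℤ)) (.var 12) k := .var (by simp)
    exact ((evals_sideTooth (evals_c Rk hk') (evals_x Rk hk' hk) (.var Rk.W) (.var Rk.H)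
      (.ifLt hk' (.var Rk.n) evals_zero (.var Rk.H) (by omega) (by omega))
      (.ifLt hk' (.var Rk.n) evals_zero evals_one (by omega) (by omega))).append
        (.single evals_zero (evals_c Rk ((hk'.add evals_one).congr (by push_cast; rfl))))).coords
  · exact single (EvalsPoints.coords (.triple evals_one.neg (((Evals.var R0.m).add evals_one).mul
      (.var R0.M)).neg evals_one.neg evals_one (evals_a R0 (j := 0) evals_zero (by omega))
        evals_one))
  · refine ⟨by norm_num, R.threeM, by omega, by omega, fun k hk => ?_⟩
    have hk : k < 3 * d.m := hk
    have Rk := R.update k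
    have hk' : Evals w inp (Function.update E 12 (k : ℤ)) (.var 12) k := .var (by simp)
    exact ((evals_upTooth (evals_a Rk hk' (by omega)) (.var Rk.W) (.var Rk.L)
      (.ifLt hk' (.var Rk.m) evals_zero (.var Rk.L) (by omega) (by omega))).append
        (.single (evals_a Rk ((hk'.add evals_one).congr (by push_cast; rfl)) (by omega))
          evals_one)).coords
  · exact single (EvalsPoints.coords (.triple (evals_a R0 (.var R0.threeM) (by omega)) evals_zero
      evals_zero evals_zero evals_zero (evals_g R0 (j := 0) evals_zero (by omega)).neg))
  · refine ⟨by norm_num, R.m, by omega, by omega, fun k hk => ?_⟩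
    have hk : k < d.m := hk
    have Rk := R.update k
    have hk' : Evals w inp (Function.update E 12 (k : ℤ)) (.var 12) k := .var (by simp)
    exact ((evals_rightTooth (evals_g Rk hk' (by omega)) (.var Rk.W) (.var Rk.L)).append
        (.single evals_zero (evals_g Rk ((hk'.add evals_one).congr (by push_cast; rfl))
          (by omega)).neg)).coords

theorem triple_overlap {d : SumData} {r₁ r₂ : ℕ} {g : Ghost} (R : Represents w inp g.env d r₁ r₂)
    (hmn : d.m ≤ d.n) (hout : g.out = []) (h12 : g.env 12 = 0)
    (hlen : d.overlapInstance.enc.length ≤ 2 ^ w) :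
    Triple w inp (.pieces 12 overlap) g { g with out := d.overlapInstance.enc }
      (piecesCost overlap * (3 * d.n)) := by
  have h := Triple.pieces (w := w) (inp := inp) (g := g) (N := 3 * d.n) (by have := d.n_pos; omega)
    rfl h12 (evals_overlap R hmn) (by rwa [overlapValues_eq, hout, List.nil_append])
  rwa [overlapValues_eq, hout, List.nil_append] at h

end PolyCode

section Search

/-! ## The reduction -/

variable {w : ℕ}

theorem Triple.assign_of_evals {inp : List ℤ} {g : Ghost} {r : ℕ} {e : Expr} {v : ℤ}
    (h : Evals w inp g.env e v) : Triple w inp (.assign r e) g (g.set r v) (e.cost + 1) := by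
  have := Triple.assign (r := r) h.1
  rwa [h.2] at this

/-- Powers of expressions. -/
def Expr.pow (e : Expr) : ℕ → Expr
  | 0 => 1
  | b + 1 => e.pow b * e

theorem Evals.pow {inp : List ℤ} {E : ℕ → ℤ} {e : Expr} {v : ℤ} (h : Evals w inp E e v) (b : ℕ) :
    Evals w inp E (e.pow b) (v ^ b) := by
  induction b with
  | zero => exact PolyCode.evals_one.congr (pow_zero v).symm
  | succ b ih => exact (ih.mul h).congr (pow_succ v b).symm

open Classical in
/-- The result of `k` steps of a linear search, starting at `1`. -/
noncomputable def leastFrom (Q : ℕ → Prop) : ℕ → ℕ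
  | 0 => 1
  | k + 1 => leastFrom Q k + if Q (leastFrom Q k) then 0 else 1

theorem leastFrom_pos (Q : ℕ → Prop) (k : ℕ) : 1 ≤ leastFrom Q k := by
  induction k with
  | zero => exact le_rfl
  | succ k ih => exact ih.trans (Nat.le_add_right _ _)

theorem leastFrom_le (Q : ℕ → Prop) (k : ℕ) : leastFrom Q k ≤ k + 1 := by
  induction k with
  | zero => exact le_rfl
  | succ k ih => simp only [leastFrom]; split_ifs <;> omega

theorem leastFrom_spec {Q : ℕ → Prop} {N : ℕ} (hN : 1 ≤ N) (hQ : Q N)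
    (hmono : ∀ i j, i ≤ j → Q i → Q j) :
    Q (leastFrom Q N) ∧ leastFrom Q N ≤ N ∧ (leastFrom Q N = 1 ∨ ¬ Q (leastFrom Q N - 1)) := by
  have key : ∀ k, (leastFrom Q k = 1 ∨ ¬ Q (leastFrom Q k - 1)) ∧
      (Q (leastFrom Q k) ∨ leastFrom Q k = k + 1) := by
    intro k
    induction k with
    | zero => exact ⟨Or.inl rfl, Or.inr rfl⟩
    | succ k ih =>
      by_cases h : Q (leastFrom Q k)
      · simp only [leastFrom, h, if_true, add_zero, true_or, and_true]
        exact ih.1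
      · simp only [leastFrom, h, if_false, Nat.add_sub_cancel, not_false_eq_true, or_true, true_and]
        rcases ih.2 with h' | h'
        · exact absurd h' h
        · exact Or.inr (by rw [h'])
  have hle : leastFrom Q N ≤ N := by
    rcases (key N).1 with h | h
    · omega
    · by_contra hlt
      exact h (hmono N _ (by omega) hQ)
  refine ⟨?_, hle, (key N).1⟩
  rcases (key N).2 with h | h
  · exact h
  · omega

/-- Increase variable `r` until `e < f` fails, at most as many times as variable `1` says. -/
def Prog.search (r : ℕ) (e f : Expr) : Prog :=
  .seq (.assign r 1) (.for 12 1 (.assign r (.var r + .lt e f)))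

theorem Triple.search {inp : List ℤ} {g : Ghost} {r N : ℕ} {e f : Expr} {u : ℕ → ℕ} {v : ℕ}
    (hr : r ≠ 1 ∧ r ≠ 12) (hN : g.env 1 = N) (hw : N < 2 ^ w) (h12 : g.env 12 = 0)
    (he : ∀ (E : ℕ → ℤ) (i : ℕ), (∀ x, x ≠ 12 → x ≠ r → E x = g.env x) → E r = i →
      Evals w inp E e (u i))
    (hf : ∀ E : ℕ → ℤ, (∀ x, x ≠ 12 → x ≠ r → E x = g.env x) → Evals w inp E f v)
    (hu : ∀ i ≤ N, u i < 2 ^ w) (hv : v < 2 ^ w) :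
    Triple w inp (.search r e f) g (g.set r (leastFrom (fun i => v ≤ u i) N))
      ((e.cost + f.cost + 15) * (N + 1)) := by
  have h0 : Triple w inp (.assign r 1) g (g.set r (1 : ℕ)) 2 :=
    Triple.assign_of_evals PolyCode.evals_one
  have h1 := Triple.for (w := w) (inp := inp) (i := 12) (b := 1) (n := N)
    (body := .assign r (.var r + .lt e f)) (t := e.cost + f.cost + 4)
    (B := fun k => g.set r (leastFrom (fun i => v ≤ u i) k)) (by norm_num) hw
    (fun k _ => by rw [Ghost.set_env_of_ne _ _ hr.1.symm, hN]) ?_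
  · have e12 : (g.set r (leastFrom (fun i => v ≤ u i) N)).env 12 = 0 := by
      rw [Ghost.set_env_of_ne _ _ hr.2.symm, h12]
    rw [Ghost.set_eq_self e12] at h1
    refine (h0.seq h1).mono ?_
    nlinarith
  · intro k hk
    set l := leastFrom (fun i => v ≤ u i) k with hl
    have hlN : l ≤ N := (leastFrom_le _ k).trans hk
    set G := (g.set r l).set 12 k with hG
    have Er : G.env r = l := by simp [hG, Ghost.set, hr.2]
    have Ex : ∀ x, x ≠ 12 → x ≠ r → G.env x = g.env x := fun x h12 hxr => by
      simp [hG, Ghost.set, h12, hxr]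
    have ev := he G.env l Ex Er
    have fv := hf G.env Ex
    have hlt : Evals w inp G.env (.lt e f) (if (u l : ℤ) < v then 1 else 0) := by
      refine ⟨⟨⟨ev.1, fv.1⟩, ?_, ?_⟩, by simp only [Expr.eval, ev.2, fv.2]⟩
      · rw [ev.2]; exact ⟨by positivity, by exact_mod_cast hu l hlN⟩
      · rw [fv.2]; exact ⟨by positivity, by exact_mod_cast hv⟩
    have hstep := Triple.assign_of_evals (r := r) ((Evals.var Er).add hlt)
    have hgoal : (g.set r (leastFrom (fun i => v ≤ u i) (k + 1))).set 12 k =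
        G.set r (l + if (u l : ℤ) < v then 1 else 0) := by
      have : ((leastFrom (fun i => v ≤ u i) (k + 1) : ℕ) : ℤ) =
          l + if (u l : ℤ) < v then 1 else 0 := by
        simp only [leastFrom, ← hl, Nat.cast_lt]
        by_cases h : v ≤ u l
        · rw [if_pos h, if_neg (by omega)]; simp
        · rw [if_neg h, if_pos (by omega)]; simp
      rw [this, hG]
      simp only [Ghost.set, Function.update_comm hr.2, Function.update_idem]
    rw [hgoal]
    refine hstep.mono ?_
    show (1 + (e.cost + (f.cost + 1) + 1)) + 1 ≤ _
    omega

/-- The input of the reduction. -/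
structure SumInput where
  l : List ℕ
  N : ℕ
  N_pos : 0 < N
  head : l.getD 0 0 = N
  pos : ∀ i < N, 1 ≤ l.getD (1 + i) 0
  inj₁ : Set.InjOn (fun i => l.getD (1 + i) 0) (Set.Iio N)
  inj₂ : Set.InjOn (fun i => l.getD (1 + N + i) 0) (Set.Iio N)
  inj₃ : Set.InjOn (fun i => l.getD (1 + 2 * N + i) 0) (Set.Iio N)

/-- Any upper bound for the entries can serve as V; the sum of the input is found in one pass
without comparing entries. -/
theorem getD_le_sum (l : List ℕ) (i : ℕ) : l.getD i 0 ≤ l.sum := by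
  rcases lt_or_ge i l.length with h | h
  · rw [List.getD_eq_getElem _ _ h]
    exact List.le_sum_of_mem (List.getElem_mem h)
  · rw [List.getD_eq_default _ _ h]
    exact Nat.zero_le _

namespace SumInput

variable (I : SumInput)

/-- The `r`-th piece of length `m` of a list that starts after position `p`. -/
def piece (p m r j : ℕ) : ℕ := I.l.getD (1 + p + if r * m + j < I.N then r * m + j else 0) 0

/-- The instance of the sum problem for two pieces of the fourth and fifth list. -/
def data (m : ℕ) (hm : 0 < m) (r₁ r₂ : ℕ) : SumData where
  n := I.N
  m := m
  V := I.l.sum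
  X₁ i := I.l.getD (1 + i) 0
  X₂ i := I.l.getD (1 + I.N + i) 0
  X₃ i := I.l.getD (1 + 2 * I.N + i) 0
  Y₁ j := I.piece (3 * I.N) m r₁ j
  Y₂ j := I.piece (4 * I.N) m r₂ j
  n_pos := I.N_pos
  m_pos := hm
  X₁_pos := I.pos
  X₁_le _ _ := getD_le_sum _ _
  X₂_le _ _ := getD_le_sum _ _
  X₃_le _ _ := getD_le_sum _ _
  Y₁_le _ _ := getD_le_sum _ _
  Y₂_le _ _ := getD_le_sum _ _
  X₁_inj := I.inj₁
  X₂_inj := I.inj₂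
  X₃_inj := I.inj₃

/-- The input string. -/
def enc : List ℤ := I.l.map (fun a : ℕ => (a : ℤ))

theorem getD_enc (i : ℕ) : I.enc.getD i 0 = (I.l.getD i 0 : ℕ) := by
  rcases lt_or_ge i I.l.length with h | h
  · rw [List.getD_eq_getElem _ _ h, List.getD_eq_getElem _ _ (by simpa [enc] using h)]
    simp [enc]
  · rw [List.getD_eq_default _ _ h, List.getD_eq_default _ _ (by simpa [enc] using h)]
    rfl

end SumInput

end Search

/-! ### Computing the parameters in linear time -/

section Parameters

open PolyCode

section Time

variable {w : ℕ} {inp : List ℤ} {g g' g'' : Ghost} {p p' : Prog} {K K' N : ℕ}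

theorem Triple.seq_mul (h : Triple w inp p g g' (K * N)) (h' : Triple w inp p' g' g'' (K' * N)) :
    Triple w inp (.seq p p') g g'' ((K + K') * N) := by
  rw [add_mul]
  exact h.seq h'

theorem Triple.assign_mul (hN : 0 < N) {r : ℕ} {e : Expr} {v : ℤ} (h : Evals w inp g.env e v) :
    Triple w inp (.assign r e) g (g.set r v) ((e.cost + 1) * N) :=
  (Triple.assign_of_evals h).mono (Nat.le_mul_of_pos_right _ hN)

end Time

theorem Evals.const {w : ℕ} {inp : List ℤ} {E : ℕ → ℤ} (c : ℕ) : Evals w inp E (.const c) c :=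
  ⟨trivial, rfl⟩

namespace SumInput

variable (I : SumInput)

/-- The length of the pieces into which the lists `Y` are divided, about `N ^ (a / b)`. -/
noncomputable def m (a b : ℕ) : ℕ := leastFrom (fun i => I.N ^ a ≤ i ^ b) I.N

/-- The number of pieces that are used. -/
noncomputable def R (a b lim : ℕ) : ℕ := leastFrom (fun i => lim ≤ i * I.m a b) I.N

theorem m_pos (a b : ℕ) : 0 < I.m a b := leastFrom_pos _ _

theorem m_spec {a b : ℕ} (hab : a ≤ b) : I.N ^ a ≤ I.m a b ^ b ∧ I.m a b ≤ I.N ∧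
    (I.m a b = 1 ∨ (I.m a b - 1) ^ b < I.N ^ a) := by
  have h := leastFrom_spec (Q := fun i => I.N ^ a ≤ i ^ b) I.N_pos
    (Nat.pow_le_pow_right I.N_pos hab) (fun i j hij h => h.trans (Nat.pow_le_pow_left hij b))
  rw [not_le] at h
  exact h

theorem m_le {a b : ℕ} (hab : a ≤ b) : I.m a b ≤ I.N := (I.m_spec hab).2.1

theorem R_spec (a b : ℕ) {lim : ℕ} (hlim : lim ≤ I.N) : lim ≤ I.R a b lim * I.m a b ∧
    I.R a b lim ≤ I.N ∧ (I.R a b lim = 1 ∨ (I.R a b lim - 1) * I.m a b < lim) := by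
  have h := leastFrom_spec (Q := fun i => lim ≤ i * I.m a b) I.N_pos
    (hlim.trans (Nat.le_mul_of_pos_right _ (I.m_pos a b)))
    (fun i j hij h => h.trans (Nat.mul_le_mul_right _ hij))
  rw [not_le] at h
  exact h

/-- The instance of the sum problem for two pieces. -/
noncomputable def inst (a b r₁ r₂ : ℕ) : SumData := I.data (I.m a b) (I.m_pos a b) r₁ r₂

/-- The word length suffices for the computation of the parameters. -/
structure Fits (w a b : ℕ) : Prop where
  N : 1 + 5 * I.N < 2 ^ w
  length : I.l.length < 2 ^ w
  pow₁ : I.N ^ a < 2 ^ w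
  pow₂ : I.N ^ b < 2 ^ w
  sq : I.N * I.N < 2 ^ w

/-- The memory after the parameters are computed. -/
noncomputable def params (a b lim : ℕ) : Ghost :=
  (((((((((((((Ghost.mk (fun _ => 0) [] 0).set 1 I.N).set 13 1).set 14 (2 * I.N : ℕ)).set 16
    I.l.length).set 3 I.l.sum).set 2 (I.m a b)).set 9 (I.R a b lim)).set 15 (3 * I.m a b : ℕ)).set 4
      (I.inst a b 0 0).W).set 5 (I.inst a b 0 0).M).set 6 (I.inst a b 0 0).H).set 7
        (I.inst a b 0 0).D).set 8 (I.inst a b 0 0).L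

end SumInput

/-- The program that computes the parameters. -/
def Prog.params (k a b : ℕ) (lim : Expr) : Prog :=
  .seq (.assign 1 (.read 0)) <| .seq (.assign 13 1) <| .seq (.assign 14 (2 * .var 1)) <|
  .seq (.assign 16 (.const k * .var 1 + 1)) <|
  .seq (.for 12 16 (.assign 3 (.var 3 + .read (.var 12)))) <|
  .seq (.search 2 ((Expr.var 2).pow b) ((Expr.var 1).pow a)) <|
  .seq (.search 9 (.var 9 * .var 2) lim) <| .seq (.assign 15 (3 * .var 2)) <|
  .seq (.assign 4 (200 * (.var 1 * .var 1))) <|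
  .seq (.assign 5 (32 * .var 4 * (.var 3 + 1))) <|
  .seq (.assign 6 (4 * .var 1 * (.var 2 + 1) * .var 5)) <|
  .seq (.assign 7 (2 * .var 6)) (.assign 8 ((2 * .var 1 + 4) * .var 7))

theorem triple_sum {w : ℕ} (I : SumInput) {g : Ghost} (h3 : g.env 3 = 0) (h12 : g.env 12 = 0)
    (h16 : g.env 16 = I.l.length) (hw : I.l.length < 2 ^ w) :
    Triple w I.enc (.for 12 16 (.assign 3 (.var 3 + .read (.var 12)))) g (g.set 3 I.l.sum)
      (I.l.length * 13 + 8) := by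
  have h := Triple.for (w := w) (inp := I.enc) (i := 12) (b := 16) (n := I.l.length)
    (body := .assign 3 (.var 3 + .read (.var 12))) (t := 5)
    (B := fun k => g.set 3 ((I.l.take k).sum : ℕ)) (by norm_num) hw
    (fun k _ => by rw [Ghost.set_env_of_ne _ _ (by norm_num), h16]) ?_
  · have e12 : (g.set 3 ((I.l.take I.l.length).sum : ℕ)).env 12 = 0 := by
      rw [Ghost.set_env_of_ne _ _ (by norm_num), h12]
    rw [Ghost.set_eq_self e12, List.take_length] at h
    have e3 : g.set 3 ((I.l.take 0).sum : ℕ) = g := Ghost.set_eq_self (by simp [h3])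
    simp only [e3] at h
    exact h
  · intro k hk
    have hstep := Triple.assign_of_evals (w := w) (inp := I.enc)
      (g := (g.set 3 ((I.l.take k).sum : ℕ)).set 12 k) (r := 3)
      ((Evals.var (r := 3) (v := ((I.l.take k).sum : ℕ)) (by simp [Ghost.set])).add
        (Evals.read (k := k) (.var (r := 12) (by simp [Ghost.set])) (by omega)))
    have hsum : ((I.l.take (k + 1)).sum : ℤ) = (I.l.take k).sum + I.enc.getD k 0 := by
      rw [I.getD_enc, List.getD_eq_getElem _ _ hk, List.sum_take_succ _ _ hk]
      push_cast; rfl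
    have hgoal : (g.set 3 ((I.l.take (k + 1)).sum : ℕ)).set 12 k =
        ((g.set 3 ((I.l.take k).sum : ℕ)).set 12 k).set 3
          ((I.l.take k).sum + I.enc.getD k 0) := by
      rw [hsum]
      simp only [Ghost.set, Function.update_comm (by norm_num : (3 : ℕ) ≠ 12), Function.update_idem]
    rw [hgoal]
    exact hstep

/-- The constant depends on the program text only; word length and input are quantified after it. -/
theorem exists_triple_params {k a b : ℕ} (hab : a ≤ b) (lim : Expr) :
    ∃ K : ℕ, ∀ (w : ℕ) (I : SumInput) (l : ℕ),
    I.l.length = k * I.N + 1 → I.Fits w a b → l ≤ I.N →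
    (∀ E : ℕ → ℤ, E 1 = I.N → Evals w I.enc E lim l) →
    Triple w I.enc (.params k a b lim) ⟨fun _ => 0, [], 0⟩ (I.params a b l) (K * I.N) := by
  refine ⟨((Expr.read 0).cost + 1) + (((1 : Expr).cost + 1) + (((2 * .var 1 : Expr).cost + 1) +
    (((.const k * .var 1 + 1 : Expr).cost + 1) + (((k + 1) * 13 + 8) +
    ((((Expr.var 2).pow b).cost + ((Expr.var 1).pow a).cost + 15) * 2 +
    (((.var 9 * .var 2 : Expr).cost + lim.cost + 15) * 2 + (((3 * .var 2 : Expr).cost + 1) +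
    (((200 * (.var 1 * .var 1) : Expr).cost + 1) + (((32 * .var 4 * (.var 3 + 1) : Expr).cost + 1) +
    (((4 * .var 1 * (.var 2 + 1) * .var 5 : Expr).cost + 1) + (((2 * .var 6 : Expr).cost + 1) +
    (((2 * .var 1 + 4) * .var 7 : Expr).cost + 1)))))))))))), fun w I l hlen hw hl hlim => ?_⟩
  have hN := I.N_pos
  have hwN := hw.N
  have hread : Evals w I.enc (fun _ => 0) (.read 0) I.N := by
    have := (Evals.read (w := w) (inp := I.enc) (E := fun _ => 0) (k := 0) evals_zero (by omega))
    rwa [I.getD_enc, I.head] at this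
  refine Triple.seq_mul (Triple.assign_mul hN hread) ?_
  refine Triple.seq_mul (Triple.assign_mul hN evals_one) ?_
  refine Triple.seq_mul (Triple.assign_mul (v := (2 * I.N : ℕ)) hN
    (((Evals.num 2).mul (.var (v := I.N) (by simp [Ghost.set]))).congr (by push_cast; rfl))) ?_
  refine Triple.seq_mul (Triple.assign_mul (v := I.l.length) hN
    ((((Evals.const k).mul (.var (v := I.N) (by simp [Ghost.set]))).add evals_one).congr
      (by rw [hlen]; push_cast; rfl))) ?_
  refine Triple.seq_mul (K := (k + 1) * 13 + 8) ((triple_sum I (by simp [Ghost.set])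
    (by simp [Ghost.set]) (by simp [Ghost.set]) hw.length).mono (by rw [hlen]; nlinarith)) ?_
  -- The rational power of N is found by linear search, comparing `b`-th powers with `N ^ a`. The
  -- factor 2 absorbs N + 1 ≤ 2N.
  refine Triple.seq_mul (K := (((Expr.var 2).pow b).cost + ((Expr.var 1).pow a).cost + 15) * 2)
    ((Triple.search (N := I.N) (u := fun i => i ^ b) (v := I.N ^ a) (by norm_num)
      (by simp [Ghost.set]) (by omega) (by simp [Ghost.set])
      (fun E i _ hE => ((Evals.var hE).pow b).congr (by push_cast; rfl))
      (fun E hE => ((Evals.var (v := I.N) (by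
        rw [hE 1 (by norm_num) (by norm_num)]; simp [Ghost.set])).pow a).congr (by push_cast; rfl))
      (fun i hi => (Nat.pow_le_pow_left hi b).trans_lt hw.pow₂) hw.pow₁).mono
        (by nlinarith)) ?_
  have hm : I.m a b ≤ I.N := I.m_le hab
  refine Triple.seq_mul (K := ((.var 9 * .var 2 : Expr).cost + lim.cost + 15) * 2)
    ((Triple.search (N := I.N) (u := fun i => i * I.m a b) (v := l) (by norm_num)
      (by simp [Ghost.set]) (by omega) (by simp [Ghost.set])
      (fun E i hx hE => ((Evals.var hE).mul (.var (v := I.m a b) (by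
        rw [hx 2 (by norm_num) (by norm_num)]; simp [Ghost.set, SumInput.m]))).congr
          (by push_cast; rfl))
      (fun E hE => hlim E (by rw [hE 1 (by norm_num) (by norm_num)]; simp [Ghost.set]))
      (fun i hi => (Nat.mul_le_mul hi hm).trans_lt hw.sq) (by omega)).mono
        (by nlinarith)) ?_
  refine Triple.seq_mul (Triple.assign_mul (v := (3 * I.m a b : ℕ)) hN
    (((Evals.num 3).mul (.var (v := I.m a b) (by simp [Ghost.set, SumInput.m]))).congr
      (by push_cast; rfl))) ?_
  refine Triple.seq_mul (Triple.assign_mul (v := (I.inst a b 0 0).W) hN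
    ((Evals.num 200).mul ((Evals.var (v := I.N) (by simp [Ghost.set])).mul
      (.var (v := I.N) (by simp [Ghost.set]))))) ?_
  refine Triple.seq_mul (Triple.assign_mul (v := (I.inst a b 0 0).M) hN
    (((Evals.num 32).mul (.var (v := (I.inst a b 0 0).W) (by simp [Ghost.set]))).mul
      ((Evals.var (v := I.l.sum) (by simp [Ghost.set])).add evals_one))) ?_
  refine Triple.seq_mul (Triple.assign_mul (v := (I.inst a b 0 0).H) hN
    ((((Evals.num 4).mul (.var (v := I.N) (by simp [Ghost.set]))).mul
      ((Evals.var (v := I.m a b) (by simp [Ghost.set, SumInput.m])).add evals_one)).mul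
        (.var (v := (I.inst a b 0 0).M) (by simp [Ghost.set])))) ?_
  refine Triple.seq_mul (Triple.assign_mul (v := (I.inst a b 0 0).D) hN
    ((Evals.num 2).mul (.var (v := (I.inst a b 0 0).H) (by simp [Ghost.set])))) ?_
  exact Triple.assign_mul (v := (I.inst a b 0 0).L) hN
    ((((Evals.num 2).mul (.var (v := I.N) (by simp [Ghost.set]))).add (.num 4)).mul
      (.var (v := (I.inst a b 0 0).D) (by simp [Ghost.set])))

end Parameters

/-! ### The loop over all pairs of pieces -/

section Reduction

open PolyCode

/-- The reduction: compute the parameters and run `p` on the polygon overlap instances for all pairs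
of pieces. -/
def Prog.reduction (p : Prog) (k a b : ℕ) (lim : Expr) : Prog :=
  .seq (.params k a b lim) (.for 10 9 (.for 11 9 (.seq (.pieces 12 overlap) (.query p 0))))

namespace SumInput

variable (I : SumInput) {w a b l : ℕ}

theorem mul_m_le {r : ℕ} (hl : l ≤ I.N) (hr : r < I.R a b l) : r * I.m a b ≤ I.N := by
  rcases (I.R_spec a b hl).2.2 with h | h
  · rw [h, Nat.lt_one_iff] at hr
    simp [hr]
  · exact (Nat.mul_le_mul_right _ (by omega)).trans (h.le.trans hl)

/-- The values of the variables during the loop over the pairs of pieces. -/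
noncomputable def loopEnv (a b l : ℕ) (v r₁ r₂ : ℤ) : ℕ → ℤ :=
  Function.update (Function.update (Function.update (I.params a b l).env 0 v) 10 r₁) 11 r₂

theorem represents (hab : a ≤ b) (hw : I.Fits w a b) (hl : l ≤ I.N) (v : ℤ) {r₁ r₂ : ℕ}
    (h₁ : r₁ < I.R a b l) (h₂ : r₂ < I.R a b l) :
    Represents w I.enc (I.loopEnv a b l v r₁ r₂) (I.inst a b r₁ r₂) r₁ r₂ := by
  have hm := I.m_le hab
  have hN := hw.N
  have e₁ := I.mul_m_le hl h₁
  have e₂ := I.mul_m_le hl h₂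
  refine ⟨?_, ?_, ?_, ?_, ?_, ?_, ?_, ?_, ?_, ?_, ?_, ?_, ?_, fun i => I.getD_enc _,
    fun i => I.getD_enc _, fun i => I.getD_enc _, fun i => I.getD_enc _, fun i => I.getD_enc _,
    hN, ?_, ?_⟩
  · simp [loopEnv, params, Ghost.set]; rfl
  · simp [loopEnv, params, Ghost.set]; rfl
  · simp [loopEnv, params, Ghost.set, -Nat.cast_list_sum]; rfl
  · simp [loopEnv, params, Ghost.set]; rfl
  · simp [loopEnv, params, Ghost.set]; rfl
  · simp [loopEnv, params, Ghost.set]; rfl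
  · simp [loopEnv, params, Ghost.set]; rfl
  · simp [loopEnv, params, Ghost.set]; rfl
  · simp [loopEnv, params, Ghost.set]
  · simp [loopEnv, params, Ghost.set]
  · simp [loopEnv, params, Ghost.set]
  · simp [loopEnv, params, Ghost.set]; rfl
  · simp [loopEnv, params, Ghost.set]; rfl
  · show r₁ * I.m a b + 3 * I.m a b < _
    omega
  · show r₂ * I.m a b + 3 * I.m a b < _
    omega

theorem loopEnv_update_zero (a b l : ℕ) (v v' r₁ r₂ : ℤ) :
    Function.update (I.loopEnv a b l v r₁ r₂) 0 v' = I.loopEnv a b l v' r₁ r₂ := by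
  simp only [loopEnv, Function.update_comm (by norm_num : (11 : ℕ) ≠ 0),
    Function.update_comm (by norm_num : (10 : ℕ) ≠ 0), Function.update_idem]

theorem loopEnv_update_right (a b l : ℕ) (v r₁ r₂ r : ℤ) :
    Function.update (I.loopEnv a b l v r₁ r₂) 11 r = I.loopEnv a b l v r₁ r := by
  simp only [loopEnv, Function.update_idem]

theorem loopEnv_update_left (a b l : ℕ) (v r₁ r₂ r : ℤ) :
    Function.update (I.loopEnv a b l v r₁ r₂) 10 r = I.loopEnv a b l v r r₂ := by
  simp only [loopEnv, Function.update_comm (by norm_num : (11 : ℕ) ≠ 10), Function.update_idem]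

theorem loopEnv_zero (a b l : ℕ) : I.loopEnv a b l 0 0 0 = (I.params a b l).env := by
  simp only [loopEnv]
  rw [Function.update_eq_self_iff.2, Function.update_eq_self_iff.2, Function.update_eq_self_iff.2] <;>
    simp [params, Ghost.set]

theorem loopEnv_nine (a b l : ℕ) (v r₁ r₂ : ℤ) : I.loopEnv a b l v r₁ r₂ 9 = I.R a b l := by
  simp [loopEnv, params, Ghost.set]

theorem loopEnv_twelve (a b l : ℕ) (v r₁ r₂ : ℤ) : I.loopEnv a b l v r₁ r₂ 12 = 0 := by
  simp [loopEnv, params, Ghost.set]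

-- Variable `0` accumulates the disjunction of the answers. The time stamp equals the number of
-- queries made so far; it stays at most N², which fits into a word.
open Classical in
theorem triple_loop (p : Prog) {T : ℕ} (hab : a ≤ b) (hw : I.Fits w a b) (hl : l ≤ I.N)
    (hlen : ∀ r₁ r₂, (I.inst a b r₁ r₂).overlapInstance.enc.length ≤ 2 ^ w)
    (hp : ∀ r₁ r₂, ∃ (s : RamState w) (t : ℕ),
      Exec p (RamState.init w (I.inst a b r₁ r₂).overlapInstance.enc) s t ∧ t ≤ T ∧
        (s.reg 0 ≠ 0 ↔ (I.inst a b r₁ r₂).overlapInstance.HasOverlap)) :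
    ∃ cur, Triple w I.enc (.for 10 9 (.for 11 9 (.seq (.pieces 12 overlap) (.query p 0))))
      (I.params a b l) ⟨I.loopEnv a b l (if ∃ r₁ < I.R a b l, ∃ r₂ < I.R a b l,
        (I.inst a b r₁ r₂).overlapInstance.HasOverlap then 1 else 0) 0 0, [], cur⟩
      (I.R a b l * (I.R a b l * (piecesCost overlap * (3 * I.N) + (p.regBound + 4 * T + 8) + 8) + 8
        + 8) + 8) := by
  set R := I.R a b l with hR
  set ans := fun r₁ r₂ => (I.inst a b r₁ r₂).overlapInstance.HasOverlap with hans
  have hRN : R ≤ I.N := (I.R_spec a b hl).2.1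
  have hRw : R < 2 ^ w := by have := hw.N; omega
  have hsq : R * R ≤ I.N * I.N := Nat.mul_le_mul hRN hRN
  have hwsq := hw.sq
  have inner : ∀ r₁ < R, Triple w I.enc (.for 11 9 (.seq (.pieces 12 overlap) (.query p 0)))
      ⟨I.loopEnv a b l (if ∃ r < r₁, ∃ r₂ < R, ans r r₂ then 1 else 0) r₁ 0, [], r₁ * R⟩
      ⟨I.loopEnv a b l (if ∃ r < r₁ + 1, ∃ r₂ < R, ans r r₂ then 1 else 0) r₁ 0, [], (r₁ + 1) * R⟩
      (R * (piecesCost overlap * (3 * I.N) + (p.regBound + 4 * T + 8) + 8) + 8) := by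
    intro r₁ h₁
    have h := Triple.for (w := w) (inp := I.enc) (i := 11) (b := 9) (n := R)
      (body := .seq (.pieces 12 overlap) (.query p 0))
      (t := piecesCost overlap * (3 * I.N) + (p.regBound + 4 * T + 8))
      (B := fun r₂ => ⟨I.loopEnv a b l (if (∃ r < r₁, ∃ r₂ < R, ans r r₂) ∨ ∃ r < r₂, ans r₁ r
        then 1 else 0) r₁ 0, [], r₁ * R + r₂⟩) (by norm_num) hRw
      (fun r₂ _ => by simp only [loopEnv_nine, hR]) ?_
    · simp only [Ghost.set, loopEnv_update_right] at h
      have e1 : ((∃ r < r₁, ∃ r₂ < R, ans r r₂) ∨ ∃ r < 0, ans r₁ r) ↔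
          ∃ r < r₁, ∃ r₂ < R, ans r r₂ := by simp
      have e2 : ((∃ r < r₁, ∃ r₂ < R, ans r r₂) ∨ ∃ r < R, ans r₁ r) ↔
          ∃ r < r₁ + 1, ∃ r₂ < R, ans r r₂ := by
        constructor
        · rintro (⟨r, hr, h'⟩ | h')
          · exact ⟨r, by omega, h'⟩
          · exact ⟨r₁, by omega, h'⟩
        · rintro ⟨r, hr, h'⟩
          rcases Nat.lt_succ_iff_lt_or_eq.1 hr with hr | rfl
          · exact Or.inl ⟨r, hr, h'⟩
          · exact Or.inr h'
      simp only [e1, e2] at h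
      rw [add_one_mul]
      exact h
    · intro r₂ h₂
      simp only [Ghost.set, loopEnv_update_right]
      have hlt : r₁ * R + r₂ + 1 < 2 ^ w := by
        have : (r₁ + 1) * R ≤ R * R := Nat.mul_le_mul_right _ h₁
        rw [add_one_mul] at this
        omega
      set v : ℤ := if (∃ r < r₁, ∃ r₂ < R, ans r r₂) ∨ ∃ r < r₂, ans r₁ r then 1 else 0 with hv
      have hpieces := triple_overlap (g := ⟨I.loopEnv a b l v r₁ r₂, [], r₁ * R + r₂⟩)
        (I.represents hab hw hl v h₁ h₂) (I.m_le hab) rfl (I.loopEnv_twelve a b l v r₁ r₂) (hlen r₁ r₂)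
      have hquery := Triple.query (w := w) (inp := I.enc) (g := ⟨I.loopEnv a b l v r₁ r₂,
        (I.inst a b r₁ r₂).overlapInstance.enc, r₁ * R + r₂⟩) 0 (hp r₁ r₂) hlt
      have h := hpieces.seq hquery
      simp only [loopEnv_update_zero] at h
      have hval : (if ans r₁ r₂ then 1 else I.loopEnv a b l v r₁ r₂ 0) =
          if (∃ r < r₁, ∃ r₂ < R, ans r r₂) ∨ ∃ r < r₂ + 1, ans r₁ r then 1 else 0 := by
        have e0 : I.loopEnv a b l v r₁ r₂ 0 = v := by simp [loopEnv]
        rw [e0, hv]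
        by_cases ha : ans r₁ r₂
        · rw [if_pos ha, if_pos (Or.inr ⟨r₂, by omega, ha⟩)]
        · rw [if_neg ha]
          have : (∃ r < r₂ + 1, ans r₁ r) ↔ ∃ r < r₂, ans r₁ r := by
            constructor
            · rintro ⟨r, hr, h'⟩
              rcases Nat.lt_succ_iff_lt_or_eq.1 hr with hr | rfl
              · exact ⟨r, hr, h'⟩
              · exact absurd h' ha
            · rintro ⟨r, hr, h⟩
              exact ⟨r, by omega, h⟩
          simp only [this]
      rw [hval] at h
      exact h
  have h := Triple.for (w := w) (inp := I.enc) (i := 10) (b := 9) (n := R)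
    (body := .for 11 9 (.seq (.pieces 12 overlap) (.query p 0)))
    (t := R * (piecesCost overlap * (3 * I.N) + (p.regBound + 4 * T + 8) + 8) + 8)
    (B := fun r₁ => ⟨I.loopEnv a b l (if ∃ r < r₁, ∃ r₂ < R, ans r r₂ then 1 else 0) 0 0, [],
      r₁ * R⟩) (by norm_num) hRw (fun r₂ _ => by simp only [loopEnv_nine, hR]) ?_
  · refine ⟨R * R, ?_⟩
    simp only [Ghost.set, loopEnv_update_left] at h
    simp only [not_lt_zero, false_and, exists_false, if_false, zero_mul, loopEnv_zero] at h
    exact h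
  · intro r₁ h₁
    simp only [Ghost.set, loopEnv_update_left]
    exact inner r₁ h₁

end SumInput

theorem exists_exec_reduction (p : Prog) {k a b : ℕ} (hab : a ≤ b) (lim : Expr) :
    ∃ K : ℕ, ∀ (w : ℕ) (I : SumInput) (l T : ℕ),
    I.l.length = k * I.N + 1 → I.Fits w a b → l ≤ I.N →
    (∀ E : ℕ → ℤ, E 1 = I.N → Evals w I.enc E lim l) →
    (∀ r₁ r₂, (I.inst a b r₁ r₂).overlapInstance.enc.length ≤ 2 ^ w) →
    (∀ r₁ r₂, ∃ (s : RamState w) (t : ℕ),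
      Exec p (RamState.init w (I.inst a b r₁ r₂).overlapInstance.enc) s t ∧ t ≤ T ∧
        (s.reg 0 ≠ 0 ↔ (I.inst a b r₁ r₂).overlapInstance.HasOverlap)) →
    ∃ (s : RamState w) (t : ℕ), Exec (p.reduction k a b lim) (RamState.init w I.enc) s t ∧
      t ≤ I.R a b l * I.R a b l * (K * I.N + 4 * T) ∧
      (s.reg 0 ≠ 0 ↔ ∃ r₁ < I.R a b l, ∃ r₂ < I.R a b l,
        (I.inst a b r₁ r₂).overlapInstance.HasOverlap) := by
  classical
  obtain ⟨K, hK⟩ := exists_triple_params (k := k) hab lim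
  refine ⟨K + piecesCost overlap * 3 + p.regBound + 40, fun w I l T hlen hw hl hlim hout hp => ?_⟩
  obtain ⟨cur, hloop⟩ := I.triple_loop p hab hw hl hout hp
  obtain ⟨s, t, e, ht, hs⟩ := (hK w I l hlen hw hl hlim).seq hloop _ (holds_init I.enc)
  refine ⟨s, t, e, ht.trans ?_, ?_⟩
  · have hN := I.N_pos
    have hR : 1 ≤ I.R a b l := leastFrom_pos _ _
    generalize I.R a b l = R at hR
    generalize piecesCost overlap = c
    -- There is at least one round and N ≥ 1, so preprocessing and the overheads of the loops are
    -- absorbed into R²N.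
    have h1 : 1 ≤ R * R := Nat.mul_pos hR hR
    have h2 : R ≤ R * R := Nat.le_mul_of_pos_right _ hR
    have h3 : K * I.N ≤ R * R * (K * I.N) := Nat.le_mul_of_pos_left _ h1
    have h4 : R * R * p.regBound ≤ R * R * (p.regBound * I.N) :=
      Nat.mul_le_mul_left _ (Nat.le_mul_of_pos_right _ hN)
    have h5 : R * R ≤ R * R * I.N := Nat.le_mul_of_pos_right _ hN
    calc _ = K * I.N + R * R * (c * 3 * I.N) + R * R * p.regBound + R * R * (4 * T) +
          16 * (R * R) + 16 * R + 8 := by ring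
      _ ≤ R * R * (K * I.N) + R * R * (c * 3 * I.N) + R * R * (p.regBound * I.N) +
          R * R * (4 * T) + 40 * (R * R * I.N) := by omega
      _ = _ := by ring
  · have h0 := hs.vars 0
    rw [mul_zero] at h0
    rw [h0]
    simp only [SumInput.loopEnv]
    rw [Function.update_of_ne (by norm_num), Function.update_of_ne (by norm_num),
      Function.update_self]
    have hw1 : 1 < 2 ^ w := by have := hw.N; omega
    split_ifs with h
    · refine iff_of_true (fun h' => ?_) h
      have := congrArg BitVec.toNat h'
      simp [Nat.mod_eq_of_lt hw1] at this
    · simpa using h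

end Reduction

/-! ## The size of the instances -/

namespace SumData

variable (d : SumData)

theorem scale_le {U : ℕ} (hU : 4 ≤ U) (hn : d.n ≤ U) (hmn : d.m ≤ d.n) (hV : d.V ≤ U ^ 2) :
    3 * d.W * d.H ≤ U ^ 24 ∧ 2 * d.L ≤ U ^ 24 := by
  have hU' : (4 : ℤ) ≤ U := by exact_mod_cast hU
  have hn' : (d.n : ℤ) ≤ U := by exact_mod_cast hn
  have hm' : (d.m : ℤ) ≤ U := by exact_mod_cast hmn.trans hn
  have hV' : (d.V : ℤ) ≤ (U : ℤ) ^ 2 := by exact_mod_cast hV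
  have hW0 := d.W_pos
  have hM0 := d.M_ge
  obtain ⟨hD0, hH0, -⟩ := d.D_pos
  -- As U ≥ 4, numerical constants become powers of U, for example 200 ≤ U⁴ and 32 ≤ U³. The
  -- exponent 24 is generous; only polynomial growth matters.
  have h16 : (16 : ℤ) ≤ (U : ℤ) ^ 2 := by nlinarith
  have h64 : (64 : ℤ) ≤ (U : ℤ) ^ 3 := by nlinarith
  have h256 : (256 : ℤ) ≤ (U : ℤ) ^ 4 := by nlinarith
  have hW : d.W ≤ (U : ℤ) ^ 6 := by
    have h1 : (d.n : ℤ) * d.n ≤ (U : ℤ) ^ 2 := by nlinarith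
    calc d.W = 200 * (d.n * d.n) := rfl
      _ ≤ (U : ℤ) ^ 4 * (U : ℤ) ^ 2 := by gcongr; linarith
      _ = _ := by ring
  have hM : d.M ≤ (U : ℤ) ^ 12 := by
    have h1 : (d.V : ℤ) + 1 ≤ (U : ℤ) ^ 3 := by nlinarith
    calc d.M = 32 * d.W * (d.V + 1) := rfl
      _ ≤ (U : ℤ) ^ 3 * (U : ℤ) ^ 6 * (U : ℤ) ^ 3 := by gcongr; linarith
      _ = _ := by ring
  have hH : d.H ≤ (U : ℤ) ^ 16 := by
    have h1 : 4 * (d.n : ℤ) ≤ (U : ℤ) ^ 2 := by nlinarith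
    have h2 : (d.m : ℤ) + 1 ≤ (U : ℤ) ^ 2 := by nlinarith
    calc d.H = 4 * d.n * (d.m + 1) * d.M := rfl
      _ ≤ (U : ℤ) ^ 2 * (U : ℤ) ^ 2 * (U : ℤ) ^ 12 := by gcongr; linarith
      _ = _ := by ring
  have hL : d.L ≤ (U : ℤ) ^ 19 := by
    have h1 : 2 * (d.n : ℤ) + 4 ≤ (U : ℤ) ^ 2 := by nlinarith
    calc d.L = (2 * d.n + 4) * (2 * d.H) := rfl
      _ ≤ (U : ℤ) ^ 2 * (U * (U : ℤ) ^ 16) := by gcongr; linarith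
      _ = _ := by ring
  have hpow : ∀ i j : ℕ, i ≤ j → (U : ℤ) ^ i ≤ (U : ℤ) ^ j := fun i j h =>
    pow_le_pow_right₀ (by linarith) h
  constructor
  · calc 3 * d.W * d.H ≤ U * (U : ℤ) ^ 6 * (U : ℤ) ^ 16 := by gcongr; linarith
      _ = (U : ℤ) ^ 23 := by ring
      _ ≤ _ := hpow _ _ (by norm_num)
  · calc 2 * d.L ≤ U * (U : ℤ) ^ 19 := mul_le_mul (by linarith) hL (by linarith [d.L_ge]) (by positivity)
      _ = (U : ℤ) ^ 20 := by ring
      _ ≤ _ := hpow _ _ (by norm_num)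

theorem abs_le_of_mem_coords {v : ℤ} (hv : v ∈ coords d.P ++ coords d.Q) :
    -(2 * d.L) ≤ v ∧ v ≤ 2 * d.L := by
  have hn : (1 : ℤ) ≤ d.n := by exact_mod_cast d.n_pos
  have hW := d.W_pos
  have hM := d.M_ge
  have hm := d.mM_nonneg
  have hH := d.H_ge_mM
  have hD : d.D = 2 * d.H := rfl
  have hL : d.L = (2 * d.n + 4) * d.D := rfl
  have hL' : d.L = 2 * (d.n * d.D) + 4 * d.D := by rw [hL]; ring
  have hD0 : 0 ≤ d.D := by linarith
  have hnD : 0 ≤ d.n * d.D := by positivity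
  have hiD : ∀ i : ℕ, 0 ≤ (i : ℤ) * d.D := fun i => by positivity
  rw [P, Q, coords_comb, coords_comb] at hv
  simp only [List.mem_append, List.mem_flatMap, List.mem_range] at hv
  rcases hv with (hv | ⟨i, hi, hv⟩ | hv | ⟨i, hi, hv⟩) | (hv | ⟨j, hj, hv⟩ | hv | ⟨j, hj, hv⟩)
  · revert v
    simp only [coords, List.flatMap_cons, List.flatMap_nil, List.cons_append, List.nil_append,
      List.mem_cons, List.not_mem_nil, or_false, forall_eq_or_imp, forall_eq, Nat.cast_zero,
      zero_mul]
    and_intros <;> linarith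
  · have hh := d.h_ge hi
    have h1 := hiD i
    have h2 : ((i : ℤ) + 1) * d.D ≤ d.n * d.D :=
      mul_le_mul_of_nonneg_right (by exact_mod_cast hi) (by linarith)
    revert v
    simp only [coords, barTooth, List.flatMap_cons, List.flatMap_nil, List.cons_append,
      List.nil_append, List.mem_cons, List.not_mem_nil, or_false, forall_eq_or_imp, forall_eq]
    push_cast
    and_intros <;> linarith
  · have := d.c_ge 0
    have h0 : d.c 0 = d.D := by simp [c]
    revert v
    simp only [coords, List.flatMap_cons, List.flatMap_nil, List.cons_append, List.nil_append,
      List.mem_cons, List.not_mem_nil, or_false, forall_eq_or_imp, forall_eq]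
    and_intros <;> linarith
  · have hx := d.x_ge hi
    have hx' := d.x_le hi
    have hc := d.c_ge i
    have hc' : d.c i ≤ 2 * d.n * d.D :=
      mul_le_mul_of_nonneg_right (by exact_mod_cast hi) (by linarith)
    have hs := d.c_succ i
    revert v
    simp only [coords, sideTooth, List.flatMap_cons, List.flatMap_nil, List.cons_append,
      List.nil_append, List.mem_cons, List.not_mem_nil, or_false, forall_eq_or_imp, forall_eq, hs]
    split_ifs <;> and_intros <;> linarith
  · have ha := d.a_zero_ge
    have ha' := d.a_lt (i := 0) (j := 3 * d.m) (by have := d.m_pos; omega) le_rfl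
    rw [a_last] at ha'
    revert v
    simp only [coords, List.flatMap_cons, List.flatMap_nil, List.cons_append, List.nil_append,
      List.mem_cons, List.not_mem_nil, or_false, forall_eq_or_imp, forall_eq]
    and_intros <;> linarith
  · have ha := d.a_ge hj.le
    have hs := d.a_succ hj
    have hs' : d.a (j + 1) ≤ (3 * d.m + 2) * d.M := by
      rw [← a_last]
      rcases (Nat.succ_le_of_lt hj).eq_or_lt with h | h
      · rw [← h]
      · exact (d.a_lt h le_rfl).le
    revert v
    simp only [coords, upTooth, List.flatMap_cons, List.flatMap_nil, List.cons_append,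
      List.nil_append, List.mem_cons, List.not_mem_nil, or_false, forall_eq_or_imp, forall_eq]
    split_ifs <;> and_intros <;> linarith
  · have ha := d.a_last
    have hg := d.g_zero_ge
    have hg' := d.g_lt d.m_pos le_rfl
    rw [g_m] at hg'
    revert v
    simp only [coords, List.flatMap_cons, List.flatMap_nil, List.cons_append, List.nil_append,
      List.mem_cons, List.not_mem_nil, or_false, forall_eq_or_imp, forall_eq]
    and_intros <;> linarith
  · have hg := d.g_ge hj.le
    have hs := d.g_succ hj
    have hs' : d.g (j + 1) ≤ (d.m + 1) * d.M := by
      rw [← g_m]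
      rcases (Nat.succ_le_of_lt hj).eq_or_lt with h | h
      · rw [← h]
      · exact (d.g_lt h le_rfl).le
    revert v
    simp only [coords, rightTooth, List.flatMap_cons, List.flatMap_nil, List.cons_append,
      List.nil_append, List.mem_cons, List.not_mem_nil, or_false, forall_eq_or_imp, forall_eq]
    and_intros <;> linarith

theorem enc_length : d.overlapInstance.enc.length = 36 * d.n + 32 * d.m + 27 := by
  have hc : ∀ l : List (ℤ × ℤ), (coords l).length = 2 * l.length := fun l => by
    induction l with
    | nil => rfl
    | cons a l ih =>
      simp only [coords, List.flatMap_cons, List.length_append, List.length_cons] at ih ⊢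
      rw [ih]
      simp
      ring
  rw [enc_eq, List.length_append, List.length_append, hc, hc, P_length, Q_length]
  simp
  ring

theorem enc_le {U : ℕ} (hU : 4 ≤ U) (hn : d.n ≤ U) (hmn : d.m ≤ d.n) (hV : d.V ≤ U ^ 2) :
    d.overlapInstance.enc.length ≤ U ^ 24 ∧
      ∀ z ∈ d.overlapInstance.enc, z.natAbs ≤ U ^ 24 := by
  obtain ⟨h1, h2⟩ := d.scale_le hU hn hmn hV
  have hbig : 75 * U + 27 ≤ U ^ 24 := by
    have h16 : 16 ≤ U ^ 2 := by nlinarith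
    have h256 : 256 ≤ U ^ 4 := by nlinarith
    calc 75 * U + 27 ≤ 256 * U := by omega
      _ ≤ U ^ 4 * U := Nat.mul_le_mul_right _ h256
      _ = U ^ 5 := by ring
      _ ≤ U ^ 24 := Nat.pow_le_pow_right (by omega) (by norm_num)
  refine ⟨by rw [enc_length]; omega, fun z hz => ?_⟩
  have hW := d.W_pos
  have hH := d.D_pos.2.1
  have key : ∀ z : ℤ, -((U ^ 24 : ℕ) : ℤ) ≤ z → z ≤ (U ^ 24 : ℕ) → z.natAbs ≤ U ^ 24 := by
    intro z; omega
  rw [enc_eq, List.mem_append] at hz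
  rcases hz with hz | hz
  · simp only [List.mem_cons, List.not_mem_nil, or_false] at hz
    rcases hz with rfl | rfl | rfl
    · omega
    · omega
    · have : 0 ≤ 3 * d.W * d.H := by positivity
      refine key _ ?_ ?_
      · have : 1 ≤ U ^ 24 := Nat.one_le_pow _ _ (by omega)
        omega
      · push_cast; linarith
  · have := d.abs_le_of_mem_coords hz
    refine key _ ?_ ?_ <;> push_cast <;> linarith

end SumData

/-! ## Instances of `k`-SUM as inputs of the reduction -/

theorem getD_flatten {α : Type} {N : ℕ} (z : α) (L : List (List α)) (hL : ∀ l ∈ L, l.length = N)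
    (j : ℕ) {i : ℕ} (hi : i < N) : L.flatten.getD (j * N + i) z = (L.getD j []).getD i z := by
  induction L generalizing j with
  | nil => simp
  | cons l L ih =>
    have hl := hL l (by simp)
    rw [List.flatten_cons]
    cases j with
    | zero => rw [zero_mul, zero_add, List.getD_append _ _ _ _ (by omega)]; rfl
    | succ j =>
      rw [List.getD_append_right _ _ _ _ (by rw [hl]; nlinarith), hl,
        show (j + 1) * N + i - N = j * N + i by rw [add_one_mul]; omega, List.getD_cons_succ]
      exact ih (fun l' hl' => hL l' (by simp [hl'])) j

theorem exists_getD_iff {α : Type} {z a : α} {l : List α} {N : ℕ} (h : l.length = N) :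
    (∃ i < N, l.getD i z = a) ↔ a ∈ l := by
  subst h
  constructor
  · rintro ⟨i, hi, rfl⟩
    rw [List.getD_eq_getElem _ _ hi]
    exact List.getElem_mem hi
  · intro ha
    obtain ⟨i, hi, rfl⟩ := List.getElem_of_mem ha
    exact ⟨i, hi, List.getD_eq_getElem _ _ hi⟩

theorem injOn_getD_of_nodup {α : Type} {z : α} {l : List α} (h : l.Nodup) :
    Set.InjOn (fun i => l.getD i z) (Set.Iio l.length) := by
  intro i hi j hj hij
  simp only [Set.mem_Iio] at hi hj
  simp only [List.getD_eq_getElem _ _ hi, List.getD_eq_getElem _ _ hj] at hij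
  exact (List.Nodup.getElem_inj_iff h).1 hij

namespace KSumInstance

variable {k : ℕ} (x : KSumInstance k)

/-- The input as natural numbers. -/
def natEnc : List ℕ := x.n :: (List.ofFn x.A).flatten

theorem enc_eq : x.enc = x.natEnc.map (fun a : ℕ => (a : ℤ)) := by
  simp [enc, natEnc, List.map_eq_flatMap]

theorem length_of_mem (l : List ℕ) (hl : l ∈ List.ofFn x.A) : l.length = x.n := by
  obtain ⟨j, rfl⟩ := (List.mem_ofFn' _ _).1 hl
  exact x.length_eq j

theorem natEnc_getD (j : ℕ) {i : ℕ} (hi : i < x.n) :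
    x.natEnc.getD (1 + j * x.n + i) 0 = ((List.ofFn x.A).getD j []).getD i 0 := by
  rw [natEnc, add_assoc, add_comm 1, List.getD_cons_succ, getD_flatten 0 _ x.length_of_mem j hi]

theorem natEnc_getD_fin (j : Fin k) {i : ℕ} (hi : i < x.n) :
    x.natEnc.getD (1 + j * x.n + i) 0 = (x.A j).getD i 0 := by
  rw [natEnc_getD _ _ hi, List.getD_eq_getElem (List.ofFn x.A) [] (by simp), List.getElem_ofFn]

/-- Reading past the input yields zero; for k = 3 this provides two lists Y of zeros, and the same
program serves both reductions. -/
theorem natEnc_getD_of_le {j i : ℕ} (hj : k ≤ j) (hi : i < x.n) :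
    x.natEnc.getD (1 + j * x.n + i) 0 = 0 := by
  rw [natEnc_getD _ _ hi, List.getD_eq_default _ [] (by simpa using hj)]
  simp

theorem natEnc_length : x.natEnc.length = k * x.n + 1 := by
  simp [natEnc, List.length_flatten, List.map_ofFn, List.sum_ofFn, x.length_eq]

theorem natEnc_injOn (j : Fin k) :
    Set.InjOn (fun i => x.natEnc.getD (1 + j * x.n + i) 0) (Set.Iio x.n) := by
  intro i hi i' hi' h
  simp only [natEnc_getD_fin _ _ hi, natEnc_getD_fin _ _ hi'] at h
  exact injOn_getD_of_nodup (x.nodup j) (by rwa [x.length_eq j]) (by rwa [x.length_eq j]) h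

/-- The input of the reduction that is given by an instance of `k`-SUM. -/
def sumInput (hk : 3 ≤ k) : SumInput where
  l := x.natEnc
  N := x.n
  N_pos := x.n_pos
  head := rfl
  pos i hi := by
    have h := x.natEnc_getD_fin ⟨0, by omega⟩ hi
    simp only [zero_mul, add_zero] at h
    rw [h]
    exact x.pos _ _ ((exists_getD_iff (x.length_eq _)).1 ⟨i, hi, rfl⟩)
  inj₁ := by simpa using x.natEnc_injOn ⟨0, by omega⟩
  inj₂ := by simpa using x.natEnc_injOn ⟨1, by omega⟩
  inj₃ := by simpa using x.natEnc_injOn ⟨2, by omega⟩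

/-- Division with remainder by the length of a piece locates each entry, since the pieces cover the
list; conversely, padding only repeats entry `0` of the same list. -/
theorem exists_piece_iff (hk : 3 ≤ k) {a b lim p : ℕ} {Q : ℕ → Prop}
    (hR : x.n ≤ (x.sumInput hk).R a b lim * (x.sumInput hk).m a b) :
    (∃ r < (x.sumInput hk).R a b lim, ∃ j < (x.sumInput hk).m a b,
      Q ((x.sumInput hk).piece (p * x.n) ((x.sumInput hk).m a b) r j)) ↔
      ∃ i < x.n, Q (x.natEnc.getD (1 + p * x.n + i) 0) := by
  have hm := (x.sumInput hk).m_pos a b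
  have hn := x.n_pos
  constructor
  · rintro ⟨r, -, j, -, h⟩
    refine ⟨_, ?_, h⟩
    show (if _ < x.n then _ else _) < x.n
    split_ifs with h' <;> assumption
  · rintro ⟨i, hi, h⟩
    refine ⟨i / (x.sumInput hk).m a b, Nat.div_lt_of_lt_mul (by rw [mul_comm]; omega),
      i % (x.sumInput hk).m a b, Nat.mod_lt _ hm, ?_⟩
    have e : i / (x.sumInput hk).m a b * (x.sumInput hk).m a b + i % (x.sumInput hk).m a b = i :=
      Nat.div_add_mod' _ _
    have hi' : i < (x.sumInput hk).N := hi
    simp only [SumInput.piece, e, if_pos hi']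
    exact h

theorem hasOverlap_inst_iff (hk : 3 ≤ k) {a b r₁ r₂ : ℕ} :
    ((x.sumInput hk).inst a b r₁ r₂).overlapInstance.HasOverlap ↔
      ∃ i₁ < x.n, ∃ i₂ < x.n, ∃ i₃ < x.n, ∃ j₁ < (x.sumInput hk).m a b,
        ∃ j₂ < (x.sumInput hk).m a b,
          (x.A ⟨0, by omega⟩).getD i₁ 0 = (x.A ⟨1, by omega⟩).getD i₂ 0 +
            (x.A ⟨2, by omega⟩).getD i₃ 0 +
            (x.sumInput hk).piece (3 * x.n) ((x.sumInput hk).m a b) r₁ j₁ +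
            (x.sumInput hk).piece (4 * x.n) ((x.sumInput hk).m a b) r₂ j₂ := by
  rw [SumData.hasOverlap_iff]
  have h0 : ∀ i < x.n, x.natEnc.getD (1 + i) 0 = (x.A ⟨0, by omega⟩).getD i 0 := fun i hi => by
    simpa using x.natEnc_getD_fin ⟨0, by omega⟩ hi
  have h1 : ∀ i < x.n, x.natEnc.getD (1 + x.n + i) 0 = (x.A ⟨1, by omega⟩).getD i 0 :=
    fun i hi => by simpa using x.natEnc_getD_fin ⟨1, by omega⟩ hi
  have h2 : ∀ i < x.n, x.natEnc.getD (1 + 2 * x.n + i) 0 = (x.A ⟨2, by omega⟩).getD i 0 :=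
    fun i hi => by simpa using x.natEnc_getD_fin ⟨2, by omega⟩ hi
  constructor
  · rintro ⟨i₁, h₁, i₂, h₂, i₃, h₃, j₁, hj₁, j₂, hj₂, h⟩
    exact ⟨i₁, h₁, i₂, h₂, i₃, h₃, j₁, hj₁, j₂, hj₂, by
      rw [← h0 _ h₁, ← h1 _ h₂, ← h2 _ h₃]; exact h⟩
  · rintro ⟨i₁, h₁, i₂, h₂, i₃, h₃, j₁, hj₁, j₂, hj₂, h⟩
    exact ⟨i₁, h₁, i₂, h₂, i₃, h₃, j₁, hj₁, j₂, hj₂, by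
      rw [← h0 _ h₁, ← h1 _ h₂, ← h2 _ h₃] at h; exact h⟩

/-- The pieces cover the fourth and the fifth set, so every choice of two elements occurs in some
pair of pieces. -/
theorem hasSolution_five_iff (x : KSumInstance 5) {a b : ℕ} :
    x.HasSolution ↔ ∃ r₁ < (x.sumInput (by norm_num)).R a b x.n,
      ∃ r₂ < (x.sumInput (by norm_num)).R a b x.n,
        ((x.sumInput (by norm_num)).inst a b r₁ r₂).overlapInstance.HasOverlap := by
  have hk : 3 ≤ 5 := by norm_num
  have hR : x.n ≤ (x.sumInput hk).R a b x.n * (x.sumInput hk).m a b :=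
    ((x.sumInput hk).R_spec a b le_rfl).1
  have e3 : ∀ i < x.n, x.natEnc.getD (1 + 3 * x.n + i) 0 = (x.A 3).getD i 0 :=
    fun i hi => x.natEnc_getD_fin 3 hi
  have e4 : ∀ i < x.n, x.natEnc.getD (1 + 4 * x.n + i) 0 = (x.A 4).getD i 0 :=
    fun i hi => x.natEnc_getD_fin 4 hi
  have hmem : ∀ j a, (∃ i < x.n, (x.A j).getD i 0 = a) ↔ a ∈ x.A j := fun j a =>
    exists_getD_iff (x.length_eq j)
  have hset : (Finset.univ.erase 0 : Finset (Fin 5)) = {1, 2, 3, 4} := by decide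
  simp only [hasOverlap_inst_iff]
  constructor
  · rintro ⟨v, hv, hsum⟩
    rw [hset] at hsum
    simp at hsum
    obtain ⟨i₁, h₁, v₁⟩ := (hmem _ _).2 (hv 0)
    obtain ⟨i₂, h₂, v₂⟩ := (hmem _ _).2 (hv 1)
    obtain ⟨i₃, h₃, v₃⟩ := (hmem _ _).2 (hv 2)
    obtain ⟨i₄, h₄, v₄⟩ := (hmem _ _).2 (hv 3)
    obtain ⟨i₅, h₅, v₅⟩ := (hmem _ _).2 (hv 4)
    obtain ⟨r₁, hr₁, j₁, hj₁, p₁⟩ := (x.exists_piece_iff hk (a := a) (b := b) (p := 3)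
      (Q := fun y => y = v 3) hR).2 ⟨i₄, h₄, by rw [e3 _ h₄]; exact v₄⟩
    obtain ⟨r₂, hr₂, j₂, hj₂, p₂⟩ := (x.exists_piece_iff hk (a := a) (b := b) (p := 4)
      (Q := fun y => y = v 4) hR).2 ⟨i₅, h₅, by rw [e4 _ h₅]; exact v₅⟩
    refine ⟨r₁, hr₁, r₂, hr₂, i₁, h₁, i₂, h₂, i₃, h₃, j₁, hj₁, j₂, hj₂, ?_⟩
    rw [p₁, p₂]
    refine v₁.trans (hsum.trans ?_)
    rw [← v₂, ← v₃]
    simp only [add_assoc]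
    rfl
  · rintro ⟨r₁, hr₁, r₂, hr₂, i₁, h₁, i₂, h₂, i₃, h₃, j₁, hj₁, j₂, hj₂, h⟩
    obtain ⟨i₄, h₄, p₁⟩ := (x.exists_piece_iff hk (a := a) (b := b) (p := 3)
      (Q := fun y => y = (x.sumInput hk).piece (3 * x.n) ((x.sumInput hk).m a b) r₁ j₁) hR).1
        ⟨r₁, hr₁, j₁, hj₁, rfl⟩
    obtain ⟨i₅, h₅, p₂⟩ := (x.exists_piece_iff hk (a := a) (b := b) (p := 4)
      (Q := fun y => y = (x.sumInput hk).piece (4 * x.n) ((x.sumInput hk).m a b) r₂ j₂) hR).1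
        ⟨r₂, hr₂, j₂, hj₂, rfl⟩
    rw [e3 _ h₄] at p₁
    rw [e4 _ h₅] at p₂
    refine ⟨![(x.A 0).getD i₁ 0, (x.A 1).getD i₂ 0, (x.A 2).getD i₃ 0, (x.A 3).getD i₄ 0,
      (x.A 4).getD i₅ 0], fun j => ?_, ?_⟩
    · fin_cases j
      · exact (hmem 0 _).1 ⟨i₁, h₁, rfl⟩
      · exact (hmem 1 _).1 ⟨i₂, h₂, rfl⟩
      · exact (hmem 2 _).1 ⟨i₃, h₃, rfl⟩
      · exact (hmem 3 _).1 ⟨i₄, h₄, rfl⟩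
      · exact (hmem 4 _).1 ⟨i₅, h₅, rfl⟩
    · rw [hset]
      simp [-List.getD_eq_getElem?_getD]
      rw [p₁, p₂]
      refine h.trans ?_
      simp only [add_assoc]
      rfl

/-- All entries of Y are zero, so every pair of pieces encodes the whole instance. -/
theorem hasSolution_three_iff (x : KSumInstance 3) {a b : ℕ} :
    x.HasSolution ↔ ∃ r₁ < (x.sumInput le_rfl).R a b 1, ∃ r₂ < (x.sumInput le_rfl).R a b 1,
        ((x.sumInput le_rfl).inst a b r₁ r₂).overlapInstance.HasOverlap := by
  have hR : 0 < (x.sumInput le_rfl).R a b 1 := leastFrom_pos _ _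
  have hm := (x.sumInput le_rfl).m_pos a b
  have hp : ∀ p, 3 ≤ p → ∀ r j, (x.sumInput le_rfl).piece (p * x.n)
      ((x.sumInput le_rfl).m a b) r j = 0 := by
    intro p hp r j
    refine x.natEnc_getD_of_le hp ?_
    have hn := x.n_pos
    show (if _ < x.n then _ else _) < x.n
    split_ifs with h' <;> assumption
  have hmem : ∀ j a, (∃ i < x.n, (x.A j).getD i 0 = a) ↔ a ∈ x.A j := fun j a =>
    exists_getD_iff (x.length_eq j)
  have hset : (Finset.univ.erase 0 : Finset (Fin 3)) = {1, 2} := by decide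
  simp only [hasOverlap_inst_iff, hp 3 le_rfl, hp 4 (by norm_num), add_zero]
  constructor
  · rintro ⟨v, hv, hsum⟩
    rw [hset] at hsum
    simp at hsum
    obtain ⟨i₁, h₁, v₁⟩ := (hmem _ _).2 (hv 0)
    obtain ⟨i₂, h₂, v₂⟩ := (hmem _ _).2 (hv 1)
    obtain ⟨i₃, h₃, v₃⟩ := (hmem _ _).2 (hv 2)
    refine ⟨0, hR, 0, hR, i₁, h₁, i₂, h₂, i₃, h₃, 0, hm, 0, hm, ?_⟩
    refine v₁.trans (hsum.trans ?_)
    rw [← v₂, ← v₃]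
    rfl
  · rintro ⟨-, -, -, -, i₁, h₁, i₂, h₂, i₃, h₃, -, -, -, -, h⟩
    refine ⟨![(x.A 0).getD i₁ 0, (x.A 1).getD i₂ 0, (x.A 2).getD i₃ 0], fun j => ?_, ?_⟩
    · fin_cases j
      · exact (hmem 0 _).1 ⟨i₁, h₁, rfl⟩
      · exact (hmem 1 _).1 ⟨i₂, h₂, rfl⟩
      · exact (hmem 2 _).1 ⟨i₃, h₃, rfl⟩
    · rw [hset]
      simp
      exact h

end KSumInstance

/-! ## The lower bound -/

theorem SolvableInTime.mono_dom {I : Type} {dom dom' : I → Prop} {enc : I → List ℤ}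
    {ans : I → Prop} {T : I → ℝ} (h : SolvableInTime dom enc ans T) (hd : ∀ x, dom' x → dom x) :
    SolvableInTime dom' enc ans T := by
  obtain ⟨p, c, C, hp⟩ := h
  exact ⟨p, c, C, fun x hx => hp x (hd x hx)⟩

/-- The bound for the instances of the reduction in terms of their parameters. -/
noncomputable def overlapTime (ε : ℝ) (n m : ℕ) : ℝ :=
  max ((18 * n + 6 : ℝ) ^ 2) ((18 * n + 6) * (16 * m + 6) ^ 2) ^ (1 - ε)

theorem overlapTime_nonneg (ε : ℝ) (n m : ℕ) : 0 ≤ overlapTime ε n m :=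
  Real.rpow_nonneg (le_max_of_le_left (by positivity)) _

/-- The part common to both reductions: they differ in `k` and in how much of the lists the pieces
have to cover, and `hT` isolates the comparison of running times. -/
theorem KSumInstance.solvable_of_overlapSolvable {k a b : ℕ} [NeZero k] (hk : 3 ≤ k) (hab : a ≤ b)
    {lim : Expr} {l : ℕ → ℕ} (hl : ∀ n, 0 < n → l n ≤ n)
    (hlim : ∀ (w : ℕ) (inp : List ℤ) (E : ℕ → ℤ) (n : ℕ), E 1 = n → Evals w inp E lim (l n))
    {dom : OverlapInstance → Prop} {ε : ℝ}
    (hdom : ∀ (x : KSumInstance k) (r₁ r₂ : ℕ),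
      dom ((x.sumInput hk).inst a b r₁ r₂).overlapInstance)
    (hans : ∀ x : KSumInstance k, x.HasSolution ↔ ∃ r₁ < (x.sumInput hk).R a b (l x.n),
      ∃ r₂ < (x.sumInput hk).R a b (l x.n),
        ((x.sumInput hk).inst a b r₁ r₂).overlapInstance.HasOverlap)
    {T : KSumInstance k → ℝ}
    (hT : ∀ K C : ℝ, 0 ≤ K → 0 ≤ C → ∃ C' : ℝ, ∀ x : KSumInstance k,
      ((x.sumInput hk).R a b (l x.n) : ℝ) ^ 2 *
        (K * x.n + C * overlapTime ε x.n ((x.sumInput hk).m a b)) ≤ C' * T x)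
    (h : OverlapSolvable dom ε) :
    SolvableInTime (fun _ : KSumInstance k => True) KSumInstance.enc KSumInstance.HasSolution T := by
  obtain ⟨p, c, C, hp⟩ := h
  obtain ⟨K, hK⟩ := exists_exec_reduction p (k := k) hab lim
  -- The factor 4 is the cost of the simulation; the absolute value is needed because the sign of
  -- `C` is not known.
  obtain ⟨C', hC'⟩ := hT K (4 * |C|) (by positivity) (by positivity)
  -- The overlap instances are bounded by `U ^ 24`, so the given algorithm needs `U ^ (24 * c) ≤ 2 ^
  -- w`; the other summands cover the length of the output and the powers of N in the search.
  refine ⟨p.reduction k a b lim, 24 * c + 24 + a + b, C', fun x _ U w hlen habs hw => ?_⟩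
  set I := x.sumInput hk with hI
  have henc : x.enc = I.enc := x.enc_eq
  have hlenI : I.l.length = k * I.N + 1 := x.natEnc_length
  have hlU : I.l.length ≤ U := by
    rw [x.enc_eq, List.length_map] at hlen
    exact hlen
  have hN := I.N_pos
  have h3N : 3 * I.N ≤ k * I.N := Nat.mul_le_mul_right _ hk
  have hU4 : 4 ≤ U := by omega
  have hNU : I.N ≤ U := by omega
  have hpow : ∀ i : ℕ, i ≤ 24 * c + 24 + a + b → U ^ i ≤ 2 ^ w := fun i hi =>
    (Nat.pow_le_pow_right (by omega) hi).trans hw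
  have hpow' : ∀ i : ℕ, i + 1 ≤ 24 * c + 24 + a + b → U ^ i < 2 ^ w := fun i hi =>
    (Nat.pow_lt_pow_succ (by omega)).trans_le (hpow _ hi)
  have hfits : I.Fits w a b := by
    refine ⟨?_, ?_, ?_, ?_, ?_⟩
    · refine lt_of_le_of_lt ?_ (hpow' 3 (by omega))
      have : 16 ≤ U ^ 2 := by nlinarith
      calc 1 + 5 * I.N ≤ 16 * U := by omega
        _ ≤ U ^ 2 * U := Nat.mul_le_mul_right _ this
        _ = U ^ 3 := by ring
    · exact lt_of_le_of_lt (by simpa using hlU) (hpow' 1 (by omega))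
    · exact (Nat.pow_le_pow_left hNU a).trans_lt (hpow' a (by omega))
    · exact (Nat.pow_le_pow_left hNU b).trans_lt (hpow' b (by omega))
    · exact (Nat.mul_le_mul hNU hNU).trans_lt (by rw [← sq]; exact hpow' 2 (by omega))
  have hV : I.l.sum ≤ U ^ 2 := by
    have h1 : ∀ y ∈ I.l, y ≤ U := fun y hy => by
      have := habs y (by rw [x.enc_eq]; exact List.mem_map_of_mem hy)
      simpa using this
    calc I.l.sum ≤ I.l.length • U := List.sum_le_card_nsmul _ _ h1
      _ ≤ U ^ 2 := by rw [smul_eq_mul, sq]; exact Nat.mul_le_mul_right _ hlU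
  have hsize : ∀ r₁ r₂, (I.inst a b r₁ r₂).overlapInstance.enc.length ≤ U ^ 24 ∧
      ∀ z ∈ (I.inst a b r₁ r₂).overlapInstance.enc, z.natAbs ≤ U ^ 24 := fun r₁ r₂ =>
    (I.inst a b r₁ r₂).enc_le hU4 hNU (I.m_le hab) hV
  obtain ⟨s, t, e, ht, hs⟩ := hK w I (l x.n) ⌊|C| * overlapTime ε x.n (I.m a b)⌋₊ hlenI hfits
    (hl _ hN) (fun E hE => hlim _ _ _ _ hE)
    (fun r₁ r₂ => (hsize r₁ r₂).1.trans (hpow 24 (by omega))) (fun r₁ r₂ => by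
      obtain ⟨s, t, e, ht, hs⟩ := hp (I.inst a b r₁ r₂).overlapInstance (hdom x r₁ r₂) (U ^ 24) w
        (hsize r₁ r₂).1 (hsize r₁ r₂).2 (by rw [← pow_mul]; exact hpow _ (by omega))
      refine ⟨s, t, e, Nat.le_floor ?_, hs⟩
      have htime : (max (((I.inst a b r₁ r₂).overlapInstance.n : ℝ) ^ 2)
          (((I.inst a b r₁ r₂).overlapInstance.n : ℝ) *
            ((I.inst a b r₁ r₂).overlapInstance.m : ℝ) ^ 2)) ^ (1 - ε) =
          overlapTime ε x.n (I.m a b) := by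
        have h1 : (I.inst a b r₁ r₂).overlapInstance.n = 18 * x.n + 6 := SumData.P_length _
        have h2 : (I.inst a b r₁ r₂).overlapInstance.m = 16 * I.m a b + 6 := SumData.Q_length _
        rw [h1, h2, overlapTime]
        push_cast
        rfl
      replace ht := ht.trans_eq (congrArg (C * ·) htime)
      exact ht.trans (mul_le_mul_of_nonneg_right (le_abs_self C) (overlapTime_nonneg _ _ _)))
  refine ⟨s, t, by rw [henc]; exact e, ?_, hs.trans (hans x).symm⟩
  refine le_trans ?_ (hC' x)
  have h1 : (t : ℝ) ≤ (I.R a b (l x.n) * I.R a b (l x.n) * (K * I.N + 4 *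
      ⌊|C| * overlapTime ε x.n (I.m a b)⌋₊) : ℕ) := by exact_mod_cast ht
  have h2 : (⌊|C| * overlapTime ε x.n (I.m a b)⌋₊ : ℝ) ≤ |C| * overlapTime ε x.n (I.m a b) :=
    Nat.floor_le (mul_nonneg (abs_nonneg _) (overlapTime_nonneg _ _ _))
  refine h1.trans ?_
  push_cast
  rw [← sq]
  refine mul_le_mul_of_nonneg_left ?_ (by positivity)
  have : (I.N : ℝ) = x.n := rfl
  rw [this]
  linarith

/-! ### Arithmetic of the running times and of the regimes -/

theorem overlapTime_le {ε e : ℝ} {n m : ℕ} (he : e ≤ ε) (he1 : e ≤ 1) (he0 : 0 ≤ e) {Y : ℝ}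
    (hn : 1 ≤ n) (hm : 1 ≤ m) (h1 : (n : ℝ) ^ 2 ≤ Y) (h2 : (n : ℝ) * (m : ℝ) ^ 2 ≤ Y) :
    overlapTime ε n m ≤ 11616 * Y ^ (1 - e) := by
  have hn' : (1 : ℝ) ≤ n := by exact_mod_cast hn
  have hm' : (1 : ℝ) ≤ m := by exact_mod_cast hm
  have hY : 0 ≤ Y := (by positivity : (0 : ℝ) ≤ (n : ℝ) ^ 2).trans h1
  -- Here 18n + 6 ≤ 24n and 16m + 6 ≤ 22m, and 11616 = 24 · 22².
  have hle : max ((18 * n + 6 : ℝ) ^ 2) ((18 * n + 6) * (16 * m + 6) ^ 2) ≤ 11616 * Y := by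
    refine max_le ?_ ?_
    · calc (18 * n + 6 : ℝ) ^ 2 ≤ (24 * n) ^ 2 := by gcongr; linarith
        _ = 576 * (n : ℝ) ^ 2 := by ring
        _ ≤ 11616 * Y := by linarith
    · calc (18 * n + 6 : ℝ) * (16 * m + 6) ^ 2 ≤ (24 * n) * (22 * m) ^ 2 := by
            gcongr <;> linarith
        _ = 11616 * ((n : ℝ) * (m : ℝ) ^ 2) := by ring
        _ ≤ 11616 * Y := by linarith
  have hone : 1 ≤ max ((18 * n + 6 : ℝ) ^ 2) ((18 * n + 6) * (16 * m + 6) ^ 2) :=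
    le_max_of_le_left (by nlinarith)
  calc overlapTime ε n m ≤
        max ((18 * n + 6 : ℝ) ^ 2) ((18 * n + 6) * (16 * m + 6) ^ 2) ^ (1 - e) :=
        Real.rpow_le_rpow_of_exponent_le hone (by linarith)
    _ ≤ (11616 * Y) ^ (1 - e) := Real.rpow_le_rpow (by linarith) hle (by linarith)
    _ = 11616 ^ (1 - e) * Y ^ (1 - e) := Real.mul_rpow (by norm_num) hY
    _ ≤ 11616 * Y ^ (1 - e) := by
        refine mul_le_mul_of_nonneg_right ?_ (Real.rpow_nonneg hY _)
        calc (11616 : ℝ) ^ (1 - e) ≤ 11616 ^ (1 : ℝ) :=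
              Real.rpow_le_rpow_of_exponent_le (by norm_num) (by linarith)
          _ = _ := Real.rpow_one _

/-- As n ≤ m², the maximum is nm². Weakening (m²)^(1-e) to m² lets the number of queries cancel it:
R²m² ≤ 4n². The same estimate bounds the time for writing the instances. -/
theorem five_time_le {ε e : ℝ} {n m R : ℕ} (he : e ≤ ε) (he1 : e ≤ 1) (he0 : 0 ≤ e) (hn : 1 ≤ n)
    (hm : 1 ≤ m) (hnm : n ≤ m ^ 2) (hR : R * m ≤ 2 * n) {K C : ℝ} (hK : 0 ≤ K) (hC : 0 ≤ C) :
    (R : ℝ) ^ 2 * (K * n + C * overlapTime ε n m) ≤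
      (4 * K + 46464 * C) * (n : ℝ) ^ (3 - e) := by
  have hn' : (1 : ℝ) ≤ n := by exact_mod_cast hn
  have hm' : (1 : ℝ) ≤ m := by exact_mod_cast hm
  have hnm' : (n : ℝ) ≤ (m : ℝ) ^ 2 := by exact_mod_cast hnm
  have hRm : ((R : ℝ) * m) ^ 2 ≤ (2 * n) ^ 2 := by
    have : (R : ℝ) * m ≤ 2 * n := by exact_mod_cast hR
    gcongr
  have h1 : (R : ℝ) ^ 2 * n ≤ 4 * (n : ℝ) ^ (3 - e) := by
    calc (R : ℝ) ^ 2 * n ≤ (R : ℝ) ^ 2 * (m : ℝ) ^ 2 := by gcongr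
      _ = (R * m : ℝ) ^ 2 := by ring
      _ ≤ (2 * n) ^ 2 := hRm
      _ = 4 * (n : ℝ) ^ (2 : ℝ) := by rw [Real.rpow_two]; ring
      _ ≤ _ := by
        gcongr
        linarith
  have h2 : (R : ℝ) ^ 2 * overlapTime ε n m ≤ 46464 * (n : ℝ) ^ (3 - e) := by
    have ht := overlapTime_le (Y := (n : ℝ) * (m : ℝ) ^ 2) he he1 he0 hn hm
      (by rw [sq]; gcongr) le_rfl
    have hpos : 0 < (n : ℝ) * (m : ℝ) ^ 2 := by positivity
    have hY : ((n : ℝ) * (m : ℝ) ^ 2) ^ (1 - e) ≤ (m : ℝ) ^ 2 * (n : ℝ) ^ (1 - e) := by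
      rw [Real.mul_rpow (by positivity) (by positivity), mul_comm]
      gcongr
      calc ((m : ℝ) ^ 2) ^ (1 - e) ≤ ((m : ℝ) ^ 2) ^ (1 : ℝ) :=
            Real.rpow_le_rpow_of_exponent_le (by nlinarith) (by linarith)
        _ = _ := Real.rpow_one _
    calc (R : ℝ) ^ 2 * overlapTime ε n m
        ≤ (R : ℝ) ^ 2 * (11616 * ((m : ℝ) ^ 2 * (n : ℝ) ^ (1 - e))) := by
          gcongr
          exact ht.trans (by gcongr)
      _ = 11616 * ((R * m : ℝ) ^ 2 * (n : ℝ) ^ (1 - e)) := by ring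
      _ ≤ 11616 * ((2 * n) ^ 2 * (n : ℝ) ^ (1 - e)) := by gcongr
      _ = 46464 * ((n : ℝ) ^ (2 : ℝ) * (n : ℝ) ^ (1 - e)) := by rw [Real.rpow_two]; ring
      _ = _ := by
        rw [← Real.rpow_add (by linarith)]
        congr 2
        ring
  calc (R : ℝ) ^ 2 * (K * n + C * overlapTime ε n m)
      = K * ((R : ℝ) ^ 2 * n) + C * ((R : ℝ) ^ 2 * overlapTime ε n m) := by ring
    _ ≤ K * (4 * (n : ℝ) ^ (3 - e)) + C * (46464 * (n : ℝ) ^ (3 - e)) := by gcongr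
    _ = _ := by ring

/-- As m² ≤ 4n, the maximum is at most 4n², and 2(1 - e) ≤ 2 - e. -/
theorem three_time_le {ε e : ℝ} {n m : ℕ} (he : e ≤ ε) (he1 : e ≤ 1) (he0 : 0 ≤ e) (hn : 1 ≤ n)
    (hm : 1 ≤ m) (hnm : m ^ 2 ≤ 4 * n) {K C : ℝ} (hK : 0 ≤ K) (hC : 0 ≤ C) :
    K * n + C * overlapTime ε n m ≤ (K + 46464 * C) * (n : ℝ) ^ (2 - e) := by
  have hn' : (1 : ℝ) ≤ n := by exact_mod_cast hn
  have hnm' : (m : ℝ) ^ 2 ≤ 4 * n := by exact_mod_cast hnm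
  have h1 : (n : ℝ) ≤ (n : ℝ) ^ (2 - e) := by
    calc (n : ℝ) = (n : ℝ) ^ (1 : ℝ) := (Real.rpow_one _).symm
      _ ≤ _ := Real.rpow_le_rpow_of_exponent_le hn' (by linarith)
  have h2 : overlapTime ε n m ≤ 46464 * (n : ℝ) ^ (2 - e) := by
    have ht := overlapTime_le (Y := 4 * (n : ℝ) ^ 2) he he1 he0 hn hm (by nlinarith)
      (by rw [sq (n : ℝ)]; nlinarith)
    have h4 : (4 : ℝ) ^ (1 - e) ≤ 4 := by
      calc (4 : ℝ) ^ (1 - e) ≤ 4 ^ (1 : ℝ) :=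
            Real.rpow_le_rpow_of_exponent_le (by norm_num) (by linarith)
        _ = _ := Real.rpow_one _
    have h5 : ((n : ℝ) ^ 2) ^ (1 - e) ≤ (n : ℝ) ^ (2 - e) := by
      rw [← Real.rpow_two, ← Real.rpow_mul (by linarith)]
      exact Real.rpow_le_rpow_of_exponent_le hn' (by linarith)
    rw [Real.mul_rpow (by norm_num) (by positivity)] at ht
    calc overlapTime ε n m ≤ 11616 * (4 * (n : ℝ) ^ (2 - e)) := ht.trans (by gcongr)
      _ = _ := by ring
  calc K * n + C * overlapTime ε n m ≤ K * (n : ℝ) ^ (2 - e) + C * (46464 * (n : ℝ) ^ (2 - e)) := by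
        gcongr
    _ = _ := by ring

namespace SumInput

variable (I : SumInput) {a b : ℕ}

/-- This is m ≥ N^(a/b) ≥ √N, checked on `b`-th powers to stay within the natural numbers. -/
theorem N_le_m_sq (hab : a ≤ b) (hb : 0 < b) (h : b ≤ 2 * a) : I.N ≤ I.m a b ^ 2 := by
  refine le_of_pow_le_pow_left₀ hb.ne' (by positivity) ?_
  calc I.N ^ b ≤ I.N ^ (2 * a) := Nat.pow_le_pow_right I.N_pos h
    _ = (I.N ^ a) ^ 2 := by rw [mul_comm, pow_mul]
    _ ≤ (I.m a b ^ b) ^ 2 := Nat.pow_le_pow_left (I.m_spec hab).1 2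
    _ = (I.m a b ^ 2) ^ b := by rw [← pow_mul, ← pow_mul, mul_comm]

theorem m_sq_le (hab : a ≤ b) (h : 2 * a ≤ b) : I.m a b ^ 2 ≤ 4 * I.N := by
  have hN := I.N_pos
  rcases (I.m_spec hab).2.2 with h1 | h1
  · rw [h1]; omega
  · have hlt : (I.m a b - 1) ^ 2 < I.N := by
      refine lt_of_pow_lt_pow_left₀ b (by positivity) ?_
      calc ((I.m a b - 1) ^ 2) ^ b = ((I.m a b - 1) ^ b) ^ 2 := by
            rw [← pow_mul, ← pow_mul, mul_comm]
        _ < (I.N ^ a) ^ 2 := Nat.pow_lt_pow_left h1 (by norm_num)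
        _ = I.N ^ (2 * a) := by rw [mul_comm, pow_mul]
        _ ≤ I.N ^ b := Nat.pow_le_pow_right hN h
    obtain ⟨y, hy⟩ : ∃ y, I.m a b = 1 + y := Nat.exists_eq_add_of_le (I.m_pos a b)
    rw [hy] at hlt ⊢
    rw [Nat.add_sub_cancel_left] at hlt
    -- For y ≥ 1 one has (1 + y)² ≤ 4y², and y² < N by minimality of m.
    rcases Nat.eq_zero_or_pos y with rfl | hy0
    · omega
    · nlinarith

/-- By minimality, one piece fewer would not cover the list, and a single piece has length at most
N. -/
theorem R_mul_m_le (hab : a ≤ b) : I.R a b I.N * I.m a b ≤ 2 * I.N := by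
  have hm := I.m_le hab
  rcases (I.R_spec a b le_rfl).2.2 with h | h
  · rw [h]; omega
  · obtain ⟨y, hy⟩ := Nat.exists_eq_add_of_le (leastFrom_pos (fun i => I.N ≤ i * I.m a b) I.N)
    have hy : I.R a b I.N = 1 + y := hy
    rw [hy, Nat.add_sub_cancel_left] at h
    rw [hy, add_mul]
    omega

theorem R_one (a b : ℕ) : I.R a b 1 = 1 := by
  have hm := I.m_pos a b
  rcases (I.R_spec a b (lim := 1) I.N_pos).2.2 with h | h
  · exact h
  · have hR : 1 ≤ I.R a b 1 := leastFrom_pos _ _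
    rw [Nat.lt_one_iff, Nat.mul_eq_zero] at h
    omega

/-- The search gives N^γ ≤ m ≤ 2N^γ; the constant 100 absorbs the linear growth from N and m to the
numbers of vertices. -/
theorem regime (hab : a ≤ b) (hb : 0 < b) {γ : ℝ} (hγ : γ = a / b) (r₁ r₂ : ℕ) :
    (I.inst a b r₁ r₂).overlapInstance.m ≤ (I.inst a b r₁ r₂).overlapInstance.n ∧
      ((I.inst a b r₁ r₂).overlapInstance.n : ℝ) ^ γ ≤
        100 * ((I.inst a b r₁ r₂).overlapInstance.m : ℝ) ∧
      ((I.inst a b r₁ r₂).overlapInstance.m : ℝ) ≤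
        100 * ((I.inst a b r₁ r₂).overlapInstance.n : ℝ) ^ γ := by
  have h1 : (I.inst a b r₁ r₂).overlapInstance.n = 18 * I.N + 6 := SumData.P_length _
  have h2 : (I.inst a b r₁ r₂).overlapInstance.m = 16 * I.m a b + 6 := SumData.Q_length _
  have hm := I.m_le hab
  have hm0 : (1 : ℝ) ≤ I.m a b := by exact_mod_cast I.m_pos a b
  have hN : (1 : ℝ) ≤ I.N := by exact_mod_cast I.N_pos
  have hb' : (0 : ℝ) < b := by exact_mod_cast hb
  have hγ0 : 0 ≤ γ := by rw [hγ]; positivity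
  have hγ1 : γ ≤ 1 := by rw [hγ, div_le_one hb']; exact_mod_cast hab
  have hpow : ((I.N : ℝ) ^ γ) ^ b = (I.N : ℝ) ^ a := by
    rw [← Real.rpow_natCast, ← Real.rpow_mul (by linarith), hγ, div_mul_cancel₀ _ hb'.ne',
      Real.rpow_natCast]
  have hNγ : (1 : ℝ) ≤ (I.N : ℝ) ^ γ := Real.one_le_rpow hN hγ0
  have hlow : (I.N : ℝ) ^ γ ≤ I.m a b := by
    refine le_of_pow_le_pow_left₀ hb.ne' (by positivity) ?_
    rw [hpow]
    exact_mod_cast (I.m_spec hab).1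
  have hup : (I.m a b : ℝ) ≤ 2 * (I.N : ℝ) ^ γ := by
    rcases (I.m_spec hab).2.2 with h | h
    · rw [h]; push_cast; linarith
    · have hlt : ((I.m a b - 1 : ℕ) : ℝ) < (I.N : ℝ) ^ γ := by
        refine lt_of_pow_lt_pow_left₀ b (by positivity) ?_
        rw [hpow]
        exact_mod_cast h
      rw [Nat.cast_sub (I.m_pos a b)] at hlt
      push_cast at hlt
      linarith
  rw [h1, h2]
  refine ⟨by omega, ?_, ?_⟩
  · push_cast
    calc (18 * (I.N : ℝ) + 6) ^ γ ≤ (24 * I.N) ^ γ :=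
          Real.rpow_le_rpow (by positivity) (by linarith) hγ0
      _ = 24 ^ γ * (I.N : ℝ) ^ γ := Real.mul_rpow (by norm_num) (by linarith)
      _ ≤ 24 ^ (1 : ℝ) * (I.N : ℝ) ^ γ := by
          gcongr
          norm_num
      _ ≤ 100 * (16 * I.m a b + 6) := by rw [Real.rpow_one]; linarith
  · push_cast
    have : (I.N : ℝ) ^ γ ≤ (18 * (I.N : ℝ) + 6) ^ γ :=
      Real.rpow_le_rpow (by linarith) (by linarith) hγ0
    linarith

end SumInput

theorem not_overlapSolvable (h : KSumHypothesis) {γ : ℚ} (hγ0 : 0 ≤ γ) (hγ1 : γ ≤ 1) {ε : ℝ}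
    (hε : 0 < ε) : ¬ OverlapSolvable (fun x => x.m ≤ x.n ∧
      (x.n : ℝ) ^ (γ : ℝ) ≤ 100 * (x.m : ℝ) ∧ (x.m : ℝ) ≤ 100 * (x.n : ℝ) ^ (γ : ℝ)) ε := by
  intro hsolv
  obtain ⟨a, ha⟩ := Int.eq_ofNat_of_zero_le (Rat.num_nonneg.2 hγ0)
  have hb : 0 < γ.den := γ.den_pos
  generalize hbdef : γ.den = b at hb
  have hγ : (γ : ℝ) = a / b := by
    rw [Rat.cast_def, ha, hbdef]
    push_cast
    rfl
  have hab : a ≤ b := by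
    have : (γ : ℝ) ≤ 1 := by exact_mod_cast hγ1
    rw [hγ, div_le_one (by exact_mod_cast hb)] at this
    exact_mod_cast this
  -- A large `ε` would make the exponents negative; a smaller saving already contradicts the
  -- hypothesis.
  set e := min ε (1 / 2) with he
  have he0 : 0 < e := lt_min hε (by norm_num)
  have heε : e ≤ ε := min_le_left _ _
  have he1 : e ≤ 1 := (min_le_right _ _).trans (by norm_num)
  -- The alternatives are γ ≥ 1/2, with pieces that cover whole lists, and γ ≤ 1/2, with a single
  -- piece.
  rcases le_total b (2 * a) with hba | hba
  · refine h 5 (by norm_num) e he0 (KSumInstance.solvable_of_overlapSolvable (a := a) (b := b)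
      (lim := .var 1) (l := fun n => n) (by norm_num) hab (fun n _ => le_rfl)
      (fun w inp E n hE => .var hE) (fun x r₁ r₂ => (x.sumInput _).regime hab hb hγ r₁ r₂)
      (fun x => x.hasSolution_five_iff) ?_ hsolv)
    intro K C hK hC
    refine ⟨4 * K + 46464 * C, fun x => ?_⟩
    have hceil : ((⌈((5 : ℕ) : ℝ) / 2⌉₊ : ℕ) : ℝ) = 3 := by
      have : ⌈((5 : ℕ) : ℝ) / 2⌉₊ = 3 := by
        rw [Nat.ceil_eq_iff (by norm_num)]; norm_num
      rw [this]; norm_num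
    rw [hceil]
    exact five_time_le heε he1 he0.le x.n_pos ((x.sumInput (by norm_num)).m_pos a b)
      ((x.sumInput (by norm_num)).N_le_m_sq hab hb hba) ((x.sumInput (by norm_num)).R_mul_m_le hab)
      hK hC
  · refine h 3 (by norm_num) e he0 (KSumInstance.solvable_of_overlapSolvable (a := a) (b := b)
      (lim := .const 1) (l := fun _ => 1) le_rfl hab (fun n hn => hn)
      (fun w inp E n _ => .const 1) (fun x r₁ r₂ => (x.sumInput _).regime hab hb hγ r₁ r₂)
      (fun x => x.hasSolution_three_iff) ?_ hsolv)
    intro K C hK hC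
    refine ⟨K + 46464 * C, fun x => ?_⟩
    have hceil : ((⌈((3 : ℕ) : ℝ) / 2⌉₊ : ℕ) : ℝ) = 2 := by
      have : ⌈((3 : ℕ) : ℝ) / 2⌉₊ = 2 := by
        rw [Nat.ceil_eq_iff (by norm_num)]; norm_num
      rw [this]; norm_num
    rw [hceil, SumInput.R_one, Nat.cast_one, one_pow, one_mul]
    exact three_time_le heε he1 he0.le x.n_pos ((x.sumInput le_rfl).m_pos a b)
      ((x.sumInput le_rfl).m_sq_le hab hba) hK hC

theorem theorem2 (h : KSumHypothesis) :
    (∀ ε : ℝ, 0 < ε → ¬ OverlapSolvable (fun x => x.m ≤ x.n) ε) ∧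
    (∀ γ : ℚ, 0 ≤ γ → γ ≤ 1 → ∃ c : ℝ, 0 < c ∧ ∀ ε : ℝ, 0 < ε →
      ¬ OverlapSolvable (fun x => x.m ≤ x.n ∧
        (x.n : ℝ) ^ (γ : ℝ) ≤ c * (x.m : ℝ) ∧ (x.m : ℝ) ≤ c * (x.n : ℝ) ^ (γ : ℝ)) ε) := by
  refine ⟨fun ε hε hs => ?_, fun γ hγ0 hγ1 => ⟨100, by norm_num, fun ε hε =>
    not_overlapSolvable h hγ0 hγ1 hε⟩⟩
  -- The regime γ = 0, in which m is bounded, is a subclass of all instances, so it already shows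
  -- the bound.
  exact not_overlapSolvable h (γ := 0) le_rfl zero_le_one hε (hs.mono_dom fun x hx => hx.1)
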